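/- Fix $d\in\mathbb N$ and call a real $d\times d$ matrix a similarity matrix if it is the product of a positive scalar and an orthogonal matrix. Let $|\cdot|$ denote the Euclidean norm on $\mathbb R^d$ and also the corresponding operator norm of matrices. Let $\mathcal Z=\sum_{j=1}^N\delta_{X_j}$ be a point process of similarity matrices, where $N\in\{0,1,2,\ldots\}\cup\{\infty\}$ is random and $\mathbb E[N]>1$. Let $\mathcal Z(u)=\sum_{j=1}^{N(u)}\delta_{X_j(u)}$, where $u$ ranges over the finite words over $\{1,2,\ldots\}$, be i.i.d. copies of $\mathcal Z$ on a probability space; that is, the sequences $(X_j(u))_{1\le j\le N(u)}$ are i.i.d. in $u$. Put $\mathcal G_0=\{\varnothing\}$ and $\mathcal G_{n+1}=\{uj: u\in\mathcal G_n,\ 1\le j\le N(u)\}$, write $|u|=n$ for $u\in\mathcal G_n$, and let $L(\varnothing)$ be the identity matrix and $L(uj)=L(u)X_j(u)$. Suppose that the matrix $\mathbb E[\sum_{|u|=1}L(u)]$ has finite entries (with absolute convergence, i.e. $\mathbb E[\sum_{|u|=1}|L(u)_{ab}|]<\infty$ for all $a,b$), and that $0\ne w\in\mathbb R^d$ is a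 right eigenvector of this matrix for the eigenvalue $1$. Let $$Z_nw:=\sum_{|u|=n}L(u)w,\qquad n\ge 0,$$ and assume that $\mathbb P(Z_1w=w)<1$. Let $\alpha\in(1,2)$ be such that $$\mathbb E\Big[\sum_{|u|=1}|L(u)|^\alpha\Big]=1\quad\text{and}\quad \mathbb E\Big[\sum_{|u|=1}|L(u)|^\alpha\log|L(u)|\Big]\le 0$$ (the latter expectation being well defined in $[-\infty,0]$), and suppose that $$\mathbb E\big[|Z_1w|^\alpha(\log_+|Z_1w|)^{2+\epsilon}\big]<\infty\quad\text{for some }\epsilon>0.$$ Then for every $n$ the sum defining $Z_nw$ converges absolutely almost surely (indeed $\sum_{|u|=n}|L(u)|<\infty$ a.s.), and there is an $\mathbb R^d$-valued random variable $Z^w$ such that $Z_nw\to Z^w$ almost surely and, for every $p\in(0,\alpha)$, $Z_nw$ ($n\ge0$) and $Z^w$ lie in $L^p$ and $Z_nw\to Z^w$ in $L^p$. The limit is non-degenerate, i.e. $Z^w$ is not almost surely equal to a constant vector. -/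

import Mathlib

open MeasureTheory ProbabilityTheory Filter Topology
open scoped ENNReal Matrix Matrix.Norms.L2Operator

noncomputable section

namespace SimilarityBRW

/-- A similarity matrix: a positive scaling factor times an orthogonal matrix. -/
def IsSimilarity {d : ℕ} (A : Matrix (Fin d) (Fin d) ℝ) : Prop :=
  ∃ c : ℝ, 0 < c ∧ ∃ O ∈ Matrix.orthogonalGroup (Fin d) ℝ, A = c • O

/-
Individuals are finite words over the natural numbers, stored as lists with the most recent
letter first: `j :: u` is the child number `j` (counted from `0`) of the individual `u`, and `[]`
is the ancestor. The point process of `u` is the sum of the Dirac masses at `X u j`, where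
`0 ≤ j < N u`. The number `N u` of children may be infinite.
-/

variable {d : ℕ} {Ω : Type*}

/-- The offspring sequence of the individual `u`: the number of its children together with the
matrices `X u j` for `j < N u`. The values of `X u j` for `j ≥ N u` have no meaning and are
replaced by `0`. -/
def offspring (N : List ℕ → Ω → ℕ∞) (X : List ℕ → ℕ → Ω → Matrix (Fin d) (Fin d) ℝ)
    (u : List ℕ) (ω : Ω) : ℕ∞ × (ℕ → Fin d → Fin d → ℝ) :=
  (N u ω, fun j a b => open Classical in if (j : ℕ∞) < N u ω then X u j ω a b else 0)

/-- The set of the individuals of generation `n`. -/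
def generation (N : List ℕ → Ω → ℕ∞) : ℕ → Ω → Set (List ℕ)
  | 0, _ => {[]}
  | n + 1, ω => {v | ∃ u ∈ generation N n ω, ∃ j : ℕ, (j : ℕ∞) < N u ω ∧ v = j :: u}

/-- The weights: `L(∅) = 1` and `L(uj) = L(u) X_j(u)`. -/
def weight (X : List ℕ → ℕ → Ω → Matrix (Fin d) (Fin d) ℝ) :
    List ℕ → Ω → Matrix (Fin d) (Fin d) ℝ
  | [], _ => 1
  | j :: u, ω => weight X u ω * X u j ω

/-- `Z_n w`, the sum of `L(u) w` over the individuals `u` of generation `n`. -/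
def Z (N : List ℕ → Ω → ℕ∞) (X : List ℕ → ℕ → Ω → Matrix (Fin d) (Fin d) ℝ)
    (w : EuclideanSpace ℝ (Fin d)) (n : ℕ) (ω : Ω) : EuclideanSpace ℝ (Fin d) :=
  ∑' u : generation N n ω, Matrix.toEuclideanLin (weight X u ω) w

variable [MeasurableSpace Ω]

/-- The entries of the mean matrix, the expectation of the sum of `L(u)` over the first generation,
are finite, in the sense of absolute convergence. -/
def HasFiniteMean (P : Measure Ω) (N : List ℕ → Ω → ℕ∞)
    (X : List ℕ → ℕ → Ω → Matrix (Fin d) (Fin d) ℝ) : Prop :=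
  ∀ a b : Fin d, ∫⁻ ω, ∑' u : generation N 1 ω, ENNReal.ofReal |weight X u ω a b| ∂P < ∞

/-- The mean matrix, the expectation of the sum of `L(u)` over the first generation. -/
def meanMatrix (P : Measure Ω) (N : List ℕ → Ω → ℕ∞)
    (X : List ℕ → ℕ → Ω → Matrix (Fin d) (Fin d) ℝ) : Matrix (Fin d) (Fin d) ℝ :=
  Matrix.of fun a b => ∫ ω, ∑' u : generation N 1 ω, weight X u ω a b ∂P

/-- The index `α` is characteristic: the sum of `|L(u)| ^ α` over the first generation has
expectation `1`, and the sum of `|L(u)| ^ α * log |L(u)|` over the first generation has a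
well-defined expectation in `[-∞, 0]`. The latter says that the expectation of the sum of the
positive parts is finite and at most the expectation of the sum of the negative parts. -/
structure IsCharacteristicIndex (P : Measure Ω) (N : List ℕ → Ω → ℕ∞)
    (X : List ℕ → ℕ → Ω → Matrix (Fin d) (Fin d) ℝ) (α : ℝ) : Prop where
  moment_eq_one :
    ∫⁻ ω, ∑' u : generation N 1 ω, ENNReal.ofReal (‖weight X u ω‖ ^ α) ∂P = 1
  posPart_finite :
    ∫⁻ ω, ∑' u : generation N 1 ω,
      ENNReal.ofReal (‖weight X u ω‖ ^ α * Real.log ‖weight X u ω‖) ∂P < ∞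
  posPart_le_negPart :
    ∫⁻ ω, ∑' u : generation N 1 ω,
      ENNReal.ofReal (‖weight X u ω‖ ^ α * Real.log ‖weight X u ω‖) ∂P ≤
    ∫⁻ ω, ∑' u : generation N 1 ω,
      ENNReal.ofReal (-(‖weight X u ω‖ ^ α * Real.log ‖weight X u ω‖)) ∂P

/-- The moment condition `E[|Z_1 w| ^ α * (log⁺ |Z_1 w|) ^ (2 + ε)] < ∞` for some `ε > 0`. -/
def HasLogMoment (P : Measure Ω) (N : List ℕ → Ω → ℕ∞)
    (X : List ℕ → ℕ → Ω → Matrix (Fin d) (Fin d) ℝ)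
    (w : EuclideanSpace ℝ (Fin d)) (α : ℝ) : Prop :=
  ∃ ε : ℝ, 0 < ε ∧
    ∫⁻ ω, ENNReal.ofReal (‖Z N X w 1 ω‖ ^ α * Real.posLog ‖Z N X w 1 ω‖ ^ (2 + ε)) ∂P < ∞

end SimilarityBRW

end

set_option linter.unusedSectionVars false

namespace SimilarityBRW

/-! Telescoping expresses `Z_n w - w` as the sum of `L(u) D(u)` over all words `u` of length less
than `n`, where the innovation `D(u)` is the sum of the vectors `X_j(u) w` minus `w`. The
eigenvector equation centres `D(u)`, and `D(u)` is independent of `L(u)`, so each coordinate of `Z_n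
w` is a martingale. Everything then rests on the tail bound `P(|Z_n w - w| > 2t) ≤ C (1 + log t)
t^(-α)`, uniform in `n` (`exists_tail_process`). It bounds the process in `L^q` for every `q < α`.
As `α > 1`, martingale convergence gives the almost sure limit and uniform integrability gives `L^p`
convergence. Convergence in `L^1` closes the martingale, so a constant limit would force `Z_1 w =
w`.

For the tail bound, ancestral lines are cut when their weight first exceeds `t`. Since the `α`-th
powers of the weights have mean sum one, some line is cut with probability at most `t^(-α)`
(`measure_not_below_le`). On the remaining lines `D(u)` is truncated where `|L(u)| |D(u)| ≤ t`. The
centred truncated terms are orthogonal in `L²` and are handled by Chebyshev's inequality; what is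
left over is handled by Markov's. For a given innovation, both estimates ask for the expected sum of
`|L(u)|^q` over uncut lines, with `|L(u)| ≤ B` for `q = 2` and `|L(u)| > B` for `q = 1`, where `B =
t / |D|`. The bound `C (1 + log t) B^(q - α)` of `exists_moment_bound` turns either one into a
multiple of `(1 + log t) t^(-α) E|D|^α`.

That bound comes from `many_to_one`: biased by `|L(u)|^α`, the logarithm of the weight along a line
is a random walk killed above `log t`. Whatever the drift, the killed walk spends expected time at
most `C (1 + log t)` in any interval of a fixed short length (`exists_green_bound`). To see this,
the path is split where it attains its maximum. The first piece ends at an ascending record of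
height at most `log t`; the second, reversed in time, ends at its minimum. The expected number of
extrema in a given short interval is bounded, because after each of them a jump out of the interval
has a fixed probability, and no later extremum of the same kind can return to it. Supercriticality
ensures that downward steps occur.

Conformality makes operator norms multiplicative, so scalar weights carry these estimates, and
absent children are encoded by zero matrices. -/

/-- The σ-algebra generated by the `ξ i` with `i ∈ s`. -/
abbrev sigmaOf {ι Ω Θ : Type*} [MeasurableSpace Θ] (ξ : ι → Ω → Θ) (s : Set ι) :
    MeasurableSpace Ω :=
  ⨆ i ∈ s, MeasurableSpace.comap (ξ i) inferInstance

/-! ### Freezing one of two independent blocks of marks -/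

section Independence

variable {ι Ω Θ β γ : Type*} [MeasurableSpace Θ] [MeasurableSpace β]
  [MeasurableSpace γ] {ξ : ι → Ω → Θ}

theorem measurable_sigmaOf {s : Set ι} {i : ι} (hi : i ∈ s) : Measurable[sigmaOf ξ s] (ξ i) := by
  have h : MeasurableSpace.comap (ξ i) inferInstance ≤ sigmaOf ξ s :=
    le_iSup₂_of_le (f := fun i (_ : i ∈ s) => MeasurableSpace.comap (ξ i) inferInstance) i hi le_rfl
  exact (comap_measurable (ξ i)).mono h le_rfl

theorem sigmaOf_mono {s t : Set ι} (h : s ⊆ t) : sigmaOf ξ s ≤ sigmaOf ξ t :=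
  biSup_mono h

variable [mΩ : MeasurableSpace Ω]

theorem sigmaOf_le (hξ : ∀ i, Measurable (ξ i)) (s : Set ι) : sigmaOf ξ s ≤ mΩ :=
  iSup₂_le fun i _ => (hξ i).comap_le

variable {P : Measure Ω}

theorem indepFun_of_sigmaOf (hξ : ∀ i, Measurable (ξ i)) (hi : iIndepFun ξ P)
    {s t : Set ι} (hst : Disjoint s t) {F : Ω → β} {G : Ω → γ}
    (hF : Measurable[sigmaOf ξ s] F) (hG : Measurable[sigmaOf ξ t] G) : IndepFun F G P := by
  rw [IndepFun_iff_Indep]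
  have h := indep_iSup_of_disjoint (m := fun i => MeasurableSpace.comap (ξ i) inferInstance)
    (fun i => (hξ i).comap_le) hi.iIndep hst
  exact indep_of_indep_of_le h hF.comap_le hG.comap_le

/-- This replaces conditional expectations in the estimates: functions of disjoint blocks of marks
have a product law, so one may be frozen while the other is integrated against its own law. -/
theorem lintegral_of_sigmaOf [IsFiniteMeasure P] (hξ : ∀ i, Measurable (ξ i)) (hi : iIndepFun ξ P)
    {s t : Set ι} (hst : Disjoint s t) {F : Ω → β} {G : Ω → γ}
    (hF : Measurable[sigmaOf ξ s] F) (hG : Measurable[sigmaOf ξ t] G)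
    {h : β × γ → ℝ≥0∞} (hh : Measurable h) :
    ∫⁻ ω, h (F ω, G ω) ∂P = ∫⁻ ω, ∫⁻ g, h (F ω, g) ∂(P.map G) ∂P := by
  have hF' : Measurable F := hF.mono (sigmaOf_le hξ s) le_rfl
  have hG' : Measurable G := hG.mono (sigmaOf_le hξ t) le_rfl
  have h1 := (indepFun_iff_map_prod_eq_prod_map_map hF'.aemeasurable hG'.aemeasurable).1
    (indepFun_of_sigmaOf hξ hi hst hF hG)
  rw [← lintegral_map hh (hF'.prodMk hG'), h1, lintegral_prod _ hh.aemeasurable,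
    lintegral_map hh.lintegral_prod_right' hF']

theorem integral_of_sigmaOf [IsFiniteMeasure P] (hξ : ∀ i, Measurable (ξ i)) (hi : iIndepFun ξ P)
    {s t : Set ι} (hst : Disjoint s t) {F : Ω → β} {G : Ω → γ}
    (hF : Measurable[sigmaOf ξ s] F) (hG : Measurable[sigmaOf ξ t] G)
    {h : β × γ → ℝ} (hh : Measurable h) (hint : Integrable (fun ω => h (F ω, G ω)) P) :
    ∫ ω, h (F ω, G ω) ∂P = ∫ ω, ∫ g, h (F ω, g) ∂(P.map G) ∂P := by
  have hF' : Measurable F := hF.mono (sigmaOf_le hξ s) le_rfl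
  have hG' : Measurable G := hG.mono (sigmaOf_le hξ t) le_rfl
  have h1 := (indepFun_iff_map_prod_eq_prod_map_map hF'.aemeasurable hG'.aemeasurable).1
    (indepFun_of_sigmaOf hξ hi hst hF hG)
  have h2 : Integrable h ((P.map F).prod (P.map G)) := by
    rw [← h1]
    exact (integrable_map_measure hh.aestronglyMeasurable (hF'.prodMk hG').aemeasurable).2 hint
  have h3 := integral_map (hF'.prodMk hG').aemeasurable (μ := P) (f := h)
    hh.aestronglyMeasurable
  rw [← h3, h1, integral_prod _ h2, integral_map hF'.aemeasurable]
  exact (hh.stronglyMeasurable.integral_prod_right').aestronglyMeasurable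

end Independence

/-! ### Random walks with i.i.d. steps and their records -/

section Walk

/-- The partial sums of a sequence. -/
def walk (ω : ℕ → ℝ) (n : ℕ) : ℝ := ∑ i ∈ Finset.range n, ω i

@[simp] theorem walk_zero (ω : ℕ → ℝ) : walk ω 0 = 0 := by simp [walk]

theorem walk_succ (ω : ℕ → ℝ) (n : ℕ) : walk ω (n + 1) = walk ω n + ω n := by
  simp [walk, Finset.sum_range_succ]

theorem walk_add (ω : ℕ → ℝ) (k n : ℕ) :
    walk ω (k + n) = walk ω k + walk (fun i => ω (i + k)) n := by
  simp only [walk, Finset.sum_range_add]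
  simp [add_comm]

@[fun_prop] theorem measurable_walk (n : ℕ) : Measurable fun ω : ℕ → ℝ => walk ω n := by
  unfold walk; fun_prop

theorem measurable_walk_sigmaOf {n k : ℕ} (h : n ≤ k) :
    Measurable[sigmaOf (fun (i : ℕ) (ω : ℕ → ℝ) => ω i) (Set.Iio k)]
      fun ω : ℕ → ℝ => walk ω n := by
  unfold walk
  refine Finset.measurable_fun_sum _ fun i hi => ?_
  exact measurable_sigmaOf (ξ := fun (i : ℕ) (ω : ℕ → ℝ) => ω i) (s := Set.Iio k) (i := i)
    (lt_of_lt_of_le (Finset.mem_range.1 hi) h)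

variable (μ : Measure ℝ) [IsProbabilityMeasure μ]

/-- The law of an i.i.d. sequence with marginal `μ`. -/
noncomputable abbrev iidLaw : Measure (ℕ → ℝ) := Measure.infinitePi fun _ : ℕ => μ

theorem iIndepFun_iidLaw : iIndepFun (fun (i : ℕ) (ω : ℕ → ℝ) => ω i) (iidLaw μ) :=
  iIndepFun_infinitePi (X := fun _ x => x) (fun _ => measurable_id)

/-- Used twice: for reversing an initial segment of the steps and for the shift after a fixed time.
-/
theorem map_reindex_iidLaw {f : ℕ → ℕ} (hf : f.Injective) :
    (iidLaw μ).map (fun ω i => ω (f i)) = iidLaw μ :=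
  Measure.map_infinitePi_infinitePi_of_inj hf

/-- Times at which the walk is at a weak minimum located in an interval of length `δ`:
a jump below `-δ` makes the walk leave this interval for good. -/
theorem tsum_record_mul_le (y δ : ℝ) :
    (∑' j, iidLaw μ {ω | (∀ i ≤ j, walk ω j ≤ walk ω i) ∧ walk ω j ∈ Set.Icc y (y + δ)})
      * μ (Set.Iio (-δ)) ≤ 1 := by
  set A : ℕ → Set (ℕ → ℝ) :=
    fun j => {ω | (∀ i ≤ j, walk ω j ≤ walk ω i) ∧ walk ω j ∈ Set.Icc y (y + δ)} with hA
  set B : ℕ → Set (ℕ → ℝ) := fun j => {ω | ω j < -δ} with hB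
  have hAm : ∀ j, MeasurableSet[sigmaOf (fun (i : ℕ) (ω : ℕ → ℝ) => ω i) (Set.Iio j)] (A j) := by
    intro j
    have e : A j = (⋂ i ∈ Set.Iic j, {ω | walk ω j ≤ walk ω i}) ∩
        (fun ω => walk ω j) ⁻¹' Set.Icc y (y + δ) := by
      ext ω; simp [hA]
    rw [e]
    refine MeasurableSet.inter (MeasurableSet.biInter (Set.to_countable _) fun i hi => ?_) ?_
    · exact measurableSet_le (measurable_walk_sigmaOf le_rfl) (measurable_walk_sigmaOf hi)
    · exact measurable_walk_sigmaOf le_rfl measurableSet_Icc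
  have hBm : ∀ j, MeasurableSet[sigmaOf (fun (i : ℕ) (ω : ℕ → ℝ) => ω i) {j}] (B j) := fun j =>
    measurable_sigmaOf (ξ := fun (i : ℕ) (ω : ℕ → ℝ) => ω i) (s := {j}) rfl measurableSet_Iio
  have hmeas : ∀ i : ℕ, Measurable fun ω : ℕ → ℝ => ω i := fun i => measurable_pi_apply i
  have hBP : ∀ j, iidLaw μ (B j) = μ (Set.Iio (-δ)) := by
    intro j
    have h := Measure.infinitePi_map_eval (fun _ : ℕ => μ) j
    conv_rhs => rw [← h]
    rw [Measure.map_apply (hmeas j) measurableSet_Iio]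
    rfl
  have hprod : ∀ j, iidLaw μ (A j ∩ B j) = iidLaw μ (A j) * μ (Set.Iio (-δ)) := by
    intro j
    rw [← hBP j]
    have h := indep_iSup_of_disjoint
      (m := fun i => MeasurableSpace.comap (fun ω : ℕ → ℝ => ω i) inferInstance)
      (fun i => (hmeas i).comap_le) (iIndepFun_iidLaw μ).iIndep
      (S := Set.Iio j) (T := {j}) (by simp)
    exact (Indep_iff _ _ _).1 h _ _ (hAm j) (hBm j)
  rw [← ENNReal.tsum_mul_right]
  change ∑' j, iidLaw μ (A j) * μ (Set.Iio (-δ)) ≤ 1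
  simp_rw [← hprod]
  rw [← measure_iUnion]
  · exact prob_le_one
  -- The jump after time `j` takes the walk below `y`, and a weak minimum at a later time `j'` is no
  -- higher than the position right after that jump.
  · have key : ∀ j j', j < j' → Disjoint (A j ∩ B j) (A j' ∩ B j') := by
      intro j j' hjj
      rw [Set.disjoint_left]
      rintro ω ⟨⟨-, -, h2⟩, h3⟩ ⟨⟨h4, h5, -⟩, -⟩
      have h6 := h4 (j + 1) hjj
      rw [walk_succ] at h6
      simp only [hB, Set.mem_ofPred_eq] at h3
      linarith
    intro j j' hjj
    rcases lt_or_gt_of_ne hjj with h | h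
    · exact key _ _ h
    · exact (key _ _ h).symm
  · intro j
    exact (sigmaOf_le hmeas _ _ (hAm j)).inter (sigmaOf_le hmeas _ _ (hBm j))

theorem walk_neg (ω : ℕ → ℝ) (n : ℕ) : walk (fun i => -ω i) n = -walk ω n := by
  simp [walk]

/-- Maxima of the walk are minima of the negated walk, whose steps have the reflected law. -/
theorem tsum_ascending_record_mul_le (y δ : ℝ) :
    (∑' j, iidLaw μ {ω | (∀ i ≤ j, walk ω i ≤ walk ω j) ∧ walk ω j ∈ Set.Icc y (y + δ)})
      * μ (Set.Ioi δ) ≤ 1 := by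
  have hn : IsProbabilityMeasure (μ.map Neg.neg) :=
    Measure.isProbabilityMeasure_map measurable_neg.aemeasurable
  have h := tsum_record_mul_le (μ.map Neg.neg) (-y - δ) δ
  have e1 : (μ.map Neg.neg) (Set.Iio (-δ)) = μ (Set.Ioi δ) := by
    rw [Measure.map_apply measurable_neg measurableSet_Iio]; simp
  have e2 : iidLaw (μ.map Neg.neg) = (iidLaw μ).map (fun ω i => -ω i) := by
    exact (Measure.infinitePi_map_pi (μ := fun _ : ℕ => μ) (f := fun _ x => -x)
      (fun _ => measurable_neg)).symm
  rw [e1, e2] at h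
  refine le_of_eq_of_le ?_ h
  congr 1
  refine tsum_congr fun j => ?_
  rw [Measure.map_apply]
  · congr 1
    ext ω
    simp only [Set.mem_preimage, Set.mem_ofPred_eq, walk_neg, Set.mem_Icc, neg_le_neg_iff]
    refine and_congr_right fun _ => ?_
    constructor <;> rintro ⟨h1, h2⟩ <;> constructor <;> linarith
  · fun_prop
  · have e : {ω : ℕ → ℝ | (∀ i ≤ j, walk ω j ≤ walk ω i) ∧ walk ω j ∈ Set.Icc (-y-δ) (-y-δ + δ)}
      = (⋂ i ∈ Set.Iic j, {ω | walk ω j ≤ walk ω i}) ∩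
        (fun ω => walk ω j) ⁻¹' Set.Icc (-y-δ) (-y-δ + δ) := by
      ext ω; simp
    rw [e]
    refine MeasurableSet.inter (MeasurableSet.biInter (Set.to_countable _) fun i hi => ?_) ?_
    · exact measurableSet_le (by fun_prop) (by fun_prop)
    · exact measurable_walk j measurableSet_Icc

end Walk

/-! ### Green function of the walk killed above a level -/

section Green

variable (μ : Measure ℝ) [IsProbabilityMeasure μ]

/-- Reversal of the order of the first `j` letters. -/
def reversal (j i : ℕ) : ℕ := if i < j then j - 1 - i else i

theorem reversal_injective (j : ℕ) : (reversal j).Injective := by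
  intro a b h
  unfold reversal at h
  split_ifs at h <;> omega

theorem walk_reversal (ω : ℕ → ℝ) (j : ℕ) {i : ℕ} (hi : i ≤ j) :
    walk (fun n => ω (reversal j n)) i = walk ω j - walk ω (j - i) := by
  induction i with
  | zero => simp
  | succ i ih =>
    have h1 : reversal j i = j - (i + 1) := by
      unfold reversal; rw [if_pos (by omega)]; omega
    have h2 : j - i = j - (i + 1) + 1 := by omega
    rw [walk_succ, ih (by omega), h1, h2, walk_succ]
    ring

theorem measurableSet_staysBelow (c : ℝ) (n : ℕ) :
    MeasurableSet {ω : ℕ → ℝ | ∀ i ≤ n, walk ω i ≤ c} := by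
  have e : {ω : ℕ → ℝ | ∀ i ≤ n, walk ω i ≤ c} = ⋂ i ∈ Set.Iic n, {ω | walk ω i ≤ c} := by
    ext ω; simp
  rw [e]
  exact MeasurableSet.biInter (Set.to_countable _) fun i _ =>
    measurableSet_le (by fun_prop) measurable_const

/-- Duality: reversing the first `j` steps preserves the law and the endpoint, and exchanges being
nonpositive throughout with ending at the minimum. -/
theorem measure_staysBelow_eq (j : ℕ) {I : Set ℝ} (hI : MeasurableSet I) :
    iidLaw μ {ω | (∀ i ≤ j, walk ω i ≤ 0) ∧ walk ω j ∈ I} =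
      iidLaw μ {ω | (∀ i ≤ j, walk ω j ≤ walk ω i) ∧ walk ω j ∈ I} := by
  conv_lhs => rw [← map_reindex_iidLaw μ (reversal_injective j)]
  have hm : MeasurableSet {ω : ℕ → ℝ | (∀ i ≤ j, walk ω i ≤ 0) ∧ walk ω j ∈ I} :=
    (measurableSet_staysBelow 0 j).inter (measurable_walk j hI)
  rw [Measure.map_apply (by fun_prop) hm]
  congr 1
  ext ω
  simp only [Set.mem_preimage, Set.mem_ofPred_eq]
  rw [walk_reversal ω j le_rfl]
  simp only [tsub_self, walk_zero, sub_zero]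
  refine and_congr_left fun _ => ⟨fun h i hi => ?_, fun h i hi => ?_⟩
  · have := h (j - i) (by omega)
    rw [walk_reversal ω j (by omega), show j - (j - i) = i by omega] at this
    linarith
  · rw [walk_reversal ω j hi]
    linarith [h (j - i) (by omega)]

theorem tsum_staysBelow_mul_le (y δ : ℝ) :
    (∑' j, iidLaw μ {ω | (∀ i ≤ j, walk ω i ≤ 0) ∧ walk ω j ∈ Set.Icc y (y + δ)})
      * μ (Set.Iio (-δ)) ≤ 1 := by
  simp_rw [measure_staysBelow_eq μ _ measurableSet_Icc]
  exact tsum_record_mul_le μ y δ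

theorem measurableSet_sigmaOf_ascending (c : ℝ) (k : ℕ) :
    MeasurableSet[sigmaOf (fun (i : ℕ) (ω : ℕ → ℝ) => ω i) (Set.Iio k)]
      {ω : ℕ → ℝ | (∀ i ≤ k, walk ω i ≤ walk ω k) ∧ walk ω k ≤ c} := by
  have e : {ω : ℕ → ℝ | (∀ i ≤ k, walk ω i ≤ walk ω k) ∧ walk ω k ≤ c} =
      (⋂ i ∈ Set.Iic k, {ω | walk ω i ≤ walk ω k}) ∩ {ω | walk ω k ≤ c} := by
    ext ω; simp
  rw [e]
  refine MeasurableSet.inter (MeasurableSet.biInter (Set.to_countable _) fun i hi => ?_) ?_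
  · exact measurableSet_le (measurable_walk_sigmaOf hi) (measurable_walk_sigmaOf le_rfl)
  · exact measurableSet_le (measurable_walk_sigmaOf le_rfl) measurable_const

/-- Decomposition at a time where the maximum is attained. -/
theorem measure_ascending_inter_eq (c y δ : ℝ) (k j : ℕ) :
    iidLaw μ {ω | ((∀ i ≤ k, walk ω i ≤ walk ω k) ∧ walk ω k ≤ c) ∧
      (∀ i ≤ j, walk (fun n => ω (n + k)) i ≤ 0) ∧
        walk ω k + walk (fun n => ω (n + k)) j ∈ Set.Icc y (y + δ)} =
    ∫⁻ ω in {ω | (∀ i ≤ k, walk ω i ≤ walk ω k) ∧ walk ω k ≤ c},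
      iidLaw μ {ω' | (∀ i ≤ j, walk ω' i ≤ 0) ∧
        walk ω' j ∈ Set.Icc (y - walk ω k) (y - walk ω k + δ)} ∂(iidLaw μ) := by
  have hmeas : ∀ i : ℕ, Measurable fun ω : ℕ → ℝ => ω i := fun i => measurable_pi_apply i
  set R : Set (ℕ → ℝ) := {ω | (∀ i ≤ k, walk ω i ≤ walk ω k) ∧ walk ω k ≤ c} with hR
  have hRm := measurableSet_sigmaOf_ascending c k
  have hRm' : MeasurableSet R := sigmaOf_le hmeas _ _ hRm
  set Q : Set ((ℝ≥0∞ × ℝ) × (ℕ → ℝ)) := {p | (∀ i ≤ j, walk p.2 i ≤ 0) ∧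
    p.1.2 + walk p.2 j ∈ Set.Icc y (y + δ)} with hQ
  have hQm : MeasurableSet Q := by
    refine MeasurableSet.inter (measurable_snd (measurableSet_staysBelow 0 j)) ?_
    exact (by fun_prop : Measurable fun p : (ℝ≥0∞ × ℝ) × (ℕ → ℝ) => p.1.2 + walk p.2 j)
      measurableSet_Icc
  have hF : Measurable[sigmaOf (fun (i : ℕ) (ω : ℕ → ℝ) => ω i) (Set.Iio k)]
      fun ω => (R.indicator (fun _ => (1 : ℝ≥0∞)) ω, walk ω k) :=
    (measurable_const.indicator hRm).prodMk (measurable_walk_sigmaOf le_rfl)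
  have hG : Measurable[sigmaOf (fun (i : ℕ) (ω : ℕ → ℝ) => ω i) (Set.Ici k)]
      fun (ω : ℕ → ℝ) (n : ℕ) => ω (n + k) := by
    refine @measurable_pi_lambda _ _ _ (_) _ _ fun n => ?_
    exact measurable_sigmaOf (ξ := fun (i : ℕ) (ω : ℕ → ℝ) => ω i) (s := Set.Ici k)
      (i := n + k) (by simp)
  have hh : Measurable fun p : (ℝ≥0∞ × ℝ) × (ℕ → ℝ) => p.1.1 * Q.indicator (fun _ => 1) p :=
    (by fun_prop : Measurable fun p : (ℝ≥0∞ × ℝ) × (ℕ → ℝ) => p.1.1).mul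
      (measurable_const.indicator hQm)
  have h := lintegral_of_sigmaOf (P := iidLaw μ) hmeas (iIndepFun_iidLaw μ)
    (by simp : Disjoint (Set.Iio k) (Set.Ici k)) hF hG hh
  rw [map_reindex_iidLaw μ (add_left_injective k)] at h
  have hset : ∀ z : ℝ, MeasurableSet {ω' : ℕ → ℝ | (∀ i ≤ j, walk ω' i ≤ 0) ∧
        walk ω' j ∈ Set.Icc z (z + δ)} := fun z =>
    (measurableSet_staysBelow 0 j).inter (measurable_walk j measurableSet_Icc)
  rw [← lintegral_indicator hRm']
  convert h using 1
  · rw [← lintegral_indicator_one]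
    · refine lintegral_congr fun ω => ?_
      by_cases h1 : ω ∈ R <;>
        by_cases h2 : ((R.indicator (fun _ => (1 : ℝ≥0∞)) ω, walk ω k), fun n => ω (n + k)) ∈ Q
      · rw [Set.indicator_of_mem, Set.indicator_of_mem h1, Set.indicator_of_mem]
        · simp
        · rw [Set.indicator_of_mem h1] at h2; exact h2
        · exact ⟨h1, h2⟩
      · rw [Set.indicator_of_notMem, Set.indicator_of_notMem h2]
        · simp
        · exact fun h3 => h2 h3.2
      · rw [Set.indicator_of_notMem, Set.indicator_of_notMem h1]
        · simp
        · exact fun h3 => h1 h3.1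
      · rw [Set.indicator_of_notMem, Set.indicator_of_notMem h1]
        · simp
        · exact fun h3 => h1 h3.1
    · refine hRm'.inter (MeasurableSet.inter ?_ ?_)
      · exact (by fun_prop : Measurable fun (ω : ℕ → ℝ) (n : ℕ) => ω (n + k))
          (measurableSet_staysBelow 0 j)
      · exact (Measurable.add (by fun_prop) ((measurable_walk j).comp
          (by fun_prop : Measurable fun (ω : ℕ → ℝ) (n : ℕ) => ω (n + k)))) measurableSet_Icc
  · refine lintegral_congr fun ω => ?_
    have hQmω := hQm.preimage (measurable_prodMk_left
      (x := (R.indicator (fun _ => (1 : ℝ≥0∞)) ω, walk ω k)))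
    rw [lintegral_const_mul _ (by
      exact (measurable_const.indicator hQm).comp measurable_prodMk_left)]
    by_cases h1 : ω ∈ R
    · rw [Set.indicator_of_mem h1]
      simp only [Set.indicator_of_mem h1, one_mul]
      rw [← lintegral_indicator_one (hset _)]
      refine lintegral_congr fun ω' => ?_
      have : ω' ∈ {ω' : ℕ → ℝ | (∀ i ≤ j, walk ω' i ≤ 0) ∧
        walk ω' j ∈ Set.Icc (y - walk ω k) (y - walk ω k + δ)} ↔
          (((1 : ℝ≥0∞), walk ω k), ω') ∈ Q := by
        simp only [hQ, Set.mem_ofPred_eq, Set.mem_Icc]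
        refine and_congr_right fun _ => ?_
        constructor <;> rintro ⟨h1, h2⟩ <;> constructor <;> linarith
      by_cases h3 : (((1 : ℝ≥0∞), walk ω k), ω') ∈ Q
      · rw [Set.indicator_of_mem h3, Set.indicator_of_mem (this.2 h3)]; rfl
      · rw [Set.indicator_of_notMem h3, Set.indicator_of_notMem (fun h4 => h3 (this.1 h4))]
    · simp [h1]

/-- An ascending record is at least the starting value `0`, so its height lies in `[0, c]`. This
range is covered by order `1 + c` intervals of length `δ`, each with a bounded expected number of
records. -/
theorem tsum_ascending_le (hμ : μ (Set.Ioi 0) ≠ 0) :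
    ∃ C : ℝ≥0∞, C ≠ ∞ ∧ ∀ c : ℝ, 0 ≤ c →
      ∑' k, iidLaw μ {ω | (∀ i ≤ k, walk ω i ≤ walk ω k) ∧ walk ω k ≤ c} ≤
        C * ENNReal.ofReal (1 + c) := by
  obtain ⟨δ, hδ, hpos⟩ : ∃ δ : ℝ, 0 < δ ∧ μ (Set.Ioi δ) ≠ 0 := by
    by_contra! hcon
    apply hμ
    have e : Set.Ioi (0 : ℝ) = ⋃ n : ℕ, Set.Ioi (1 / ((n : ℝ) + 1)) := by
      ext x
      simp only [Set.mem_Ioi, Set.mem_iUnion]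
      exact ⟨fun h => exists_nat_one_div_lt h, fun ⟨n, hn⟩ => lt_trans (by positivity) hn⟩
    rw [e]
    exact measure_iUnion_null fun n => hcon _ (by positivity)
  have hrec : ∀ y : ℝ, ∑' k, iidLaw μ {ω | (∀ i ≤ k, walk ω i ≤ walk ω k) ∧
      walk ω k ∈ Set.Icc y (y + δ)} ≤ (μ (Set.Ioi δ))⁻¹ := fun y =>
    (ENNReal.le_inv_iff_mul_le).2 (tsum_ascending_record_mul_le μ y δ)
  -- The cover uses `⌊c / δ⌋ + 1` intervals, at most `(1 / δ + 1) * (1 + c)`.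
  refine ⟨(μ (Set.Ioi δ))⁻¹ * ENNReal.ofReal (1 / δ + 1), ?_, fun c hc => ?_⟩
  · exact ENNReal.mul_ne_top (ENNReal.inv_ne_top.2 hpos) ENNReal.ofReal_ne_top
  set M : ℕ := ⌊c / δ⌋₊ + 1 with hM
  have hstep : ∀ k, iidLaw μ {ω | (∀ i ≤ k, walk ω i ≤ walk ω k) ∧ walk ω k ≤ c} ≤
      ∑ m ∈ Finset.range M, iidLaw μ {ω | (∀ i ≤ k, walk ω i ≤ walk ω k) ∧
        walk ω k ∈ Set.Icc (m * δ) (m * δ + δ)} := by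
    intro k
    refine le_trans (measure_mono ?_) (measure_biUnion_finset_le _ _)
    rintro ω ⟨h1, h2⟩
    have h0 : 0 ≤ walk ω k := by simpa using h1 0 (Nat.zero_le _)
    simp only [Set.mem_iUnion]
    refine ⟨⌊walk ω k / δ⌋₊, ?_, h1, ?_, ?_⟩
    · rw [Finset.mem_range, hM, Nat.lt_add_one_iff]
      exact Nat.floor_mono (by gcongr)
    · have := Nat.floor_le (div_nonneg h0 hδ.le)
      rwa [le_div_iff₀ hδ] at this
    · have := (Nat.lt_floor_add_one (walk ω k / δ)).le
      rw [div_le_iff₀ hδ] at this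
      linarith
  calc _ ≤ ∑' k, ∑ m ∈ Finset.range M, iidLaw μ {ω | (∀ i ≤ k, walk ω i ≤ walk ω k) ∧
        walk ω k ∈ Set.Icc (m * δ) (m * δ + δ)} := ENNReal.tsum_le_tsum hstep
    _ = ∑ m ∈ Finset.range M, ∑' k, iidLaw μ {ω | (∀ i ≤ k, walk ω i ≤ walk ω k) ∧
        walk ω k ∈ Set.Icc (m * δ) (m * δ + δ)} :=
      Summable.tsum_finsetSum fun _ _ => ENNReal.summable
    _ ≤ ∑ m ∈ Finset.range M, (μ (Set.Ioi δ))⁻¹ := Finset.sum_le_sum fun m _ => hrec _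
    _ = (μ (Set.Ioi δ))⁻¹ * (M : ℝ≥0∞) := by simp [mul_comm]
    _ ≤ _ := by
      rw [mul_assoc, ← ENNReal.ofReal_mul (by positivity), ← ENNReal.ofReal_natCast]
      gcongr
      have := Nat.floor_le (div_nonneg hc hδ.le)
      push_cast [hM]
      have h1 : (1 / δ + 1) * (1 + c) = 1 / δ + c / δ + 1 + c := by field_simp; ring
      rw [h1]
      have : 0 ≤ 1 / δ := by positivity
      linarith

/-- The Green function of the walk killed above level `c` grows at most linearly in `c`, uniformly
over intervals of a fixed length. -/
theorem exists_green_bound (hμ : μ (Set.Iio 0) ≠ 0) :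
    ∃ δ : ℝ, 0 < δ ∧ ∃ C : ℝ≥0∞, C ≠ ∞ ∧ ∀ c : ℝ, 0 ≤ c → ∀ y : ℝ,
      ∑' n, iidLaw μ {ω | (∀ i ≤ n, walk ω i ≤ c) ∧ walk ω n ∈ Set.Icc y (y + δ)} ≤
        C * ENNReal.ofReal (1 + c) := by
  obtain ⟨δ, hδ, hneg⟩ : ∃ δ : ℝ, 0 < δ ∧ μ (Set.Iio (-δ)) ≠ 0 := by
    by_contra! hcon
    apply hμ
    have e : Set.Iio (0 : ℝ) = ⋃ n : ℕ, Set.Iio (-(1 / ((n : ℝ) + 1))) := by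
      ext x
      simp only [Set.mem_Iio, Set.mem_iUnion]
      constructor
      · intro h
        obtain ⟨n, hn⟩ := exists_nat_one_div_lt (neg_pos.2 h)
        exact ⟨n, by linarith⟩
      · rintro ⟨n, hn⟩
        have : (0 : ℝ) < 1 / ((n : ℝ) + 1) := by positivity
        linarith
    rw [e]
    exact measure_iUnion_null fun n => hcon _ (by positivity)
  have hbelow : ∀ y : ℝ, ∑' j, iidLaw μ {ω | (∀ i ≤ j, walk ω i ≤ 0) ∧
      walk ω j ∈ Set.Icc y (y + δ)} ≤ (μ (Set.Iio (-δ)))⁻¹ := fun y =>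
    (ENNReal.le_inv_iff_mul_le).2 (tsum_staysBelow_mul_le μ y δ)
  have hinv : (μ (Set.Iio (-δ)))⁻¹ ≠ ∞ := ENNReal.inv_ne_top.2 hneg
  refine ⟨δ, hδ, ?_⟩
  -- Without upward steps there is no record estimate to use, but then the walk almost surely never
  -- exceeds `0` and the bound for the walk kept nonpositive applies directly.
  by_cases hpos : μ (Set.Ioi 0) = 0
  · refine ⟨(μ (Set.Iio (-δ)))⁻¹, hinv, fun c hc y => ?_⟩
    have hae : ∀ᵐ ω ∂(iidLaw μ), ∀ i : ℕ, ω i ≤ 0 := by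
      rw [ae_all_iff]
      intro i
      have h := Measure.infinitePi_map_eval (fun _ : ℕ => μ) i
      have h0 : ∀ᵐ x ∂μ, x ≤ 0 := by
        rw [ae_iff, ← hpos]; congr 1; ext x; simp
      rw [← h] at h0
      exact ae_of_ae_map (measurable_pi_apply i).aemeasurable h0
    calc _ ≤ ∑' j, iidLaw μ {ω | (∀ i ≤ j, walk ω i ≤ 0) ∧ walk ω j ∈ Set.Icc y (y + δ)} := by
          refine ENNReal.tsum_le_tsum fun n => measure_mono_ae ?_
          filter_upwards [hae] with ω h1 h2
          exact ⟨fun i _ => Finset.sum_nonpos fun _ _ => h1 _, h2.2⟩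
      _ ≤ (μ (Set.Iio (-δ)))⁻¹ * 1 := by rw [mul_one]; exact hbelow y
      _ ≤ _ := by
          gcongr
          rw [← ENNReal.ofReal_one]
          exact ENNReal.ofReal_le_ofReal (by linarith)
  · obtain ⟨C, hC, hasc⟩ := tsum_ascending_le μ hpos
    refine ⟨C * (μ (Set.Iio (-δ)))⁻¹, ENNReal.mul_ne_top hC hinv, fun c hc y => ?_⟩
    set f : ℕ → ℕ → ℝ≥0∞ := fun k j => iidLaw μ {ω | ((∀ i ≤ k, walk ω i ≤ walk ω k) ∧
      walk ω k ≤ c) ∧ (∀ i ≤ j, walk (fun n => ω (n + k)) i ≤ 0) ∧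
        walk ω k + walk (fun n => ω (n + k)) j ∈ Set.Icc y (y + δ)} with hf
    have hstep : ∀ n, iidLaw μ {ω | (∀ i ≤ n, walk ω i ≤ c) ∧ walk ω n ∈ Set.Icc y (y + δ)} ≤
        ∑ p ∈ Finset.HasAntidiagonal.antidiagonal n, f p.1 p.2 := by
      intro n
      refine le_trans (measure_mono ?_) (measure_biUnion_finset_le _ _)
      rintro ω ⟨h1, h2⟩
      -- Any time of the maximum will do, since only an upper bound is sought: it is an ascending
      -- record of height at most `c`, and from it on the shifted walk is nonpositive.
      obtain ⟨k, hk, hmax⟩ := Finset.exists_max_image (Finset.range (n + 1)) (walk ω) ⟨0, by simp⟩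
      have hk' : k ≤ n := by simpa [Nat.lt_add_one_iff] using hk
      have hmax' : ∀ i ≤ n, walk ω i ≤ walk ω k := fun i hi =>
        hmax i (by simpa [Nat.lt_add_one_iff] using hi)
      simp only [Set.mem_iUnion]
      refine ⟨(k, n - k), by simp; omega, ⟨fun i hi => hmax' i (hi.trans hk'), h1 k hk'⟩,
        fun i hi => ?_, ?_⟩
      · have := hmax' (k + i) (by simp at hi; omega)
        rw [walk_add] at this
        linarith
      · dsimp only
        rw [← walk_add, show k + (n - k) = n by omega]
        exact h2
    calc _ ≤ ∑' n, ∑ p ∈ Finset.HasAntidiagonal.antidiagonal n, f p.1 p.2 := ENNReal.tsum_le_tsum hstep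
      _ = ∑' k, ∑' j, f k j := by
        rw [← ENNReal.tsum_prod (f := fun k j => f k j),
          ← Finset.HasAntidiagonal.sigmaAntidiagonalEquivProd.tsum_eq, ENNReal.tsum_sigma']
        refine tsum_congr fun n => ?_
        rw [tsum_fintype]
        exact (Finset.sum_coe_sort (Finset.HasAntidiagonal.antidiagonal n) (fun p => f p.1 p.2)).symm
      _ ≤ ∑' k, iidLaw μ {ω | (∀ i ≤ k, walk ω i ≤ walk ω k) ∧ walk ω k ≤ c} *
            (μ (Set.Iio (-δ)))⁻¹ := by
        refine ENNReal.tsum_le_tsum fun k => ?_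
        simp only [hf, measure_ascending_inter_eq]
        rw [← lintegral_tsum]
        · calc _ ≤ ∫⁻ ω in {ω | (∀ i ≤ k, walk ω i ≤ walk ω k) ∧ walk ω k ≤ c},
                (μ (Set.Iio (-δ)))⁻¹ ∂(iidLaw μ) := lintegral_mono fun ω => hbelow _
            _ = _ := by rw [setLIntegral_const, mul_comm]
        · intro j
          have hm : MeasurableSet {p : (ℕ → ℝ) × (ℕ → ℝ) | (∀ i ≤ j, walk p.2 i ≤ 0) ∧
              walk p.2 j ∈ Set.Icc (y - walk p.1 k) (y - walk p.1 k + δ)} := by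
            refine MeasurableSet.inter (measurable_snd (measurableSet_staysBelow 0 j)) ?_
            have h1 : Measurable fun p : (ℕ → ℝ) × (ℕ → ℝ) => y - walk p.1 k := by fun_prop
            have h2 : Measurable fun p : (ℕ → ℝ) × (ℕ → ℝ) => walk p.2 j := by fun_prop
            exact MeasurableSet.inter (measurableSet_le h1 h2)
              (measurableSet_le h2 (h1.add_const δ))
          exact (measurable_measure_prodMk_left hm).aemeasurable
      _ ≤ _ := by
        rw [ENNReal.tsum_mul_right]
        calc _ ≤ C * ENNReal.ofReal (1 + c) * (μ (Set.Iio (-δ)))⁻¹ := by gcongr; exact hasc c hc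
          _ = _ := by ring

end Green

/-! ### Sums over words, by length -/

section Words

/-- The words of length `n`. -/
abbrev Word (n : ℕ) : Type := {u : List ℕ // u.length = n}

/-- A nonempty word is a word together with a further letter. -/
def wordSuccEquiv (n : ℕ) : Word n × ℕ ≃ Word (n + 1) where
  toFun p := ⟨p.2 :: p.1.1, by simp [p.1.2]⟩
  invFun v := (⟨v.1.tail, by simp [v.2]⟩, v.1.head (by
    intro h; have := v.2; simp [h] at this))
  left_inv p := by simp
  right_inv v := by simp

theorem tsum_word_succ (n : ℕ) (f : List ℕ → ℝ≥0∞) :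
    ∑' v : Word (n + 1), f v = ∑' u : Word n, ∑' j : ℕ, f (j :: u) := by
  rw [← (wordSuccEquiv n).tsum_eq, ENNReal.tsum_prod']
  rfl

instance uniqueWordZero : Unique (Word 0) where
  default := ⟨[], rfl⟩
  uniq v := Subtype.ext (List.length_eq_zero_iff.1 v.2)

theorem tsum_word_zero {M : Type*} [AddCommMonoid M] [TopologicalSpace M] (f : List ℕ → M) :
    ∑' v : Word 0, f v = f [] := by
  rw [tsum_fintype, Fintype.sum_unique]
  rfl

theorem tsum_list_eq (f : List ℕ → ℝ≥0∞) : ∑' u, f u = ∑' n, ∑' u : Word n, f u := by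
  rw [← (Equiv.sigmaFiberEquiv (List.length (α := ℕ))).tsum_eq, ENNReal.tsum_sigma']
  rfl

end Words

/-! ### Scalar weights, size-biasing and the many-to-one formula -/

section RelWeight

variable {Ω Θ : Type*}

/-- The multiplicative weight of an individual. -/
def relWeight (x : ℕ → Θ → ℝ) (ξ : List ℕ → Ω → Θ) : List ℕ → Ω → ℝ
  | [], _ => 1
  | j :: u, ω => relWeight x ξ u ω * x j (ξ u ω)

/-- The event that no weight on the ancestral line of an individual exceeds `t`. -/
def below (x : ℕ → Θ → ℝ) (ξ : List ℕ → Ω → Θ) (t : ℝ) : List ℕ → Set Ω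
  | [] => Set.univ
  | j :: u => below x ξ t u ∩ {ω | relWeight x ξ (j :: u) ω ≤ t}

variable {x : ℕ → Θ → ℝ} {ξ : List ℕ → Ω → Θ}

theorem relWeight_nonneg (hx0 : ∀ j θ, 0 ≤ x j θ) (u : List ℕ) (ω : Ω) :
    0 ≤ relWeight x ξ u ω := by
  induction u with
  | nil => exact zero_le_one
  | cons j u ih => exact mul_nonneg ih (hx0 _ _)

variable [MeasurableSpace Θ]

theorem measurable_relWeight (hx : ∀ j, Measurable (x j)) (u : List ℕ) {s : Set (List ℕ)}
    (hs : ∀ v : List ℕ, v.length < u.length → v ∈ s) :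
    Measurable[sigmaOf ξ s] (relWeight x ξ u) := by
  induction u with
  | nil => exact measurable_const
  | cons j u ih =>
    refine Measurable.mul (ih fun v hv => hs v (by simp; omega)) ?_
    exact (hx j).comp (measurable_sigmaOf (hs u (by simp)))

theorem measurableSet_below (hx : ∀ j, Measurable (x j)) (t : ℝ) (u : List ℕ) {s : Set (List ℕ)}
    (hs : ∀ v : List ℕ, v.length < u.length → v ∈ s) :
    MeasurableSet[sigmaOf ξ s] (below x ξ t u) := by
  induction u with
  | nil => exact MeasurableSet.univ
  | cons j u ih =>
    refine MeasurableSet.inter (ih fun v hv => hs v (by simp; omega)) ?_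
    exact measurableSet_le (measurable_relWeight hx _ hs) measurable_const

variable [MeasurableSpace Ω] {P : Measure Ω} {ν : Measure Θ}

theorem sigmaOf_compl_singleton_length (u : List ℕ) :
    ∀ v : List ℕ, v.length < u.length → v ∈ ({u}ᶜ : Set (List ℕ)) := by
  rintro v hv rfl
  exact lt_irrefl _ hv

theorem measurableSet_below' (hξ : ∀ u, Measurable (ξ u)) (hx : ∀ j, Measurable (x j)) (t : ℝ)
    (u : List ℕ) : MeasurableSet (below x ξ t u) :=
  sigmaOf_le hξ _ _ (measurableSet_below hx t u (s := Set.univ) fun _ _ => trivial)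

theorem measurable_relWeight' (hξ : ∀ u, Measurable (ξ u)) (hx : ∀ j, Measurable (x j))
    (u : List ℕ) : Measurable (relWeight x ξ u) :=
  (measurable_relWeight hx u (s := Set.univ) fun _ _ => trivial).mono (sigmaOf_le hξ _) le_rfl

/-- The offspring of `u` is independent of the weight of `u` and of its ancestors. -/
theorem setLIntegral_below [IsProbabilityMeasure P] (hξ : ∀ u, Measurable (ξ u))
    (hi : iIndepFun ξ P)
    (hν : ∀ u, P.map (ξ u) = ν) (hx : ∀ j, Measurable (x j)) (t : ℝ) (u : List ℕ)
    {g : ℝ × Θ → ℝ≥0∞} (hg : Measurable g) :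
    ∫⁻ ω in below x ξ t u, g (relWeight x ξ u ω, ξ u ω) ∂P =
      ∫⁻ ω in below x ξ t u, ∫⁻ θ, g (relWeight x ξ u ω, θ) ∂ν ∂P := by
  have hb := measurableSet_below (ξ := ξ) hx t u (sigmaOf_compl_singleton_length u)
  have hF : Measurable[sigmaOf ξ {u}ᶜ] fun ω =>
      ((below x ξ t u).indicator (fun _ => (1 : ℝ≥0∞)) ω, relWeight x ξ u ω) :=
    (measurable_const.indicator hb).prodMk
      (measurable_relWeight hx u (sigmaOf_compl_singleton_length u))
  have hG : Measurable[sigmaOf ξ {u}] (ξ u) := measurable_sigmaOf rfl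
  have hh : Measurable fun p : (ℝ≥0∞ × ℝ) × Θ => p.1.1 * g (p.1.2, p.2) :=
    Measurable.mul (by fun_prop) (hg.comp (by fun_prop))
  have h := lintegral_of_sigmaOf (P := P) hξ hi (by simp : Disjoint ({u}ᶜ : Set (List ℕ)) {u})
    hF hG hh
  rw [hν] at h
  have hb' := measurableSet_below' (ξ := ξ) hξ hx t u
  rw [← lintegral_indicator hb', ← lintegral_indicator hb']
  convert h using 1
  · refine lintegral_congr fun ω => ?_
    by_cases h1 : ω ∈ below x ξ t u <;> simp [h1]
  · refine lintegral_congr fun ω => ?_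
    by_cases h1 : ω ∈ below x ξ t u <;> simp [h1]

/-- The law of the logarithmic displacement of a size-biased first-generation individual. -/
noncomputable def stepLaw (ν : Measure Θ) (x : ℕ → Θ → ℝ) (α : ℝ) : Measure ℝ :=
  Measure.sum fun j => (ν.withDensity fun θ => ENNReal.ofReal (x j θ ^ α)).map
    fun θ => Real.log (x j θ)

/-- For `α > 0` a child of weight `0` has bias `0`, so the convention `Real.log 0 = 0` puts no mass
on the step law. -/
theorem lintegral_stepLaw (hx : ∀ j, Measurable (x j)) (α : ℝ) {g : ℝ → ℝ≥0∞}
    (hg : Measurable g) :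
    ∫⁻ s, g s ∂(stepLaw ν x α) =
      ∫⁻ θ, ∑' j, ENNReal.ofReal (x j θ ^ α) * g (Real.log (x j θ)) ∂ν := by
  have hm : ∀ j, Measurable fun θ => ENNReal.ofReal (x j θ ^ α) := fun j =>
    ((hx j).pow_const α).ennreal_ofReal
  have hl : ∀ j, Measurable fun θ => Real.log (x j θ) := fun j =>
    Real.measurable_log.comp (hx j)
  rw [stepLaw, lintegral_sum_measure, lintegral_tsum]
  · refine tsum_congr fun j => ?_
    rw [lintegral_map hg (hl j), lintegral_withDensity_eq_lintegral_mul _ (hm j)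
      (by exact hg.comp (hl j) : Measurable fun θ => g (Real.log (x j θ)))]
    rfl
  · exact fun j => ((hm j).mul (hg.comp (hl j))).aemeasurable

theorem isProbabilityMeasure_stepLaw (hx : ∀ j, Measurable (x j)) {α : ℝ}
    (hα : ∫⁻ θ, ∑' j, ENNReal.ofReal (x j θ ^ α) ∂ν = 1) :
    IsProbabilityMeasure (stepLaw ν x α) := by
  constructor
  rw [← lintegral_one, lintegral_stepLaw hx α measurable_const]
  simpa using hα

/-- If no biased step were negative, almost surely every nonzero weight would be at least `1`, hence
so would its `α`-th power. The mean number of nonzero weights would then be at most the mean sum of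
`α`-th powers, which is `1`. -/
theorem stepLaw_Iio_ne_zero [IsProbabilityMeasure ν] (hx : ∀ j, Measurable (x j))
    {α : ℝ} (hα0 : 0 < α) (hα : ∫⁻ θ, ∑' j, ENNReal.ofReal (x j θ ^ α) ∂ν = 1)
    (hN : 1 < ∫⁻ θ, ∑' j, {θ | 0 < x j θ}.indicator 1 θ ∂ν) :
    stepLaw ν x α (Set.Iio 0) ≠ 0 := by
  intro h0
  have hm : ∀ j, Measurable fun θ => ENNReal.ofReal (x j θ ^ α) := fun j =>
    ((hx j).pow_const α).ennreal_ofReal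
  rw [← lintegral_indicator_one measurableSet_Iio, lintegral_stepLaw hx α
    (measurable_one.indicator measurableSet_Iio), lintegral_eq_zero_iff] at h0
  · refine absurd hN (not_lt.2 ?_)
    rw [← hα]
    refine lintegral_mono_ae ?_
    filter_upwards [h0] with θ hθ
    refine ENNReal.tsum_le_tsum fun j => ?_
    have hj := ENNReal.tsum_eq_zero.1 hθ j
    by_cases h1 : 0 < x j θ
    · rw [Set.indicator_of_mem (show θ ∈ {θ | 0 < x j θ} from h1)]
      have h2 : 0 < x j θ ^ α := Real.rpow_pos_of_pos h1 _
      have h3 : Real.log (x j θ) ∉ Set.Iio 0 := by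
        intro h4
        rw [Set.indicator_of_mem h4] at hj
        simp at hj
        linarith
      have h4 : 1 ≤ x j θ := by
        by_contra h5
        exact h3 (Real.log_neg h1 (not_le.1 h5))
      simpa using Real.one_le_rpow h4 hα0.le
    · rw [Set.indicator_of_notMem (show θ ∉ {θ | 0 < x j θ} from h1)]; exact zero_le
  · refine Measurable.tsum fun j => (hm j).mul ?_
    exact (measurable_one.indicator measurableSet_Iio).comp (Real.measurable_log.comp (hx j))

/-- The many-to-one formula for the individuals whose ancestral line stays below `t`. -/
theorem many_to_one [IsProbabilityMeasure P] [SFinite ν]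
    (hξ : ∀ u, Measurable (ξ u)) (hi : iIndepFun ξ P)
    (hν : ∀ u, P.map (ξ u) = ν) (hx : ∀ j, Measurable (x j)) (hx0 : ∀ j θ, 0 ≤ x j θ)
    {α : ℝ} (hα0 : 0 < α) [IsProbabilityMeasure (stepLaw ν x α)]
    {t : ℝ} (ht : 1 ≤ t) (n : ℕ) {h : ℝ → ℝ≥0∞} (hh : Measurable h) (h0 : h 0 = 0) :
    ∑' u : Word n, ∫⁻ ω in below x ξ t u, h (relWeight x ξ u ω) ∂P =
      ∫⁻ ω in {ω | ∀ i ≤ n, walk ω i ≤ Real.log t},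
        ENNReal.ofReal (Real.exp (-α * walk ω n)) * h (Real.exp (walk ω n))
          ∂(iidLaw (stepLaw ν x α)) := by
  induction n generalizing h with
  | zero =>
    rw [tsum_word_zero fun u => ∫⁻ ω in below x ξ t u, h (relWeight x ξ u ω) ∂P]
    have e : {ω : ℕ → ℝ | ∀ i ≤ 0, walk ω i ≤ Real.log t} = Set.univ := by
      ext ω; simp [Real.log_nonneg ht]
    rw [e]
    simp [below, relWeight]
  | succ n ih =>
    -- The barrier condition on the last letter is absorbed into the test function. Averaging over
    -- the last mark then gives `H`, to which the induction hypothesis for shorter words applies.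
    set ht' : ℝ → ℝ≥0∞ := (Set.Iic t).indicator h with hht
    have hhm : Measurable ht' := hh.indicator measurableSet_Iic
    have hzero : ht' 0 = 0 := by
      rw [hht, Set.indicator_apply]; split_ifs <;> simp [h0]
    set H : ℝ → ℝ≥0∞ := fun y => ∫⁻ θ, ∑' j, ht' (y * x j θ) ∂ν with hH
    have hjoint : Measurable fun p : ℝ × Θ => ∑' j, ht' (p.1 * x j p.2) :=
      Measurable.tsum fun j => hhm.comp (measurable_fst.mul ((hx j).comp measurable_snd))
    have hHm : Measurable H := hjoint.lintegral_prod_right'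
    have hH0 : H 0 = 0 := by simp [hH, hzero]
    have h1 : ∀ u : Word n, ∑' j, ∫⁻ ω in below x ξ t (j :: u), h (relWeight x ξ (j :: u) ω) ∂P
        = ∫⁻ ω in below x ξ t u, H (relWeight x ξ u ω) ∂P := by
      intro u
      rw [← setLIntegral_below hξ hi hν hx t u hjoint, lintegral_tsum]
      · refine tsum_congr fun j => ?_
        have hm := measurableSet_below' hξ hx t u.1
        have hm2 := measurableSet_below' hξ hx t (j :: u.1)
        rw [← lintegral_indicator hm, ← lintegral_indicator hm2]
        refine lintegral_congr fun ω => ?_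
        by_cases h2 : ω ∈ below x ξ t u.1
        · rw [Set.indicator_of_mem h2]
          by_cases h3 : relWeight x ξ (j :: u.1) ω ∈ Set.Iic t
          · rw [Set.indicator_of_mem (show ω ∈ below x ξ t (j :: u.1) from ⟨h2, h3⟩)]
            exact (Set.indicator_of_mem h3 h).symm
          · rw [Set.indicator_of_notMem (show ω ∉ below x ξ t (j :: u.1) from fun h4 => h3 h4.2)]
            exact (Set.indicator_of_notMem h3 h).symm
        · rw [Set.indicator_of_notMem h2, Set.indicator_of_notMem (fun h3 => h2 h3.1)]
      · intro j
        have : Measurable fun ω => ht' (relWeight x ξ u ω * x j (ξ u ω)) :=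
          hhm.comp ((measurable_relWeight' hξ hx _).mul ((hx j).comp (hξ _)))
        exact this.aemeasurable
    rw [tsum_word_succ n fun u => ∫⁻ ω in below x ξ t u, h (relWeight x ξ u ω) ∂P]
    simp_rw [h1]
    rw [ih hHm hH0]
    have hmeas : ∀ i : ℕ, Measurable fun ω : ℕ → ℝ => ω i := fun i => measurable_pi_apply i
    set R : Set (ℕ → ℝ) := {ω | ∀ i ≤ n, walk ω i ≤ Real.log t} with hR
    have hRm : MeasurableSet[sigmaOf (fun (i : ℕ) (ω : ℕ → ℝ) => ω i) (Set.Iio n)] R := by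
      have e : R = ⋂ i ∈ Set.Iic n, {ω | walk ω i ≤ Real.log t} := by
        ext ω; simp [hR]
      rw [e]
      exact MeasurableSet.biInter (Set.to_countable _) fun i hi =>
        measurableSet_le (measurable_walk_sigmaOf hi) measurable_const
    have hF : Measurable[sigmaOf (fun (i : ℕ) (ω : ℕ → ℝ) => ω i) (Set.Iio n)]
        fun ω => (R.indicator (fun _ => (1 : ℝ≥0∞)) ω, walk ω n) :=
      (measurable_const.indicator hRm).prodMk (measurable_walk_sigmaOf le_rfl)
    have hG : Measurable[sigmaOf (fun (i : ℕ) (ω : ℕ → ℝ) => ω i) {n}] fun ω : ℕ → ℝ => ω n :=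
      measurable_sigmaOf (ξ := fun (i : ℕ) (ω : ℕ → ℝ) => ω i) (s := {n}) rfl
    have hinner : Measurable fun s : ℝ => ENNReal.ofReal (Real.exp (-α * s)) * ht' (Real.exp s) :=
      Measurable.mul (by fun_prop) (hhm.comp Real.measurable_exp)
    have hq : Measurable fun p : (ℝ≥0∞ × ℝ) × ℝ => p.1.1 *
        (ENNReal.ofReal (Real.exp (-α * (p.1.2 + p.2))) * ht' (Real.exp (p.1.2 + p.2))) :=
      Measurable.mul (by fun_prop) (hinner.comp
        (by fun_prop : Measurable fun p : (ℝ≥0∞ × ℝ) × ℝ => p.1.2 + p.2))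
    have key := lintegral_of_sigmaOf (P := iidLaw (stepLaw ν x α)) hmeas
      (iIndepFun_iidLaw (stepLaw ν x α)) (by simp : Disjoint (Set.Iio n) {n}) hF hG hq
    rw [Measure.infinitePi_map_eval] at key
    have hRm' : MeasurableSet R := sigmaOf_le hmeas _ _ hRm
    have hRm2 := measurableSet_staysBelow (Real.log t) (n + 1)
    rw [← lintegral_indicator hRm', ← lintegral_indicator hRm2]
    have ht0 : 0 < t := by linarith
    have hR2 : ∀ ω : ℕ → ℝ, ω ∈ {ω : ℕ → ℝ | ∀ i ≤ n + 1, walk ω i ≤ Real.log t} ↔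
        ω ∈ R ∧ Real.exp (walk ω (n + 1)) ∈ Set.Iic t := by
      intro ω
      simp only [hR, Set.mem_ofPred_eq, Set.mem_Iic, ← Real.le_log_iff_exp_le ht0]
      refine ⟨fun h => ⟨fun i hi => h i (by omega), h _ le_rfl⟩, fun h i hi => ?_⟩
      rcases Nat.lt_or_ge i (n + 1) with h3 | h3
      · exact h.1 i (by omega)
      · rw [show i = n + 1 by omega]; exact h.2
    symm
    convert key using 1
    · refine lintegral_congr fun ω => ?_
      dsimp only
      rw [← walk_succ]
      by_cases h2 : ω ∈ R
      · rw [Set.indicator_of_mem h2, one_mul, hht]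
        by_cases h3 : Real.exp (walk ω (n + 1)) ∈ Set.Iic t
        · rw [Set.indicator_of_mem h3, Set.indicator_of_mem ((hR2 ω).2 ⟨h2, h3⟩)]
        · rw [Set.indicator_of_notMem h3, Set.indicator_of_notMem (fun h4 => h3 ((hR2 ω).1 h4).2)]
          simp
      · rw [Set.indicator_of_notMem h2, zero_mul,
          Set.indicator_of_notMem (fun h4 => h2 ((hR2 ω).1 h4).1)]
    · refine lintegral_congr fun ω => ?_
      by_cases h2 : ω ∈ R
      · simp only [Set.indicator_of_mem h2, one_mul]
        rw [lintegral_stepLaw hx α (by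
          exact hinner.comp (by fun_prop : Measurable fun s => walk ω n + s) :
            Measurable fun s => ENNReal.ofReal (Real.exp (-α * (walk ω n + s))) *
              ht' (Real.exp (walk ω n + s))), hH]
        dsimp only
        rw [← lintegral_const_mul _ (by exact hjoint.comp measurable_prodMk_left :
          Measurable fun θ => ∑' j, ht' (Real.exp (walk ω n) * x j θ))]
        refine lintegral_congr fun θ => ?_
        rw [← ENNReal.tsum_mul_left]
        refine tsum_congr fun j => ?_
        -- A zero weight contributes nothing on either side: the test function vanishes at `0`, and
        -- so does the bias. For a positive weight the bias `x ^ α` cancels the factor `exp (-α *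
        -- log x)`.
        rcases (hx0 j θ).eq_or_lt with h3 | h3
        · rw [← h3, mul_zero, hzero, Real.zero_rpow hα0.ne']; simp
        · rw [Real.exp_add, Real.exp_log h3, mul_add, Real.exp_add,
            ENNReal.ofReal_mul (Real.exp_pos _).le, Real.rpow_def_of_pos h3]
          have h4 : ENNReal.ofReal (Real.exp (Real.log (x j θ) * α)) *
              ENNReal.ofReal (Real.exp (-α * Real.log (x j θ))) = 1 := by
            rw [← ENNReal.ofReal_mul (Real.exp_pos _).le, ← Real.exp_add]
            simp [mul_comm]
          calc _ = ENNReal.ofReal (Real.exp (-α * walk ω n)) * ht' (Real.exp (walk ω n) * x j θ) *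
                (ENNReal.ofReal (Real.exp (Real.log (x j θ) * α)) *
              ENNReal.ofReal (Real.exp (-α * Real.log (x j θ)))) := by rw [h4, mul_one]
            _ = _ := by ring
      · simp [h2]

end RelWeight

/-! ### Exponential integrals against measures bounded on short intervals -/

section ExponentialSums

theorem tsum_ofReal_exp_ne_top {β : ℝ} (hβ : 0 < β) :
    ∑' i : ℕ, ENNReal.ofReal (Real.exp (-β * i)) ≠ ∞ := by
  have h : ∀ i : ℕ, ENNReal.ofReal (Real.exp (-β * i)) = ENNReal.ofReal (Real.exp (-β)) ^ i := by
    intro i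
    rw [← ENNReal.ofReal_pow (Real.exp_pos _).le, ← Real.exp_nat_mul, mul_comm]
  simp_rw [h]
  rw [ENNReal.tsum_geometric]
  refine ENNReal.inv_ne_top.2 ?_
  rw [ne_eq, tsub_eq_zero_iff_le, not_le, ENNReal.ofReal_lt_one]
  simpa using hβ

/-- Cutting the half-line into intervals of length `δ` downwards from `b`, the exponential loses a
factor `exp (-(β * δ))` from one to the next, so the masses form a geometric series. -/
theorem setLIntegral_exp_Iic_le {G : Measure ℝ} {δ : ℝ} (hδ : 0 < δ) {K : ℝ≥0∞}
    (hG : ∀ y, G (Set.Icc y (y + δ)) ≤ K) {β : ℝ} (hβ : 0 < β) (b : ℝ) :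
    ∫⁻ s in Set.Iic b, ENNReal.ofReal (Real.exp (β * s)) ∂G ≤
      K * ENNReal.ofReal (Real.exp (β * b)) *
        ∑' i : ℕ, ENNReal.ofReal (Real.exp (-(β * δ) * i)) := by
  have hcover : Set.Iic b ⊆ ⋃ i : ℕ, Set.Icc (b - (i + 1) * δ) (b - (i + 1) * δ + δ) := by
    intro s hs
    have h0 : 0 ≤ (b - s) / δ := div_nonneg (sub_nonneg.2 hs) hδ.le
    refine Set.mem_iUnion.2 ⟨⌊(b - s) / δ⌋₊, ?_, ?_⟩
    · have := (Nat.lt_floor_add_one ((b - s) / δ)).le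
      rw [div_le_iff₀ hδ] at this
      linarith
    · have := Nat.floor_le h0
      rw [le_div_iff₀ hδ] at this
      linarith
  calc _ ≤ ∫⁻ s in ⋃ i : ℕ, Set.Icc (b - (i + 1) * δ) (b - (i + 1) * δ + δ),
        ENNReal.ofReal (Real.exp (β * s)) ∂G := lintegral_mono_set hcover
    _ ≤ ∑' i : ℕ, ∫⁻ s in Set.Icc (b - (i + 1) * δ) (b - (i + 1) * δ + δ),
        ENNReal.ofReal (Real.exp (β * s)) ∂G := lintegral_iUnion_le _ _
    _ ≤ ∑' i : ℕ, K * ENNReal.ofReal (Real.exp (β * b)) *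
          ENNReal.ofReal (Real.exp (-(β * δ) * i)) := by
      refine ENNReal.tsum_le_tsum fun i => ?_
      calc _ ≤ ∫⁻ s in Set.Icc (b - (i + 1) * δ) (b - (i + 1) * δ + δ),
            ENNReal.ofReal (Real.exp (β * b)) * ENNReal.ofReal (Real.exp (-(β * δ) * i)) ∂G := by
            refine setLIntegral_mono measurable_const fun s hs => ?_
            rw [← ENNReal.ofReal_mul (Real.exp_pos _).le, ← Real.exp_add]
            refine ENNReal.ofReal_le_ofReal (Real.exp_le_exp.2 ?_)
            have h1 : s ≤ b - i * δ := by have := hs.2; linarith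
            calc β * s ≤ β * (b - i * δ) := by gcongr
              _ = _ := by ring
        _ ≤ _ := by
            rw [setLIntegral_const]
            calc _ ≤ ENNReal.ofReal (Real.exp (β * b)) *
                  ENNReal.ofReal (Real.exp (-(β * δ) * i)) * K := by gcongr; exact hG _
              _ = _ := by ring
    _ = _ := ENNReal.tsum_mul_left

theorem setLIntegral_exp_Ici_le {G : Measure ℝ} {δ : ℝ} (hδ : 0 < δ) {K : ℝ≥0∞}
    (hG : ∀ y, G (Set.Icc y (y + δ)) ≤ K) {β : ℝ} (hβ : 0 < β) (b : ℝ) :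
    ∫⁻ s in Set.Ici b, ENNReal.ofReal (Real.exp (-β * s)) ∂G ≤
      K * ENNReal.ofReal (Real.exp (-β * b)) *
        ∑' i : ℕ, ENNReal.ofReal (Real.exp (-(β * δ) * i)) := by
  have h : ∀ y, (G.map Neg.neg) (Set.Icc y (y + δ)) ≤ K := by
    intro y
    rw [Measure.map_apply measurable_neg measurableSet_Icc]
    convert hG (-y - δ) using 2
    ext s
    simp only [Set.mem_preimage, Set.mem_Icc]
    constructor <;> rintro ⟨h1, h2⟩ <;> constructor <;> linarith
  have h1 := setLIntegral_exp_Iic_le hδ h hβ (-b)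
  rw [setLIntegral_map measurableSet_Iic (by fun_prop) measurable_neg] at h1
  simpa using h1

end ExponentialSums

/-! ### Moments of the weights on lines staying below a level -/

section Moments

variable {Ω Θ : Type*} [MeasurableSpace Θ] [MeasurableSpace Ω] {P : Measure Ω} {ν : Measure Θ}
  {x : ℕ → Θ → ℝ} {ξ : List ℕ → Ω → Θ}

/-- The occupation measure of the walk killed above the level `c`. -/
noncomputable def killedGreen (μ : Measure ℝ) [IsProbabilityMeasure μ] (c : ℝ) : Measure ℝ :=
  Measure.sum fun n =>
    ((iidLaw μ).restrict {ω | ∀ i ≤ n, walk ω i ≤ c}).map fun ω => walk ω n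

theorem lintegral_killedGreen (μ : Measure ℝ) [IsProbabilityMeasure μ] (c : ℝ) {g : ℝ → ℝ≥0∞}
    (hg : Measurable g) : ∫⁻ s, g s ∂(killedGreen μ c) =
      ∑' n, ∫⁻ ω in {ω | ∀ i ≤ n, walk ω i ≤ c}, g (walk ω n) ∂(iidLaw μ) := by
  rw [killedGreen, lintegral_sum_measure]
  exact tsum_congr fun n => lintegral_map hg (measurable_walk n)

theorem exists_killedGreen_le (μ : Measure ℝ) [IsProbabilityMeasure μ] (hμ : μ (Set.Iio 0) ≠ 0) :
    ∃ δ : ℝ, 0 < δ ∧ ∃ C : ℝ≥0∞, C ≠ ∞ ∧ ∀ c : ℝ, 0 ≤ c → ∀ y : ℝ,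
      killedGreen μ c (Set.Icc y (y + δ)) ≤ C * ENNReal.ofReal (1 + c) := by
  obtain ⟨δ, hδ, C, hC, h⟩ := exists_green_bound μ hμ
  refine ⟨δ, hδ, C, hC, fun c hc y => le_of_eq_of_le ?_ (h c hc y)⟩
  rw [killedGreen, Measure.sum_apply _ measurableSet_Icc]
  refine tsum_congr fun n => ?_
  rw [Measure.map_apply (measurable_walk n) measurableSet_Icc,
    Measure.restrict_apply (measurable_walk n measurableSet_Icc), Set.inter_comm]
  rfl

theorem tsum_below_eq [IsProbabilityMeasure P] [SFinite ν]
    (hξ : ∀ u, Measurable (ξ u)) (hi : iIndepFun ξ P)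
    (hν : ∀ u, P.map (ξ u) = ν) (hx : ∀ j, Measurable (x j)) (hx0 : ∀ j θ, 0 ≤ x j θ)
    {α : ℝ} (hα0 : 0 < α) [IsProbabilityMeasure (stepLaw ν x α)]
    {t : ℝ} (ht : 1 ≤ t) {h : ℝ → ℝ≥0∞} (hh : Measurable h) (h0 : h 0 = 0) :
    ∑' u : List ℕ, ∫⁻ ω in below x ξ t u, h (relWeight x ξ u ω) ∂P =
      ∫⁻ s, ENNReal.ofReal (Real.exp (-α * s)) * h (Real.exp s)
        ∂(killedGreen (stepLaw ν x α) (Real.log t)) := by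
  rw [tsum_list_eq, lintegral_killedGreen]
  · exact tsum_congr fun n => many_to_one hξ hi hν hx hx0 hα0 ht n hh h0
  · exact Measurable.mul (by fun_prop) (hh.comp Real.measurable_exp)

/-- Summed over generations, the many-to-one formula gives the integral of `exp ((q - α) * s)`
against the killed Green measure over one side of `log B`. In both cases the integrand decays
geometrically away from `log B`, leaving its value there times the bound for a short interval. -/
theorem exists_moment_bound [IsProbabilityMeasure P] [IsProbabilityMeasure ν]
    (hξ : ∀ u, Measurable (ξ u)) (hi : iIndepFun ξ P)
    (hν : ∀ u, P.map (ξ u) = ν) (hx : ∀ j, Measurable (x j)) (hx0 : ∀ j θ, 0 ≤ x j θ)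
    {α : ℝ} (hα0 : 0 < α) (hα : ∫⁻ θ, ∑' j, ENNReal.ofReal (x j θ ^ α) ∂ν = 1)
    (hN : 1 < ∫⁻ θ, ∑' j, {θ | 0 < x j θ}.indicator 1 θ ∂ν) {q : ℝ} (hq : 0 < q) :
    ∃ C : ℝ≥0∞, C ≠ ∞ ∧ ∀ t : ℝ, 1 ≤ t → ∀ B : ℝ, 0 < B →
      (α < q → ∑' u : List ℕ, ∫⁻ ω in below x ξ t u, (Set.Iic B).indicator
          (fun a => ENNReal.ofReal (a ^ q)) (relWeight x ξ u ω) ∂P ≤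
        C * ENNReal.ofReal (1 + Real.log t) * ENNReal.ofReal (B ^ (q - α))) ∧
      (q < α → ∑' u : List ℕ, ∫⁻ ω in below x ξ t u, (Set.Ioi B).indicator
          (fun a => ENNReal.ofReal (a ^ q)) (relWeight x ξ u ω) ∂P ≤
        C * ENNReal.ofReal (1 + Real.log t) * ENNReal.ofReal (B ^ (q - α))) := by
  have hprob := isProbabilityMeasure_stepLaw hx hα
  obtain ⟨δ, hδ, C, hC, hG⟩ := exists_killedGreen_le (stepLaw ν x α)
    (stepLaw_Iio_ne_zero hx hα0 hα hN)
  have hexp : ∀ s : ℝ, ENNReal.ofReal (Real.exp (-α * s)) * ENNReal.ofReal (Real.exp s ^ q) =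
      ENNReal.ofReal (Real.exp ((q - α) * s)) := by
    intro s
    rw [← ENNReal.ofReal_mul (Real.exp_pos _).le, ← Real.exp_mul, ← Real.exp_add]
    congr 2; ring
  have hm : Measurable fun a : ℝ => ENNReal.ofReal (a ^ q) := by fun_prop
  have hB' : ∀ B : ℝ, 0 < B → B ^ (q - α) = Real.exp ((q - α) * Real.log B) := by
    intro B hB
    rw [Real.rpow_def_of_pos hB, mul_comm]
  rcases lt_trichotomy q α with hq' | rfl | hq'
  · refine ⟨C * ∑' i : ℕ, ENNReal.ofReal (Real.exp (-((α - q) * δ) * i)),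
      ENNReal.mul_ne_top hC (tsum_ofReal_exp_ne_top (mul_pos (sub_pos.2 hq') hδ)),
      fun t ht B hB => ⟨fun h => absurd h hq'.not_gt, fun _ => ?_⟩⟩
    rw [tsum_below_eq hξ hi hν hx hx0 hα0 ht (hm.indicator measurableSet_Ioi)
      (by rw [Set.indicator_of_notMem]; simp [hB.le])]
    calc _ ≤ ∫⁻ s in Set.Ici (Real.log B), ENNReal.ofReal (Real.exp (-(α - q) * s))
          ∂(killedGreen (stepLaw ν x α) (Real.log t)) := by
          rw [← lintegral_indicator measurableSet_Ici]
          refine lintegral_mono fun s => ?_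
          by_cases h : Real.exp s ∈ Set.Ioi B
          · rw [Set.indicator_of_mem h, hexp, Set.indicator_of_mem
              (show s ∈ Set.Ici _ from ((Real.log_lt_iff_lt_exp hB).2 h).le), neg_sub]
          · rw [Set.indicator_of_notMem h, mul_zero]; exact zero_le
      _ ≤ _ := setLIntegral_exp_Ici_le hδ (hG _ (Real.log_nonneg ht)) (sub_pos.2 hq') _
      _ = _ := by rw [hB' B hB, neg_sub]; ring
  -- At `q = α` there is no decay to exploit, and neither strict inequality can hold.
  · exact ⟨0, ENNReal.zero_ne_top, fun t ht B hB =>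
      ⟨fun h => absurd h (lt_irrefl _), fun h => absurd h (lt_irrefl _)⟩⟩
  · refine ⟨C * ∑' i : ℕ, ENNReal.ofReal (Real.exp (-((q - α) * δ) * i)),
      ENNReal.mul_ne_top hC (tsum_ofReal_exp_ne_top (mul_pos (sub_pos.2 hq') hδ)),
      fun t ht B hB => ⟨fun _ => ?_, fun h => absurd h hq'.not_gt⟩⟩
    rw [tsum_below_eq hξ hi hν hx hx0 hα0 ht (hm.indicator measurableSet_Iic)
      (by rw [Set.indicator_of_mem (by simpa using hB.le), Real.zero_rpow hq.ne']; simp)]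
    calc _ ≤ ∫⁻ s in Set.Iic (Real.log B), ENNReal.ofReal (Real.exp ((q - α) * s))
          ∂(killedGreen (stepLaw ν x α) (Real.log t)) := by
          rw [← lintegral_indicator measurableSet_Iic]
          refine lintegral_mono fun s => ?_
          by_cases h : Real.exp s ∈ Set.Iic B
          · rw [Set.indicator_of_mem h, hexp, Set.indicator_of_mem
              (show s ∈ Set.Iic _ from (Real.le_log_iff_exp_le hB).2 h)]
          · rw [Set.indicator_of_notMem h, mul_zero]; exact zero_le
      _ ≤ _ := setLIntegral_exp_Iic_le hδ (hG _ (Real.log_nonneg ht)) (sub_pos.2 hq') _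
      _ = _ := by rw [hB' B hB]; ring

/-- The weights stay below `t` with probability at least `1 - t ^ (-α)`. -/
theorem measure_not_below_le [IsProbabilityMeasure P] [IsProbabilityMeasure ν]
    (hξ : ∀ u, Measurable (ξ u)) (hi : iIndepFun ξ P)
    (hν : ∀ u, P.map (ξ u) = ν) (hx : ∀ j, Measurable (x j)) (hx0 : ∀ j θ, 0 ≤ x j θ)
    {α : ℝ} (hα0 : 0 < α) (hα : ∫⁻ θ, ∑' j, ENNReal.ofReal (x j θ ^ α) ∂ν = 1)
    {t : ℝ} (ht : 1 ≤ t) :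
    P {ω | ∃ u, ω ∉ below x ξ t u} ≤ ENNReal.ofReal (t ^ (-α)) := by
  have ht0 : 0 < t := by linarith
  have htα : 0 < t ^ α := Real.rpow_pos_of_pos ht0 _
  have ha := measurable_relWeight' (ξ := ξ) hξ hx
  have hb := measurableSet_below' (ξ := ξ) hξ hx t
  set E : List ℕ → ℕ → Set Ω := fun u j => below x ξ t u ∩ {ω | t < relWeight x ξ (j :: u) ω}
    with hE
  have hEm : ∀ u j, MeasurableSet (E u j) := fun u j =>
    (hb u).inter (measurableSet_lt measurable_const (ha _))
  set k : ℕ → ℝ≥0∞ := fun n => ∑' u : Word n,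
    ∫⁻ ω in below x ξ t u, ENNReal.ofReal (relWeight x ξ u ω ^ α) ∂P with hk
  set bad : ℕ → ℝ≥0∞ := fun n => ∑' u : Word n, ∑' j, P (E u j) with hbad
  -- The mean sum of `α`-th powers passes unchanged from parents to children. A child of an uncut
  -- line either exceeds `t`, which uses up at least `t ^ α` on that event, or is counted in `k (n +
  -- 1)`. Summing over generations leaves at most `k 0 = 1` to use up.
  have hstep : ∀ n, ENNReal.ofReal (t ^ α) * bad n + k (n + 1) ≤ k n := by
    intro n
    simp only [hk, hbad]
    rw [tsum_word_succ n fun u => ∫⁻ ω in below x ξ t u,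
      ENNReal.ofReal (relWeight x ξ u ω ^ α) ∂P, ← ENNReal.tsum_mul_left, ← ENNReal.tsum_add]
    refine ENNReal.tsum_le_tsum fun u => ?_
    rw [← ENNReal.tsum_mul_left, ← ENNReal.tsum_add]
    have h1 : ∫⁻ ω in below x ξ t u, ENNReal.ofReal (relWeight x ξ u ω ^ α) ∂P =
        ∑' j, ∫⁻ ω in below x ξ t u, ENNReal.ofReal (relWeight x ξ (j :: u.1) ω ^ α) ∂P := by
      have hg : Measurable fun p : ℝ × Θ => ∑' j, ENNReal.ofReal (p.1 ^ α) *
          ENNReal.ofReal (x j p.2 ^ α) := by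
        refine Measurable.tsum fun j => (measurable_fst.pow_const α).ennreal_ofReal.mul ?_
        exact (((hx j).comp measurable_snd).pow_const α).ennreal_ofReal
      have h2 := setLIntegral_below hξ hi hν hx t u.1 hg
      simp only [ENNReal.tsum_mul_left] at h2
      have h3 : ∀ y : ℝ, ∫⁻ θ, ENNReal.ofReal (y ^ α) * ∑' j, ENNReal.ofReal (x j θ ^ α) ∂ν =
          ENNReal.ofReal (y ^ α) := by
        intro y
        rw [lintegral_const_mul, hα, mul_one]
        exact Measurable.tsum fun j => ((hx j).pow_const α).ennreal_ofReal
      simp only [h3] at h2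
      rw [← h2, ← lintegral_tsum]
      · refine lintegral_congr fun ω => ?_
        rw [← ENNReal.tsum_mul_left]
        refine tsum_congr fun j => ?_
        rw [relWeight, Real.mul_rpow (relWeight_nonneg hx0 _ _) (hx0 _ _), ENNReal.ofReal_mul]
        exact Real.rpow_nonneg (relWeight_nonneg hx0 _ _) _
      · exact fun j => ((ha _).pow_const α).ennreal_ofReal.aemeasurable
    rw [h1]
    refine ENNReal.tsum_le_tsum fun j => ?_
    have h4 : below x ξ t u = E u j ∪ below x ξ t (j :: u.1) := by
      ext ω
      simp only [hE, below, Set.mem_union, Set.mem_inter_iff, Set.mem_ofPred_eq]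
      have := lt_or_ge t (relWeight x ξ (j :: u.1) ω)
      tauto
    have h5 : Disjoint (E u j) (below x ξ t (j :: u.1)) := by
      rw [Set.disjoint_left]
      rintro ω ⟨-, h6⟩ ⟨-, h7⟩
      have h6' : t < relWeight x ξ (j :: u.1) ω := h6
      exact not_lt.2 h7 h6'
    rw [h4, lintegral_union (hb _) h5]
    gcongr
    rw [← setLIntegral_const]
    refine setLIntegral_mono ((ha _).pow_const α).ennreal_ofReal fun ω h6 => ?_
    exact ENNReal.ofReal_le_ofReal (Real.rpow_le_rpow ht0.le (le_of_lt h6.2) hα0.le)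
  have hk0 : k 0 = 1 := by
    simp only [hk]
    rw [tsum_word_zero fun u => ∫⁻ ω in below x ξ t u, ENNReal.ofReal (relWeight x ξ u ω ^ α) ∂P]
    simp [below, relWeight]
  have hpart : ∀ n, ENNReal.ofReal (t ^ α) * ∑ i ∈ Finset.range n, bad i + k n ≤ 1 := by
    intro n
    induction n with
    | zero => simp [hk0]
    | succ n ih =>
      refine le_trans ?_ ih
      rw [Finset.sum_range_succ, mul_add, add_assoc]
      gcongr
      exact hstep n
  have hsum : ENNReal.ofReal (t ^ α) * ∑' n, bad n ≤ 1 := by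
    rw [ENNReal.tsum_eq_iSup_nat, ENNReal.mul_iSup]
    exact iSup_le fun n => le_trans le_self_add (hpart n)
  have hsub : {ω | ∃ u, ω ∉ below x ξ t u} ⊆ ⋃ u, ⋃ j, E u j := by
    rintro ω ⟨u, hu⟩
    by_contra hcon
    simp only [Set.mem_iUnion, not_exists] at hcon
    apply hu
    clear hu
    induction u with
    | nil => trivial
    | cons j u ih =>
      exact ⟨ih, show _ ≤ t from not_lt.1 fun h => hcon u j ⟨ih, h⟩⟩
  calc _ ≤ P (⋃ u, ⋃ j, E u j) := measure_mono hsub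
    _ ≤ ∑' u, ∑' j, P (E u j) :=
      (measure_iUnion_le _).trans (ENNReal.tsum_le_tsum fun u => measure_iUnion_le _)
    _ = ∑' n, bad n := tsum_list_eq _
    _ ≤ (ENNReal.ofReal (t ^ α))⁻¹ := by
      rw [ENNReal.le_inv_iff_mul_le, mul_comm]; exact hsum
    _ = _ := by
      rw [← ENNReal.ofReal_inv_of_pos htα, Real.rpow_neg ht0.le]

end Moments

/-! ### Conformal operators and branching data -/

/-- An operator which is a similarity or zero. -/
def IsConformal {E : Type*} [NormedAddCommGroup E] [NormedSpace ℝ E] (T : E →L[ℝ] E) : Prop :=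
  ∀ v, ‖T v‖ = ‖T‖ * ‖v‖

/-- A conformal operator stretches every vector by the same factor, so one nonzero vector detects
the norm of a product. -/
theorem IsConformal.norm_mul {E : Type*} [NormedAddCommGroup E] [NormedSpace ℝ E] [Nontrivial E]
    {S T : E →L[ℝ] E} (hS : IsConformal S) (hT : IsConformal T) : ‖S * T‖ = ‖S‖ * ‖T‖ := by
  obtain ⟨v, hv⟩ := exists_ne (0 : E)
  refine le_antisymm (norm_mul_le _ _) ?_
  have h := (S * T).le_opNorm v
  rw [mul_apply_eq_comp, hS, hT, ← mul_assoc] at h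
  exact le_of_mul_le_mul_right h (norm_pos_iff.2 hv)

theorem IsConformal.mul {E : Type*} [NormedAddCommGroup E] [NormedSpace ℝ E] [Nontrivial E]
    {S T : E →L[ℝ] E} (hS : IsConformal S) (hT : IsConformal T) : IsConformal (S * T) := by
  intro v
  rw [hS.norm_mul hT, mul_apply_eq_comp, hS, hT, mul_assoc]

/-- The operator weight of an individual. -/
noncomputable def opWeight {Ω Θ E : Type*} [NormedAddCommGroup E] [NormedSpace ℝ E]
    (A : ℕ → Θ → E →L[ℝ] E) (ξ : List ℕ → Ω → Θ) : List ℕ → Ω → E →L[ℝ] E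
  | [], _ => 1
  | j :: u, ω => opWeight A ξ u ω * A j (ξ u ω)

/-- A branching random walk with conformal displacements `A j (ξ u)`, where the marks `ξ u` are
i.i.d. with law `ν`. -/
structure IsBranching {Ω Θ E : Type*} [NormedAddCommGroup E] [InnerProductSpace ℝ E]
    [MeasurableSpace E] [MeasurableSpace Ω] [MeasurableSpace Θ] (P : Measure Ω) (ν : Measure Θ)
    (ξ : List ℕ → Ω → Θ) (A : ℕ → Θ → E →L[ℝ] E) (α : ℝ) : Prop where
  measurable : ∀ u, Measurable (ξ u)
  indep : iIndepFun ξ P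
  map_eq : ∀ u, P.map (ξ u) = ν
  measurable_op : ∀ j, Measurable (A j)
  conformal : ∀ j θ, IsConformal (A j θ)
  moment : ∫⁻ θ, ∑' j, ENNReal.ofReal (‖A j θ‖ ^ α) ∂ν = 1
  supercritical : 1 < ∫⁻ θ, ∑' j, {θ | 0 < ‖A j θ‖}.indicator 1 θ ∂ν

/-! ### Truncated innovations and their orthogonality -/

section Vector

variable {Ω Θ E : Type*} [NormedAddCommGroup E] [InnerProductSpace ℝ E] [FiniteDimensional ℝ E]
  [Nontrivial E] [MeasurableSpace E] [BorelSpace E] [MeasurableSpace Ω] [MeasurableSpace Θ]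
  {P : Measure Ω} {ν : Measure Θ} {ξ : List ℕ → Ω → Θ} {A : ℕ → Θ → E →L[ℝ] E} {α : ℝ}

/-- The event that no weight on the ancestral line of an individual exceeds `t`. -/
abbrev stays (A : ℕ → Θ → E →L[ℝ] E) (ξ : List ℕ → Ω → Θ) (t : ℝ) (u : List ℕ) : Set Ω :=
  below (fun j θ => ‖A j θ‖) ξ t u

namespace IsBranching

theorem isConformal_opWeight (hB : IsBranching P ν ξ A α) (u : List ℕ) (ω : Ω) :
    IsConformal (opWeight A ξ u ω) := by
  induction u with
  | nil => intro v; simp [opWeight]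
  | cons j u ih => exact ih.mul (hB.conformal _ _)

theorem norm_opWeight (hB : IsBranching P ν ξ A α) (u : List ℕ) (ω : Ω) :
    ‖opWeight A ξ u ω‖ = relWeight (fun j θ => ‖A j θ‖) ξ u ω := by
  induction u with
  | nil => simp [opWeight, relWeight]
  | cons j u ih =>
    rw [opWeight, relWeight, (hB.isConformal_opWeight u ω).norm_mul (hB.conformal _ _), ih]

theorem measurable_norm_op (hB : IsBranching P ν ξ A α) (j : ℕ) :
    Measurable fun θ => ‖A j θ‖ := (hB.measurable_op j).norm

theorem measurable_opWeight_sigmaOf (hB : IsBranching P ν ξ A α) (u : List ℕ) {s : Set (List ℕ)}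
    (hs : ∀ v : List ℕ, v.length < u.length → v ∈ s) :
    Measurable[sigmaOf ξ s] (opWeight A ξ u) := by
  induction u with
  | nil => exact measurable_const
  | cons j u ih =>
    refine Measurable.mul (ih fun v hv => hs v (by simp; omega)) ?_
    exact (hB.measurable_op j).comp (measurable_sigmaOf (hs u (by simp)))

theorem measurable_opWeight (hB : IsBranching P ν ξ A α) (u : List ℕ) :
    Measurable (opWeight A ξ u) :=
  (hB.measurable_opWeight_sigmaOf u (s := Set.univ) fun _ _ => trivial).mono
    (sigmaOf_le hB.measurable _) le_rfl

theorem measurableSet_stays (hB : IsBranching P ν ξ A α) (t : ℝ) (u : List ℕ) :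
    MeasurableSet (stays A ξ t u) :=
  measurableSet_below' hB.measurable hB.measurable_norm_op t u

end IsBranching

theorem measurable_clm_apply {β : Type*} {mβ : MeasurableSpace β} {f : β → E →L[ℝ] E} {g : β → E}
    (hf : Measurable f) (hg : Measurable g) : Measurable fun b => f b (g b) :=
  (by fun_prop : Continuous fun p : (E →L[ℝ] E) × E => p.1 p.2).measurable.comp (hf.prodMk hg)

/-- The restriction of `D` to the event that `a * ‖D‖` does not exceed `t`. -/
noncomputable def truncated (D : Θ → E) (t a : ℝ) (θ : Θ) : E :=
  {θ | a * ‖D θ‖ ≤ t}.indicator D θ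

theorem measurable_truncated {D : Θ → E} (hD : Measurable D) (t : ℝ) :
    Measurable fun p : ℝ × Θ => truncated D t p.1 p.2 := by
  have h : MeasurableSet {p : ℝ × Θ | p.1 * ‖D p.2‖ ≤ t} :=
    measurableSet_le (measurable_fst.mul (hD.comp measurable_snd).norm) measurable_const
  exact (hD.comp measurable_snd).indicator h

theorem norm_truncated_le (D : Θ → E) (t a : ℝ) (θ : Θ) : ‖truncated D t a θ‖ ≤ ‖D θ‖ := by
  unfold truncated
  exact norm_indicator_le_norm_self _ _

theorem mul_norm_truncated_le (D : Θ → E) {t : ℝ} (ht : 0 ≤ t) (a : ℝ) (θ : Θ) :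
    a * ‖truncated D t a θ‖ ≤ t := by
  unfold truncated
  by_cases h : θ ∈ {θ | a * ‖D θ‖ ≤ t}
  · rw [Set.indicator_of_mem h]; exact h
  · rw [Set.indicator_of_notMem h]; simpa using ht

theorem integrable_truncated {D : Θ → E} (hD : Measurable D) (hDi : Integrable D ν) (t a : ℝ) :
    Integrable (truncated D t a) ν := by
  refine hDi.mono ?_ (ae_of_all _ fun θ => norm_truncated_le D t a θ)
  exact ((measurable_truncated hD t).comp measurable_prodMk_left).aestronglyMeasurable

/-- The centred truncated innovation at `u`. -/
noncomputable def centred (ν : Measure Θ) (ξ : List ℕ → Ω → Θ) (A : ℕ → Θ → E →L[ℝ] E)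
    (D : Θ → E) (t : ℝ) (u : List ℕ) (ω : Ω) : E :=
  (stays A ξ t u).indicator (fun ω => opWeight A ξ u ω
    (truncated D t ‖opWeight A ξ u ω‖ (ξ u ω) - ∫ θ, truncated D t ‖opWeight A ξ u ω‖ θ ∂ν)) ω

/-- The difference between the innovation at `u` and its centred truncation. -/
noncomputable def remainder (ν : Measure Θ) (ξ : List ℕ → Ω → Θ) (A : ℕ → Θ → E →L[ℝ] E)
    (D : Θ → E) (t : ℝ) (u : List ℕ) (ω : Ω) : E :=
  (stays A ξ t u).indicator (fun ω => opWeight A ξ u ω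
    (D (ξ u ω) - truncated D t ‖opWeight A ξ u ω‖ (ξ u ω)
      + ∫ θ, truncated D t ‖opWeight A ξ u ω‖ θ ∂ν)) ω

theorem centred_add_remainder (D : Θ → E) (t : ℝ) (u : List ℕ) (ω : Ω) :
    centred ν ξ A D t u ω + remainder ν ξ A D t u ω =
      (stays A ξ t u).indicator (fun ω => opWeight A ξ u ω (D (ξ u ω))) ω := by
  unfold centred remainder
  by_cases h : ω ∈ stays A ξ t u
  · simp only [Set.indicator_of_mem h, ← map_add]
    congr 1; abel
  · simp only [Set.indicator_of_notMem h, add_zero]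

variable [IsProbabilityMeasure ν]

theorem measurable_integral_truncated {D : Θ → E} (hD : Measurable D) (t : ℝ) :
    Measurable fun a : ℝ => ∫ θ, truncated D t a θ ∂ν :=
  ((measurable_truncated hD t).stronglyMeasurable.integral_prod_right').measurable

namespace IsBranching

theorem measurable_centred_sigmaOf (hB : IsBranching P ν ξ A α) {D : Θ → E} (hD : Measurable D)
    (t : ℝ) (u : List ℕ) {s : Set (List ℕ)} (hs : ∀ v : List ℕ, v.length < u.length → v ∈ s)
    (hu : u ∈ s) : Measurable[sigmaOf ξ s] (centred ν ξ A D t u) := by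
  have hW := hB.measurable_opWeight_sigmaOf u hs
  refine Measurable.indicator ?_ (measurableSet_below hB.measurable_norm_op t u hs)
  refine measurable_clm_apply hW (Measurable.sub ?_ ?_)
  · exact (measurable_truncated hD t).comp ((measurable_norm.comp hW).prodMk (measurable_sigmaOf hu))
  · exact (measurable_integral_truncated hD t).comp (measurable_norm.comp hW)

theorem measurable_centred (hB : IsBranching P ν ξ A α) {D : Θ → E} (hD : Measurable D)
    (t : ℝ) (u : List ℕ) : Measurable (centred ν ξ A D t u) :=
  (hB.measurable_centred_sigmaOf hD t u (s := Set.univ) (fun _ _ => trivial) trivial).mono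
    (sigmaOf_le hB.measurable _) le_rfl

theorem measurable_remainder (hB : IsBranching P ν ξ A α) {D : Θ → E} (hD : Measurable D)
    (t : ℝ) (u : List ℕ) : Measurable (remainder ν ξ A D t u) := by
  have hW := hB.measurable_opWeight u
  refine Measurable.indicator ?_ (hB.measurableSet_stays t u)
  refine measurable_clm_apply hW (Measurable.add (Measurable.sub (hD.comp (hB.measurable u)) ?_) ?_)
  · exact (measurable_truncated hD t).comp (hW.norm.prodMk (hB.measurable u))
  · exact (measurable_integral_truncated hD t).comp hW.norm

/-- Multiplied by the weight, the truncated innovation is at most `t`, and hence so is its mean.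
Boundedness makes all the inner products below integrable although the innovations need not be
square integrable. -/
theorem norm_centred_le (hB : IsBranching P ν ξ A α) (D : Θ → E) {t : ℝ} (ht : 0 ≤ t)
    (u : List ℕ) (ω : Ω) : ‖centred ν ξ A D t u ω‖ ≤ 2 * t := by
  unfold centred
  refine (norm_indicator_le_norm_self _ _).trans ?_
  rw [hB.isConformal_opWeight u ω]
  set a := ‖opWeight A ξ u ω‖ with ha
  have h1 : a * ‖∫ θ, truncated D t a θ ∂ν‖ ≤ t := by
    have h2 : ‖∫ θ, a • truncated D t a θ ∂ν‖ ≤ t * (ν.real Set.univ) := by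
      refine norm_integral_le_of_norm_le_const (ae_of_all _ fun θ => ?_)
      rw [norm_smul, ha, norm_norm]
      exact mul_norm_truncated_le D ht _ θ
    rw [integral_smul, norm_smul, ha, norm_norm] at h2
    simpa using h2
  calc _ ≤ a * (‖truncated D t a (ξ u ω)‖ + ‖∫ θ, truncated D t a θ ∂ν‖) := by
        gcongr; exact norm_sub_le _ _
    _ ≤ _ := by
        rw [mul_add]
        have := mul_norm_truncated_le D ht a (ξ u ω)
        linarith

/-- Since `v` is no longer than `u` and differs from it, the term at `v`, the weight of `u` and the
barrier event of `u` involve only marks other than `ξ u`. With these frozen, the integral over `ξ u`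
is that of a centred vector under a linear map. -/
theorem integral_inner_centred_eq_zero_of_le [IsProbabilityMeasure P]
    (hB : IsBranching P ν ξ A α) {D : Θ → E} (hD : Measurable D)
    (hDi : Integrable D ν) {t : ℝ} (ht : 0 ≤ t) {u v : List ℕ} (huv : u ≠ v)
    (hlen : v.length ≤ u.length) :
    ∫ ω, inner ℝ (centred ν ξ A D t v ω) (centred ν ξ A D t u ω) ∂P = 0 := by
  have hs := sigmaOf_compl_singleton_length u
  have hW := hB.measurable_opWeight_sigmaOf u hs
  have hY : Measurable[sigmaOf ξ {u}ᶜ] (centred ν ξ A D t v) := by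
    refine hB.measurable_centred_sigmaOf hD t v ?_ ?_
    · exact fun z hz => hs z (hz.trans_le hlen)
    · exact fun h => huv h.symm
  have hF : Measurable[sigmaOf ξ {u}ᶜ] fun ω => ((centred ν ξ A D t v ω,
      (stays A ξ t u).indicator (fun _ => (1 : ℝ)) ω), opWeight A ξ u ω) :=
    (hY.prodMk (measurable_const.indicator
      (measurableSet_below hB.measurable_norm_op t u hs))).prodMk hW
  have hG : Measurable[sigmaOf ξ {u}] (ξ u) := measurable_sigmaOf rfl
  have hh : Measurable fun p : ((E × ℝ) × (E →L[ℝ] E)) × Θ => p.1.1.2 *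
      inner ℝ p.1.1.1 (p.1.2 (truncated D t ‖p.1.2‖ p.2 - ∫ θ, truncated D t ‖p.1.2‖ θ ∂ν)) := by
    refine Measurable.mul (by fun_prop) (Measurable.inner (by fun_prop) ?_)
    refine measurable_clm_apply (by fun_prop) (Measurable.sub ?_ ?_)
    · exact (measurable_truncated hD t).comp (by fun_prop :
        Measurable fun p : ((E × ℝ) × (E →L[ℝ] E)) × Θ => (‖p.1.2‖, p.2))
    · exact (measurable_integral_truncated hD t).comp (by fun_prop :
        Measurable fun p : ((E × ℝ) × (E →L[ℝ] E)) × Θ => ‖p.1.2‖)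
  have heq : ∀ ω, inner ℝ (centred ν ξ A D t v ω) (centred ν ξ A D t u ω) =
      (stays A ξ t u).indicator (fun _ => (1 : ℝ)) ω * inner ℝ (centred ν ξ A D t v ω)
        (opWeight A ξ u ω (truncated D t ‖opWeight A ξ u ω‖ (ξ u ω) -
          ∫ θ, truncated D t ‖opWeight A ξ u ω‖ θ ∂ν)) := by
    intro ω
    conv_lhs => rw [centred.eq_def ν ξ A D t u ω]
    by_cases h : ω ∈ stays A ξ t u <;> simp [h]
  have hint : Integrable (fun ω => (stays A ξ t u).indicator (fun _ => (1 : ℝ)) ω *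
      inner ℝ (centred ν ξ A D t v ω) (opWeight A ξ u ω (truncated D t ‖opWeight A ξ u ω‖ (ξ u ω) -
          ∫ θ, truncated D t ‖opWeight A ξ u ω‖ θ ∂ν))) P := by
    simp_rw [← heq]
    refine Integrable.of_bound (C := 2 * t * (2 * t)) ?_ (ae_of_all _ fun ω => ?_)
    · exact ((hB.measurable_centred hD t v).inner
        (hB.measurable_centred hD t u)).aestronglyMeasurable
    · refine (norm_inner_le_norm _ _).trans ?_
      exact mul_le_mul (hB.norm_centred_le D ht v ω) (hB.norm_centred_le D ht u ω)
        (norm_nonneg _) (by positivity)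
  simp_rw [heq]
  refine (integral_of_sigmaOf hB.measurable hB.indep
    (by simp : Disjoint ({u}ᶜ : Set (List ℕ)) {u}) hF hG hh hint).trans ?_
  rw [hB.map_eq]
  refine integral_eq_zero_of_ae (ae_of_all _ fun ω => ?_)
  dsimp only
  rw [integral_const_mul]
  set a := ‖opWeight A ξ u ω‖
  have hti := integrable_truncated hD hDi t a
  have h1 := ContinuousLinearMap.integral_comp_comm
    ((innerSL ℝ (centred ν ξ A D t v ω)).comp (opWeight A ξ u ω))
    (hti.sub (integrable_const (∫ θ, truncated D t a θ ∂ν)))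
  simp only [ContinuousLinearMap.comp_apply, innerSL_apply_apply, Pi.sub_apply] at h1
  rw [h1, integral_sub hti (integrable_const _)]
  simp

theorem integral_inner_centred_eq_zero [IsProbabilityMeasure P]
    (hB : IsBranching P ν ξ A α) {D : Θ → E} (hD : Measurable D)
    (hDi : Integrable D ν) {t : ℝ} (ht : 0 ≤ t) {u v : List ℕ} (huv : u ≠ v) :
    ∫ ω, inner ℝ (centred ν ξ A D t v ω) (centred ν ξ A D t u ω) ∂P = 0 := by
  rcases le_total v.length u.length with h | h
  · exact hB.integral_inner_centred_eq_zero_of_le hD hDi ht huv h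
  · simp_rw [fun ω => real_inner_comm (centred ν ξ A D t u ω) (centred ν ξ A D t v ω)]
    exact hB.integral_inner_centred_eq_zero_of_le hD hDi ht huv.symm h

end IsBranching

theorem lintegral_sq_sum_of_orthogonal {ι : Type*} [IsFiniteMeasure P] {Y : ι → Ω → E}
    (hY : ∀ i, Measurable (Y i)) {C : ℝ} (hC : ∀ i ω, ‖Y i ω‖ ≤ C)
    (horth : ∀ i j, i ≠ j → ∫ ω, inner ℝ (Y i ω) (Y j ω) ∂P = 0) (s : Finset ι) :
    ∫⁻ ω, ENNReal.ofReal (‖∑ i ∈ s, Y i ω‖ ^ 2) ∂P =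
      ∑ i ∈ s, ∫⁻ ω, ENNReal.ofReal (‖Y i ω‖ ^ 2) ∂P := by
  have hint : ∀ i j, Integrable (fun ω => inner ℝ (Y i ω) (Y j ω)) P := by
    intro i j
    refine Integrable.of_bound (C := C * C) ((hY i).inner (hY j)).aestronglyMeasurable
      (ae_of_all _ fun ω => (norm_inner_le_norm _ _).trans ?_)
    exact mul_le_mul (hC i ω) (hC j ω) (norm_nonneg _) ((norm_nonneg _).trans (hC i ω))
  have hsq : ∀ ω, ‖∑ i ∈ s, Y i ω‖ ^ 2 = ∑ i ∈ s, ∑ j ∈ s, inner ℝ (Y i ω) (Y j ω) := by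
    intro ω
    rw [← real_inner_self_eq_norm_sq, sum_inner]
    simp_rw [inner_sum]
  have hsi : Integrable (fun ω => ‖∑ i ∈ s, Y i ω‖ ^ 2) P := by
    simp_rw [hsq]
    exact integrable_finsetSum _ fun i _ => integrable_finsetSum _ fun j _ => hint i j
  have hii : ∀ i, Integrable (fun ω => ‖Y i ω‖ ^ 2) P := by
    intro i
    simp_rw [← real_inner_self_eq_norm_sq]
    exact hint i i
  rw [← ofReal_integral_eq_lintegral_ofReal hsi (ae_of_all _ fun ω => by positivity)]
  simp_rw [← fun i => ofReal_integral_eq_lintegral_ofReal (hii i)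
    (ae_of_all _ fun ω => by positivity)]
  rw [← ENNReal.ofReal_sum_of_nonneg fun i _ => integral_nonneg fun ω => by positivity]
  congr 1
  simp_rw [hsq]
  rw [integral_finsetSum _ fun i _ => integrable_finsetSum _ fun j _ => hint i j]
  refine Finset.sum_congr rfl fun i hi => ?_
  rw [integral_finsetSum _ fun j _ => hint i j, Finset.sum_eq_single i]
  · simp_rw [real_inner_self_eq_norm_sq]
  · exact fun j _ hj => horth i j hj.symm
  · exact fun h => absurd hi h

end Vector

/-! ### Tail of finite sums of innovations -/

section Tail

variable {Ω Θ E : Type*} [NormedAddCommGroup E] [InnerProductSpace ℝ E] [FiniteDimensional ℝ E]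
  [Nontrivial E] [MeasurableSpace E] [BorelSpace E] [MeasurableSpace Ω] [MeasurableSpace Θ]
  {P : Measure Ω} {ν : Measure Θ} {ξ : List ℕ → Ω → Θ} {A : ℕ → Θ → E →L[ℝ] E} {α : ℝ}
  [IsProbabilityMeasure ν]

/-- The variance does not exceed the second moment. -/
theorem lintegral_sq_sub_integral_le {B : Θ → E} (hB : Measurable B) {C : ℝ}
    (hC : ∀ θ, ‖B θ‖ ≤ C) :
    ∫⁻ θ, ENNReal.ofReal (‖B θ - ∫ θ', B θ' ∂ν‖ ^ 2) ∂ν ≤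
      ∫⁻ θ, ENNReal.ofReal (‖B θ‖ ^ 2) ∂ν := by
  set n := ∫ θ', B θ' ∂ν with hn
  have hBi : Integrable B ν := Integrable.of_bound hB.aestronglyMeasurable C (ae_of_all _ hC)
  have hB2 : Integrable (fun θ => ‖B θ‖ ^ 2) ν := by
    refine Integrable.of_bound (hB.norm.pow_const 2).aestronglyMeasurable (C ^ 2)
      (ae_of_all _ fun θ => ?_)
    rw [norm_pow, norm_norm]
    exact pow_le_pow_left₀ (norm_nonneg _) (hC θ) 2
  have hin : Integrable (fun θ => inner ℝ (B θ) n) ν := hBi.inner_const n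
  have hexp : ∀ θ, ‖B θ - n‖ ^ 2 = ‖B θ‖ ^ 2 - 2 * inner ℝ (B θ) n + ‖n‖ ^ 2 := fun θ =>
    norm_sub_sq_real _ _
  have hint : Integrable (fun θ => ‖B θ‖ ^ 2 - 2 * inner ℝ (B θ) n) ν := hB2.sub (hin.const_mul 2)
  have hI : ∫ θ, inner ℝ (B θ) n ∂ν = ‖n‖ ^ 2 := by
    simp_rw [fun θ => real_inner_comm n (B θ)]
    rw [integral_inner hBi, ← hn, real_inner_self_eq_norm_sq]
  rw [← ofReal_integral_eq_lintegral_ofReal hB2 (ae_of_all _ fun θ => by positivity),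
    ← ofReal_integral_eq_lintegral_ofReal (by
      simp_rw [hexp]; exact hint.add (integrable_const _)) (ae_of_all _ fun θ => by positivity)]
  refine ENNReal.ofReal_le_ofReal ?_
  simp_rw [hexp]
  rw [integral_add hint (integrable_const _), integral_sub hB2 (hin.const_mul 2),
    integral_const_mul, hI]
  simp only [integral_const, probReal_univ, smul_eq_mul, one_mul]
  nlinarith [sq_nonneg ‖n‖]

namespace IsBranching

theorem lintegral_sq_centred_le [IsProbabilityMeasure P] (hB : IsBranching P ν ξ A α) {D : Θ → E}
    (hD : Measurable D) {t : ℝ} (ht : 0 ≤ t) (u : List ℕ) :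
    ∫⁻ ω, ENNReal.ofReal (‖centred ν ξ A D t u ω‖ ^ 2) ∂P ≤
      ∫⁻ ω in stays A ξ t u, ∫⁻ θ, ENNReal.ofReal
        ((relWeight (fun j θ => ‖A j θ‖) ξ u ω * ‖truncated D t
          (relWeight (fun j θ => ‖A j θ‖) ξ u ω) θ‖) ^ 2) ∂ν ∂P := by
  have hg : Measurable fun p : ℝ × Θ => ENNReal.ofReal
      ((p.1 * ‖truncated D t p.1 p.2 - ∫ θ, truncated D t p.1 θ ∂ν‖) ^ 2) := by
    refine ((measurable_fst.mul (Measurable.norm (Measurable.sub (measurable_truncated hD t) ?_))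
      ).pow_const 2).ennreal_ofReal
    exact (measurable_integral_truncated hD t).comp measurable_fst
  have h := setLIntegral_below hB.measurable hB.indep hB.map_eq hB.measurable_norm_op t u hg
  have h1 : ∫⁻ ω, ENNReal.ofReal (‖centred ν ξ A D t u ω‖ ^ 2) ∂P =
      ∫⁻ ω in stays A ξ t u, ENNReal.ofReal ((relWeight (fun j θ => ‖A j θ‖) ξ u ω *
        ‖truncated D t (relWeight (fun j θ => ‖A j θ‖) ξ u ω) (ξ u ω) -
          ∫ θ, truncated D t (relWeight (fun j θ => ‖A j θ‖) ξ u ω) θ ∂ν‖) ^ 2) ∂P := by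
    rw [← lintegral_indicator (hB.measurableSet_stays t u)]
    refine lintegral_congr fun ω => ?_
    unfold centred
    by_cases h2 : ω ∈ stays A ξ t u
    · rw [Set.indicator_of_mem h2, Set.indicator_of_mem h2, hB.isConformal_opWeight u ω,
        hB.norm_opWeight]
    · rw [Set.indicator_of_notMem h2, Set.indicator_of_notMem h2]; simp
  rw [h1, h]
  refine lintegral_mono fun ω => ?_
  dsimp only
  set a := relWeight (fun j θ => ‖A j θ‖) ξ u ω with ha
  have ha0 : 0 ≤ a := by rw [ha, ← hB.norm_opWeight]; exact norm_nonneg _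
  have h3 := lintegral_sq_sub_integral_le (ν := ν) (B := fun θ => a • truncated D t a θ) (C := t)
    (((measurable_truncated hD t).comp measurable_prodMk_left).const_smul a)
    (fun θ => by
      rw [norm_smul, Real.norm_of_nonneg ha0]
      exact mul_norm_truncated_le D ht a θ)
  rw [integral_smul] at h3
  simp_rw [← smul_sub, norm_smul, Real.norm_of_nonneg ha0] at h3
  exact h3

/-- Since `D` has mean zero, the mean of its truncation is minus the mean of the discarded part. It
therefore costs no more than the discarded part itself, whence the factor `2`. -/
theorem lintegral_remainder_le [IsProbabilityMeasure P] (hB : IsBranching P ν ξ A α) {D : Θ → E}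
    (hD : Measurable D) (hDi : Integrable D ν) (hD0 : ∫ θ, D θ ∂ν = 0) (t : ℝ) (u : List ℕ) :
    ∫⁻ ω, ENNReal.ofReal ‖remainder ν ξ A D t u ω‖ ∂P ≤
      2 * ∫⁻ ω in stays A ξ t u, ∫⁻ θ, ENNReal.ofReal
        (relWeight (fun j θ => ‖A j θ‖) ξ u ω * ‖D θ - truncated D t
          (relWeight (fun j θ => ‖A j θ‖) ξ u ω) θ‖) ∂ν ∂P := by
  have hg : Measurable fun p : ℝ × Θ => ENNReal.ofReal
      (p.1 * ‖D p.2 - truncated D t p.1 p.2 + ∫ θ, truncated D t p.1 θ ∂ν‖) := by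
    refine (measurable_fst.mul (Measurable.norm (Measurable.add (Measurable.sub
      (hD.comp measurable_snd) (measurable_truncated hD t)) ?_))).ennreal_ofReal
    exact (measurable_integral_truncated hD t).comp measurable_fst
  have h := setLIntegral_below hB.measurable hB.indep hB.map_eq hB.measurable_norm_op t u hg
  have h1 : ∫⁻ ω, ENNReal.ofReal ‖remainder ν ξ A D t u ω‖ ∂P =
      ∫⁻ ω in stays A ξ t u, ENNReal.ofReal (relWeight (fun j θ => ‖A j θ‖) ξ u ω *
        ‖D (ξ u ω) - truncated D t (relWeight (fun j θ => ‖A j θ‖) ξ u ω) (ξ u ω) +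
          ∫ θ, truncated D t (relWeight (fun j θ => ‖A j θ‖) ξ u ω) θ ∂ν‖) ∂P := by
    rw [← lintegral_indicator (hB.measurableSet_stays t u)]
    refine lintegral_congr fun ω => ?_
    unfold remainder
    by_cases h2 : ω ∈ stays A ξ t u
    · rw [Set.indicator_of_mem h2, Set.indicator_of_mem h2, hB.isConformal_opWeight u ω,
        hB.norm_opWeight]
    · rw [Set.indicator_of_notMem h2, Set.indicator_of_notMem h2]; simp
  rw [h1, h, ← lintegral_const_mul' _ _ ENNReal.ofNat_ne_top]
  refine lintegral_mono fun ω => ?_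
  dsimp only
  set a := relWeight (fun j θ => ‖A j θ‖) ξ u ω with ha
  have ha0 : 0 ≤ a := by rw [ha, ← hB.norm_opWeight]; exact norm_nonneg _
  have hti := integrable_truncated hD hDi t a
  have hm : ENNReal.ofReal ‖∫ θ, truncated D t a θ ∂ν‖ ≤
      ∫⁻ θ, ENNReal.ofReal ‖D θ - truncated D t a θ‖ ∂ν := by
    have h4 : ∫ θ, (D θ - truncated D t a θ) ∂ν = -∫ θ, truncated D t a θ ∂ν := by
      rw [integral_sub hDi hti, hD0, zero_sub]
    rw [← norm_neg, ← h4]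
    simp_rw [ofReal_norm]
    exact enorm_integral_le_lintegral_enorm _
  have hmt : Measurable fun θ => ENNReal.ofReal ‖D θ - truncated D t a θ‖ :=
    (hD.sub ((measurable_truncated hD t).comp measurable_prodMk_left)).norm.ennreal_ofReal
  simp_rw [ENNReal.ofReal_mul ha0]
  calc _ ≤ ∫⁻ θ, ENNReal.ofReal a * (ENNReal.ofReal ‖D θ - truncated D t a θ‖ +
        ENNReal.ofReal ‖∫ θ, truncated D t a θ ∂ν‖) ∂ν := by
        refine lintegral_mono fun θ => ?_
        dsimp only
        gcongr
        rw [← ENNReal.ofReal_add (norm_nonneg _) (norm_nonneg _)]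
        exact ENNReal.ofReal_le_ofReal (norm_add_le _ _)
    _ = ENNReal.ofReal a * (∫⁻ θ, ENNReal.ofReal ‖D θ - truncated D t a θ‖ ∂ν +
        ENNReal.ofReal ‖∫ θ, truncated D t a θ ∂ν‖) := by
        rw [lintegral_const_mul' _ _ ENNReal.ofReal_ne_top, lintegral_add_left hmt]
        simp
    _ ≤ ENNReal.ofReal a * (∫⁻ θ, ENNReal.ofReal ‖D θ - truncated D t a θ‖ ∂ν +
        ∫⁻ θ, ENNReal.ofReal ‖D θ - truncated D t a θ‖ ∂ν) := by gcongr
    _ = _ := by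
        rw [lintegral_const_mul' _ _ ENNReal.ofReal_ne_top]
        ring

/-- Interchange of the sum over individuals with the expectation over the innovation. -/
theorem tsum_stays_le [IsProbabilityMeasure P] (hB : IsBranching P ν ξ A α) (t : ℝ)
    {g : ℝ × Θ → ℝ≥0∞} (hg : Measurable g) {b : Θ → ℝ≥0∞}
    (h : ∀ θ, ∑' u : List ℕ, ∫⁻ ω in stays A ξ t u,
      g (relWeight (fun j θ => ‖A j θ‖) ξ u ω, θ) ∂P ≤ b θ) :
    ∑' u : List ℕ, ∫⁻ ω in stays A ξ t u,
      ∫⁻ θ, g (relWeight (fun j θ => ‖A j θ‖) ξ u ω, θ) ∂ν ∂P ≤ ∫⁻ θ, b θ ∂ν := by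
  have hm : ∀ u : List ℕ, Measurable fun p : Ω × Θ =>
      g (relWeight (fun j θ => ‖A j θ‖) ξ u p.1, p.2) := fun u =>
    hg.comp (((measurable_relWeight' hB.measurable hB.measurable_norm_op u).comp
      measurable_fst).prodMk measurable_snd)
  have h1 : ∀ u : List ℕ, ∫⁻ ω in stays A ξ t u,
      ∫⁻ θ, g (relWeight (fun j θ => ‖A j θ‖) ξ u ω, θ) ∂ν ∂P =
      ∫⁻ θ, ∫⁻ ω in stays A ξ t u, g (relWeight (fun j θ => ‖A j θ‖) ξ u ω, θ) ∂P ∂ν := fun u =>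
    lintegral_lintegral_swap (hm u).aemeasurable
  simp_rw [h1]
  rw [← lintegral_tsum fun u => ((hm u).lintegral_prod_left').aemeasurable]
  exact lintegral_mono h

/-- For a fixed mark `θ` with `D θ ≠ 0`, truncation compares the weight with `B = t / ‖D θ‖`. The
moment bounds with `q = 2` and `q = 1`, on either side of `α`, give `‖D θ‖ ^ q * B ^ (q - α) = t ^
(q - α) * ‖D θ‖ ^ α`, so that an `α`-th moment of `D` is all that enters. -/
theorem exists_innovation_bounds [IsProbabilityMeasure P] (hB : IsBranching P ν ξ A α)
    (hα1 : 1 < α) (hα2 : α < 2) {D : Θ → E} (hD : Measurable D) :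
    ∃ C : ℝ≥0∞, C ≠ ∞ ∧ ∀ t : ℝ, 1 ≤ t →
      ∑' u : List ℕ, ∫⁻ ω in stays A ξ t u, ∫⁻ θ, ENNReal.ofReal
        ((relWeight (fun j θ => ‖A j θ‖) ξ u ω * ‖truncated D t
          (relWeight (fun j θ => ‖A j θ‖) ξ u ω) θ‖) ^ 2) ∂ν ∂P ≤
        C * ENNReal.ofReal ((1 + Real.log t) * t ^ (2 - α)) *
          ∫⁻ θ, ENNReal.ofReal (‖D θ‖ ^ α) ∂ν ∧
      ∑' u : List ℕ, ∫⁻ ω in stays A ξ t u, ∫⁻ θ, ENNReal.ofReal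
        (relWeight (fun j θ => ‖A j θ‖) ξ u ω * ‖D θ - truncated D t
          (relWeight (fun j θ => ‖A j θ‖) ξ u ω) θ‖) ∂ν ∂P ≤
        C * ENNReal.ofReal ((1 + Real.log t) * t ^ (1 - α)) *
          ∫⁻ θ, ENNReal.ofReal (‖D θ‖ ^ α) ∂ν := by
  have hα0 : 0 < α := by linarith
  have hx0 : ∀ (j : ℕ) (θ : Θ), 0 ≤ ‖A j θ‖ := fun _ _ => norm_nonneg _
  obtain ⟨C₂, hC₂, h₂⟩ := exists_moment_bound hB.measurable hB.indep hB.map_eq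
    hB.measurable_norm_op hx0 hα0 hB.moment hB.supercritical (q := 2) (by norm_num)
  obtain ⟨C₁, hC₁, h₁⟩ := exists_moment_bound hB.measurable hB.indep hB.map_eq
    hB.measurable_norm_op hx0 hα0 hB.moment hB.supercritical (q := 1) (by norm_num)
  have hDα : Measurable fun θ => ENNReal.ofReal (‖D θ‖ ^ α) :=
    (hD.norm.pow_const α).ennreal_ofReal
  refine ⟨max C₁ C₂, (max_lt hC₁.lt_top hC₂.lt_top).ne, fun t ht => ⟨?_, ?_⟩⟩
  · have hlog : 0 ≤ 1 + Real.log t := by linarith [Real.log_nonneg ht]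
    have ht0 : 0 < t := by linarith
    rw [← lintegral_const_mul _ hDα]
    refine hB.tsum_stays_le t (g := fun p => ENNReal.ofReal ((p.1 * ‖truncated D t p.1 p.2‖) ^ 2))
      ((measurable_fst.mul (measurable_truncated hD t).norm).pow_const 2).ennreal_ofReal
      fun θ => ?_
    by_cases h0 : D θ = 0
    · have : ∀ a : ℝ, truncated D t a θ = 0 := fun a => by
        simpa [h0] using norm_truncated_le D t a θ
      simp [this]
    have hr : 0 < ‖D θ‖ := norm_pos_iff.2 h0
    have hb := (h₂ t ht (t / ‖D θ‖) (by positivity)).1 hα2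
    have heq : ∀ a : ℝ, ENNReal.ofReal ((a * ‖truncated D t a θ‖) ^ 2) =
        ENNReal.ofReal (‖D θ‖ ^ (2 : ℝ)) * (Set.Iic (t / ‖D θ‖)).indicator
          (fun a => ENNReal.ofReal (a ^ (2 : ℝ))) a := by
      intro a
      unfold truncated
      by_cases h : a ∈ Set.Iic (t / ‖D θ‖)
      · rw [Set.indicator_of_mem h, Set.indicator_of_mem (show θ ∈ {θ | a * ‖D θ‖ ≤ t} from
          (le_div_iff₀ hr).1 h), ← ENNReal.ofReal_mul (by positivity), Real.rpow_two,
          Real.rpow_two, mul_pow, mul_comm]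
      · rw [Set.indicator_of_notMem h, Set.indicator_of_notMem (show θ ∉ {θ | a * ‖D θ‖ ≤ t} from
          fun h' => h ((le_div_iff₀ hr).2 h'))]
        simp
    simp only [heq]
    simp_rw [lintegral_const_mul' _ _ ENNReal.ofReal_ne_top]
    rw [ENNReal.tsum_mul_left]
    calc _ ≤ ENNReal.ofReal (‖D θ‖ ^ (2 : ℝ)) * (C₂ * ENNReal.ofReal (1 + Real.log t) *
          ENNReal.ofReal ((t / ‖D θ‖) ^ (2 - α))) := by gcongr
      _ = C₂ * ENNReal.ofReal ((1 + Real.log t) * t ^ (2 - α)) * ENNReal.ofReal (‖D θ‖ ^ α) := by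
          have e : ‖D θ‖ ^ (2 : ℝ) * (t / ‖D θ‖) ^ (2 - α) = t ^ (2 - α) * ‖D θ‖ ^ α := by
            rw [Real.div_rpow ht0.le hr.le, Real.rpow_sub hr]
            have := (Real.rpow_pos_of_pos hr 2).ne'
            have := (Real.rpow_pos_of_pos hr α).ne'
            field_simp
          calc _ = C₂ * (ENNReal.ofReal (1 + Real.log t) * (ENNReal.ofReal (‖D θ‖ ^ (2 : ℝ)) *
                ENNReal.ofReal ((t / ‖D θ‖) ^ (2 - α)))) := by ring
            _ = _ := by
              rw [← ENNReal.ofReal_mul (by positivity), e, ENNReal.ofReal_mul (by positivity),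
                ENNReal.ofReal_mul hlog]
              ring
      _ ≤ _ := by gcongr; exact le_max_right _ _
  · have hlog : 0 ≤ 1 + Real.log t := by linarith [Real.log_nonneg ht]
    have ht0 : 0 < t := by linarith
    rw [← lintegral_const_mul _ hDα]
    refine hB.tsum_stays_le t (g := fun p => ENNReal.ofReal (p.1 * ‖D p.2 - truncated D t p.1 p.2‖))
      (measurable_fst.mul (Measurable.norm (Measurable.sub (hD.comp measurable_snd)
        (measurable_truncated hD t)))).ennreal_ofReal
      fun θ => ?_
    by_cases h0 : D θ = 0
    · have : ∀ a : ℝ, truncated D t a θ = 0 := fun a => by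
        simpa [h0] using norm_truncated_le D t a θ
      simp [this, h0]
    have hr : 0 < ‖D θ‖ := norm_pos_iff.2 h0
    have hb := (h₁ t ht (t / ‖D θ‖) (by positivity)).2 hα1
    have heq : ∀ a : ℝ, ENNReal.ofReal (a * ‖D θ - truncated D t a θ‖) =
        ENNReal.ofReal ‖D θ‖ * (Set.Ioi (t / ‖D θ‖)).indicator
          (fun a => ENNReal.ofReal (a ^ (1 : ℝ))) a := by
      intro a
      unfold truncated
      by_cases h : a ∈ Set.Ioi (t / ‖D θ‖)
      · have h' : ¬ a * ‖D θ‖ ≤ t := not_le.2 ((div_lt_iff₀ hr).1 h)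
        rw [Set.indicator_of_mem h, Set.indicator_of_notMem (show θ ∉ {θ | a * ‖D θ‖ ≤ t} from h'),
          ← ENNReal.ofReal_mul (by positivity), Real.rpow_one, sub_zero, mul_comm]
      · have h' : a * ‖D θ‖ ≤ t := not_lt.1 fun h'' => h ((div_lt_iff₀ hr).2 h'')
        rw [Set.indicator_of_notMem h, Set.indicator_of_mem (show θ ∈ {θ | a * ‖D θ‖ ≤ t} from h')]
        simp
    simp only [heq]
    simp_rw [lintegral_const_mul' _ _ ENNReal.ofReal_ne_top]
    rw [ENNReal.tsum_mul_left]
    calc _ ≤ ENNReal.ofReal ‖D θ‖ * (C₁ * ENNReal.ofReal (1 + Real.log t) *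
          ENNReal.ofReal ((t / ‖D θ‖) ^ (1 - α))) := by gcongr
      _ = C₁ * ENNReal.ofReal ((1 + Real.log t) * t ^ (1 - α)) * ENNReal.ofReal (‖D θ‖ ^ α) := by
          have e : ‖D θ‖ * (t / ‖D θ‖) ^ (1 - α) = t ^ (1 - α) * ‖D θ‖ ^ α := by
            rw [Real.div_rpow ht0.le hr.le, Real.rpow_sub hr, Real.rpow_one]
            have := (Real.rpow_pos_of_pos hr α).ne'
            field_simp
          calc _ = C₁ * (ENNReal.ofReal (1 + Real.log t) * (ENNReal.ofReal ‖D θ‖ *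
                ENNReal.ofReal ((t / ‖D θ‖) ^ (1 - α)))) := by ring
            _ = _ := by
              rw [← ENNReal.ofReal_mul (by positivity), e, ENNReal.ofReal_mul (by positivity),
                ENNReal.ofReal_mul hlog]
              ring
      _ ≤ _ := by gcongr; exact le_max_left _ _

/-- The tail of finite sums of innovations along lines that stay below `t`. -/
theorem exists_tail_finset [IsProbabilityMeasure P] (hB : IsBranching P ν ξ A α)
    (hα1 : 1 < α) (hα2 : α < 2) {D : Θ → E} (hD : Measurable D) (hDi : Integrable D ν)
    (hD0 : ∫ θ, D θ ∂ν = 0) (hDα : ∫⁻ θ, ENNReal.ofReal (‖D θ‖ ^ α) ∂ν ≠ ∞) :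
    ∃ C : ℝ≥0∞, C ≠ ∞ ∧ ∀ t : ℝ, 1 ≤ t → ∀ s : Finset (List ℕ),
      P {ω | 2 * t < ‖∑ u ∈ s, (stays A ξ t u).indicator
        (fun ω => opWeight A ξ u ω (D (ξ u ω))) ω‖} ≤
      C * ENNReal.ofReal ((1 + Real.log t) * t ^ (-α)) := by
  obtain ⟨C, hC, h⟩ := hB.exists_innovation_bounds hα1 hα2 hD
  set M := ∫⁻ θ, ENNReal.ofReal (‖D θ‖ ^ α) ∂ν with hM
  -- Chebyshev's inequality for the centred part contributes `C * M`, and Markov's inequality for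
  -- the remainder contributes `2 * C * M`.
  refine ⟨3 * C * M, by finiteness, fun t ht s => ?_⟩
  obtain ⟨h2, h1⟩ := h t ht
  have ht0 : 0 < t := by linarith
  have hlog : 0 ≤ 1 + Real.log t := by linarith [Real.log_nonneg ht]
  have hmY : Measurable fun ω => ∑ u ∈ s, centred ν ξ A D t u ω :=
    Finset.measurable_fun_sum _ fun u _ => hB.measurable_centred hD t u
  have hmR : ∀ u, Measurable fun ω => ENNReal.ofReal ‖remainder ν ξ A D t u ω‖ := fun u =>
    (hB.measurable_remainder hD t u).norm.ennreal_ofReal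
  have hY : P {ω | ENNReal.ofReal (t ^ 2) ≤
      ENNReal.ofReal (‖∑ u ∈ s, centred ν ξ A D t u ω‖ ^ 2)} ≤
      C * M * ENNReal.ofReal ((1 + Real.log t) * t ^ (-α)) := by
    refine (meas_ge_le_lintegral_div (hmY.norm.pow_const 2).ennreal_ofReal.aemeasurable
      (by simp; positivity) ENNReal.ofReal_ne_top).trans ?_
    rw [lintegral_sq_sum_of_orthogonal (hB.measurable_centred hD t)
      (hB.norm_centred_le D ht0.le) (fun i j hij => hB.integral_inner_centred_eq_zero hD hDi
        ht0.le hij.symm)]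
    calc _ ≤ (C * ENNReal.ofReal ((1 + Real.log t) * t ^ (2 - α)) * M) /
          ENNReal.ofReal (t ^ 2) := by
          gcongr
          refine le_trans ?_ h2
          refine le_trans (Finset.sum_le_sum fun u _ => hB.lintegral_sq_centred_le hD ht0.le u) ?_
          exact ENNReal.sum_le_tsum s
      _ = _ := by
          have e : (1 + Real.log t) * t ^ (-α) = (1 + Real.log t) * t ^ (2 - α) / t ^ 2 := by
            rw [sub_eq_add_neg, Real.rpow_add ht0, Real.rpow_two]
            field_simp
          rw [e, ENNReal.ofReal_div_of_pos (by positivity), ENNReal.div_eq_inv_mul,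
            ENNReal.div_eq_inv_mul]
          ring
  have hR : P {ω | ENNReal.ofReal t ≤ ∑ u ∈ s, ENNReal.ofReal ‖remainder ν ξ A D t u ω‖} ≤
      2 * C * M * ENNReal.ofReal ((1 + Real.log t) * t ^ (-α)) := by
    refine (meas_ge_le_lintegral_div (Finset.measurable_fun_sum _ fun u _ => hmR u).aemeasurable
      (by simp; positivity) ENNReal.ofReal_ne_top).trans ?_
    rw [lintegral_finsetSum _ fun u _ => hmR u]
    calc _ ≤ (2 * (C * ENNReal.ofReal ((1 + Real.log t) * t ^ (1 - α)) * M)) /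
          ENNReal.ofReal t := by
          gcongr
          refine le_trans ?_ (mul_le_mul_right h1 2)
          refine le_trans (Finset.sum_le_sum fun u _ =>
            hB.lintegral_remainder_le hD hDi hD0 t u) ?_
          rw [← Finset.mul_sum]
          gcongr
          exact ENNReal.sum_le_tsum s
      _ = _ := by
          have e : (1 + Real.log t) * t ^ (-α) = (1 + Real.log t) * t ^ (1 - α) / t := by
            rw [sub_eq_add_neg, Real.rpow_add ht0, Real.rpow_one]
            field_simp
          rw [e, ENNReal.ofReal_div_of_pos ht0, ENNReal.div_eq_inv_mul,
            ENNReal.div_eq_inv_mul]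
          ring
  calc _ ≤ P ({ω | ENNReal.ofReal (t ^ 2) ≤
        ENNReal.ofReal (‖∑ u ∈ s, centred ν ξ A D t u ω‖ ^ 2)} ∪
        {ω | ENNReal.ofReal t ≤ ∑ u ∈ s, ENNReal.ofReal ‖remainder ν ξ A D t u ω‖}) := by
        -- A sum of norm above `2 * t` cannot have both its centred part and its remainder below
        -- `t`.
        refine measure_mono fun ω hω => ?_
        by_contra hcon
        simp only [Set.mem_union, Set.mem_ofPred_eq, not_or, not_le] at hcon hω
        obtain ⟨ha, hb⟩ := hcon
        have ha' : ‖∑ u ∈ s, centred ν ξ A D t u ω‖ < t :=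
          lt_of_pow_lt_pow_left₀ 2 ht0.le ((ENNReal.ofReal_lt_ofReal_iff (by positivity)).1 ha)
        rw [← ENNReal.ofReal_sum_of_nonneg fun _ _ => norm_nonneg _,
          ENNReal.ofReal_lt_ofReal_iff ht0] at hb
        have hb' := (norm_sum_le s fun u => remainder ν ξ A D t u ω).trans_lt hb
        refine absurd hω (not_lt.2 ?_)
        simp_rw [← centred_add_remainder (ν := ν) D t, Finset.sum_add_distrib]
        refine (norm_add_le _ _).trans ?_
        linarith
    _ ≤ _ := measure_union_le _ _
    _ ≤ C * M * ENNReal.ofReal ((1 + Real.log t) * t ^ (-α)) +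
        2 * C * M * ENNReal.ofReal ((1 + Real.log t) * t ^ (-α)) := add_le_add hY hR
    _ = _ := by ring

end IsBranching

end Tail

/-! ### Generation sums as sums of innovations -/

section GenerationSums

variable {Ω Θ E : Type*} [NormedAddCommGroup E] [InnerProductSpace ℝ E] [FiniteDimensional ℝ E]
  [Nontrivial E] [MeasurableSpace E] [BorelSpace E] [MeasurableSpace Ω] [MeasurableSpace Θ]
  {P : Measure Ω} {ν : Measure Θ} {ξ : List ℕ → Ω → Θ} {A : ℕ → Θ → E →L[ℝ] E} {α : ℝ}

/-- The sum over the individuals of generation `n` of their weights applied to `w`. -/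
noncomputable def process (A : ℕ → Θ → E →L[ℝ] E) (ξ : List ℕ → Ω → Θ) (w : E) (n : ℕ) (ω : Ω) :
    E := ∑' u : Word n, opWeight A ξ u ω w

/-- The innovation produced by the offspring of one individual. -/
noncomputable def innovation (A : ℕ → Θ → E →L[ℝ] E) (w : E) (θ : Θ) : E :=
  ∑' j, A j θ w - w

theorem process_zero (w : E) (ω : Ω) : process A ξ w 0 ω = w := by
  rw [process, tsum_word_zero fun u => opWeight A ξ u ω w]
  simp [opWeight]

theorem summable_of_tsum_ofReal_norm_ne_top {ι F : Type*} [NormedAddCommGroup F] {f : ι → F}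
    (h : ∑' i, ENNReal.ofReal ‖f i‖ ≠ ∞) : Summable fun i => ‖f i‖ := by
  have := ENNReal.summable_toReal h
  simpa [ENNReal.toReal_ofReal] using this

namespace IsBranching

theorem measurable_innovation (hB : IsBranching P ν ξ A α) (w : E) :
    Measurable (innovation A w) :=
  (Measurable.tsum fun j => (hB.measurable_op j).apply_continuousLinearMap w).sub_const w

theorem lintegral_opWeight [IsProbabilityMeasure P] (hB : IsBranching P ν ξ A α) (u : List ℕ)
    {g : (E →L[ℝ] E) × Θ → ℝ≥0∞} (hg : Measurable g) :
    ∫⁻ ω, g (opWeight A ξ u ω, ξ u ω) ∂P = ∫⁻ ω, ∫⁻ θ, g (opWeight A ξ u ω, θ) ∂ν ∂P := by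
  have h := lintegral_of_sigmaOf (P := P) hB.measurable hB.indep
    (by simp : Disjoint ({u}ᶜ : Set (List ℕ)) {u})
    (hB.measurable_opWeight_sigmaOf u (sigmaOf_compl_singleton_length u))
    (measurable_sigmaOf rfl : Measurable[sigmaOf ξ {u}] (ξ u)) hg
  rwa [hB.map_eq] at h

/-- Norms of conformal operators multiply and the mark of `u` is independent of its weight, so each
generation contributes one factor. -/
theorem tsum_lintegral_opWeight [IsProbabilityMeasure P] (hB : IsBranching P ν ξ A α) (n : ℕ) :
    ∑' u : Word n, ∫⁻ ω, ENNReal.ofReal ‖opWeight A ξ u ω‖ ∂P =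
      (∫⁻ θ, ∑' j, ENNReal.ofReal ‖A j θ‖ ∂ν) ^ n := by
  induction n with
  | zero =>
    rw [tsum_word_zero fun u => ∫⁻ ω, ENNReal.ofReal ‖opWeight A ξ u ω‖ ∂P]
    simp [opWeight]
  | succ n ih =>
    rw [tsum_word_succ n fun u => ∫⁻ ω, ENNReal.ofReal ‖opWeight A ξ u ω‖ ∂P, pow_succ, ← ih,
      ← ENNReal.tsum_mul_right]
    refine tsum_congr fun u => ?_
    have hm : ∀ j, Measurable fun θ => ENNReal.ofReal ‖A j θ‖ := fun j =>
      (hB.measurable_norm_op j).ennreal_ofReal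
    have h1 : ∀ j, ∫⁻ ω, ENNReal.ofReal ‖opWeight A ξ (j :: u.1) ω‖ ∂P =
        (∫⁻ ω, ENNReal.ofReal ‖opWeight A ξ u ω‖ ∂P) * ∫⁻ θ, ENNReal.ofReal ‖A j θ‖ ∂ν := by
      intro j
      have hg : Measurable fun p : (E →L[ℝ] E) × Θ =>
          ENNReal.ofReal ‖p.1‖ * ENNReal.ofReal ‖A j p.2‖ :=
        (measurable_norm.comp measurable_fst).ennreal_ofReal.mul ((hm j).comp measurable_snd)
      have h2 := hB.lintegral_opWeight u.1 hg
      simp_rw [lintegral_const_mul _ (hm j)] at h2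
      rw [lintegral_mul_const _ (hB.measurable_opWeight u.1).norm.ennreal_ofReal] at h2
      rw [← h2]
      refine lintegral_congr fun ω => ?_
      rw [← ENNReal.ofReal_mul (norm_nonneg _), opWeight,
        (hB.isConformal_opWeight u ω).norm_mul (hB.conformal _ _)]
    simp_rw [h1]
    rw [ENNReal.tsum_mul_left, lintegral_tsum fun j => (hm j).aemeasurable]

theorem ae_summable [IsProbabilityMeasure P] (hB : IsBranching P ν ξ A α)
    (hm : ∫⁻ θ, ∑' j, ENNReal.ofReal ‖A j θ‖ ∂ν ≠ ∞) (n : ℕ) :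
    ∀ᵐ ω ∂P, Summable fun u : Word n => ‖opWeight A ξ u ω‖ := by
  have hmeas : ∀ u : Word n, Measurable fun ω => ENNReal.ofReal ‖opWeight A ξ u ω‖ := fun u =>
    (hB.measurable_opWeight u).norm.ennreal_ofReal
  have h := hB.tsum_lintegral_opWeight n
  rw [← lintegral_tsum fun u => (hmeas u).aemeasurable] at h
  filter_upwards [ae_lt_top (Measurable.tsum hmeas) (h ▸ ENNReal.pow_ne_top hm)] with ω hω
  exact summable_of_tsum_ofReal_norm_ne_top hω.ne

theorem lintegral_process_le [IsProbabilityMeasure P] (hB : IsBranching P ν ξ A α) (w : E)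
    (n : ℕ) : ∫⁻ ω, ‖process A ξ w n ω‖ₑ ∂P ≤
      (∫⁻ θ, ∑' j, ENNReal.ofReal ‖A j θ‖ ∂ν) ^ n * ‖w‖ₑ := by
  have hmeas : ∀ u : Word n, Measurable fun ω => ENNReal.ofReal ‖opWeight A ξ u ω‖ := fun u =>
    (hB.measurable_opWeight u).norm.ennreal_ofReal
  rw [← hB.tsum_lintegral_opWeight n, ← lintegral_tsum fun u => (hmeas u).aemeasurable,
    ← lintegral_mul_const _ (Measurable.tsum hmeas)]
  refine lintegral_mono fun ω => ?_
  dsimp only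
  rw [← ENNReal.tsum_mul_right]
  refine enorm_tsum_le_tsum_enorm.trans (ENNReal.tsum_le_tsum fun u => ?_)
  rw [ofReal_norm]
  exact ContinuousLinearMap.le_opENorm _ _

theorem measurable_process_sigmaOf (hB : IsBranching P ν ξ A α) (w : E) {n m : ℕ} (h : n ≤ m) :
    Measurable[sigmaOf ξ {u | u.length < m}] (process A ξ w n) := by
  refine @Measurable.tsum Ω E (Word n) (sigmaOf ξ {u | u.length < m}) _ _ _ _ _ _ _ _ _ _ _ _
    fun u => ?_
  refine measurable_clm_apply
    (hB.measurable_opWeight_sigmaOf u.1 fun v hv => ?_) measurable_const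
  rw [u.2] at hv
  exact lt_of_lt_of_le hv h

theorem measurable_process (hB : IsBranching P ν ξ A α) (w : E) (n : ℕ) :
    Measurable (process A ξ w n) :=
  (hB.measurable_process_sigmaOf w le_rfl).mono (sigmaOf_le hB.measurable _) le_rfl

theorem integrable_process [IsProbabilityMeasure P] (hB : IsBranching P ν ξ A α)
    (hm : ∫⁻ θ, ∑' j, ENNReal.ofReal ‖A j θ‖ ∂ν ≠ ∞) (w : E) (n : ℕ) :
    Integrable (process A ξ w n) P :=
  ⟨(hB.measurable_process w n).aestronglyMeasurable,
    (hB.lintegral_process_le w n).trans_lt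
      (ENNReal.mul_lt_top (ENNReal.pow_ne_top hm).lt_top enorm_lt_top)⟩

theorem lintegral_opWeight_innovation [IsProbabilityMeasure P] (hB : IsBranching P ν ξ A α)
    (w : E) (n : ℕ) :
    ∑' u : Word n, ∫⁻ ω, ENNReal.ofReal ‖opWeight A ξ u ω (innovation A w (ξ u ω))‖ ∂P =
      (∫⁻ θ, ∑' j, ENNReal.ofReal ‖A j θ‖ ∂ν) ^ n *
        ∫⁻ θ, ENNReal.ofReal ‖innovation A w θ‖ ∂ν := by
  rw [← hB.tsum_lintegral_opWeight n, ← ENNReal.tsum_mul_right]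
  refine tsum_congr fun u => ?_
  have hD : Measurable fun θ => ENNReal.ofReal ‖innovation A w θ‖ :=
    (hB.measurable_innovation w).norm.ennreal_ofReal
  have hg : Measurable fun p : (E →L[ℝ] E) × Θ =>
      ENNReal.ofReal ‖p.1‖ * ENNReal.ofReal ‖innovation A w p.2‖ :=
    (measurable_norm.comp measurable_fst).ennreal_ofReal.mul (hD.comp measurable_snd)
  have h2 := hB.lintegral_opWeight u.1 hg
  simp_rw [lintegral_const_mul _ hD] at h2
  rw [lintegral_mul_const _ (hB.measurable_opWeight u.1).norm.ennreal_ofReal] at h2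
  rw [← h2]
  refine lintegral_congr fun ω => ?_
  rw [← ENNReal.ofReal_mul (norm_nonneg _), hB.isConformal_opWeight u ω]

theorem measurable_opWeight_innovation (hB : IsBranching P ν ξ A α) (w : E) (u : List ℕ) :
    Measurable fun ω => opWeight A ξ u ω (innovation A w (ξ u ω)) :=
  measurable_clm_apply (hB.measurable_opWeight u)
    ((hB.measurable_innovation w).comp (hB.measurable u))

/-- Absolute summability allows generation `n + 1` to be grouped by parents. The children of `u`
contribute `L(u)` applied to the sum of `A j (ξ u) w`, and subtracting `L(u) w` leaves the
innovation. -/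
theorem ae_hasSum_innovation [IsProbabilityMeasure P] (hB : IsBranching P ν ξ A α)
    (hm : ∫⁻ θ, ∑' j, ENNReal.ofReal ‖A j θ‖ ∂ν ≠ ∞) (w : E) :
    ∀ᵐ ω ∂P, ∀ n, HasSum (fun u : Word n => opWeight A ξ u ω (innovation A w (ξ u ω)))
      (process A ξ w (n + 1) ω - process A ξ w n ω) := by
  have hmm : Measurable fun θ => ∑' j, ENNReal.ofReal ‖A j θ‖ :=
    Measurable.tsum fun j => (hB.measurable_norm_op j).ennreal_ofReal
  have h1 : ∀ᵐ ω ∂P, ∀ u, Summable fun j => ‖A j (ξ u ω)‖ := by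
    rw [ae_all_iff]
    intro u
    have h2 := ae_lt_top hmm hm
    rw [← hB.map_eq u] at h2
    filter_upwards [ae_of_ae_map (hB.measurable u).aemeasurable h2] with ω hω
    exact summable_of_tsum_ofReal_norm_ne_top hω.ne
  filter_upwards [ae_all_iff.2 fun n => hB.ae_summable hm n, h1] with ω hs hA n
  have hsum : ∀ k, Summable fun u : Word k => opWeight A ξ u ω w := by
    intro k
    refine Summable.of_norm_bounded ((hs k).mul_right ‖w‖) fun u => ?_
    exact ContinuousLinearMap.le_opNorm _ _
  have hprod : Summable fun p : Word n × ℕ => opWeight A ξ (p.2 :: p.1.1) ω w :=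
    (wordSuccEquiv n).summable_iff.2 (hsum (n + 1))
  have hfib : ∀ u : Word n, HasSum (fun j => opWeight A ξ (j :: u.1) ω w)
      (opWeight A ξ u ω (∑' j, A j (ξ u ω) w)) := by
    intro u
    have h3 : Summable fun j => A j (ξ u ω) w := by
      refine Summable.of_norm_bounded ((hA u).mul_right ‖w‖) fun j => ?_
      exact ContinuousLinearMap.le_opNorm _ _
    exact (opWeight A ξ u ω).hasSum h3.hasSum
  have h4 : HasSum (fun p : Word n × ℕ => opWeight A ξ (p.2 :: p.1.1) ω w)
      (process A ξ w (n + 1) ω) := by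
    have := (wordSuccEquiv n).tsum_eq fun v : Word (n + 1) => opWeight A ξ v ω w
    rw [process, ← this]
    exact hprod.hasSum
  have h5 := (h4.prod_fiberwise hfib).sub (hsum n).hasSum
  simp_rw [← map_sub] at h5
  exact h5

theorem ae_hasSum_process_sub [IsProbabilityMeasure P] (hB : IsBranching P ν ξ A α)
    (hm : ∫⁻ θ, ∑' j, ENNReal.ofReal ‖A j θ‖ ∂ν ≠ ∞) (w : E) :
    ∀ᵐ ω ∂P, ∀ n, HasSum ({u : List ℕ | u.length < n}.indicator
      fun u => opWeight A ξ u ω (innovation A w (ξ u ω))) (process A ξ w n ω - w) := by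
  filter_upwards [hB.ae_hasSum_innovation hm w] with ω h n
  induction n with
  | zero => simp [process_zero, hasSum_zero]
  | succ n ih =>
    have h1 : HasSum ({u : List ℕ | u.length = n}.indicator
        fun u => opWeight A ξ u ω (innovation A w (ξ u ω)))
        (process A ξ w (n + 1) ω - process A ξ w n ω) :=
      hasSum_subtype_iff_indicator.1 (h n)
    have h2 := ih.add h1
    convert h2 using 1
    · funext u
      simp only [Set.indicator_apply, Set.mem_ofPred_eq]
      rcases lt_trichotomy u.length n with h3 | h3 | h3
      · rw [if_pos (by omega), if_pos h3, if_neg (by omega), add_zero]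
      · rw [if_pos (by omega), if_neg (by omega), if_pos h3, zero_add]
      · rw [if_neg (by omega), if_neg (by omega), if_neg (by omega), add_zero]
    · abel

/-- A tail bound for the fluctuations that is uniform in the generation. -/
theorem exists_tail_process [IsProbabilityMeasure P] [IsProbabilityMeasure ν]
    (hB : IsBranching P ν ξ A α) (hα1 : 1 < α) (hα2 : α < 2)
    (hm : ∫⁻ θ, ∑' j, ENNReal.ofReal ‖A j θ‖ ∂ν ≠ ∞) {w : E}
    (hDi : Integrable (innovation A w) ν) (hD0 : ∫ θ, innovation A w θ ∂ν = 0)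
    (hDα : ∫⁻ θ, ENNReal.ofReal (‖innovation A w θ‖ ^ α) ∂ν ≠ ∞) :
    ∃ C : ℝ≥0∞, C ≠ ∞ ∧ ∀ t : ℝ, 1 ≤ t → ∀ n,
      P {ω | 2 * t < ‖process A ξ w n ω - w‖} ≤
        C * ENNReal.ofReal ((1 + Real.log t) * t ^ (-α)) := by
  obtain ⟨C, hC, h⟩ := hB.exists_tail_finset hα1 hα2 (hB.measurable_innovation w) hDi hD0 hDα
  -- The `1` pays for the event that some line is cut, the `C` for sums along uncut lines.
  refine ⟨1 + C, by finiteness, fun t ht n => ?_⟩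
  have ht0 : 0 < t := by linarith
  have hlog : 0 ≤ Real.log t := Real.log_nonneg ht
  have hbad := measure_not_below_le (P := P) (ξ := ξ) hB.measurable hB.indep hB.map_eq
    hB.measurable_norm_op (fun _ _ => norm_nonneg _) (by linarith) hB.moment ht
  -- A fixed enumeration of the words turns the unordered sum into a limit of finite partial sums,
  -- to which the bound for finite sets applies.
  let e : ℕ ≃ List ℕ := (Denumerable.eqv (List ℕ)).symm
  let s : ℕ → Finset (List ℕ) := fun m =>
    ((Finset.range m).map e.toEmbedding).filter fun u => u.length < n
  set f : List ℕ → Ω → E := fun u => (stays A ξ t u).indicator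
    (fun ω => opWeight A ξ u ω (innovation A w (ξ u ω))) with hf
  -- A limit of norm above `2 * t` has all its late partial sums above `2 * t`. The events `B M`
  -- increase to this, and each lies in the event for the single index `M`, so their union obeys the
  -- same bound.
  set B : ℕ → Set Ω := fun M => ⋂ m ∈ Set.Ici M, {ω | 2 * t < ‖∑ u ∈ s m, f u ω‖} with hBdef
  have hBmono : Monotone B := by
    intro M M' hM ω hω
    simp only [hBdef, Set.mem_iInter] at hω ⊢
    exact fun m hm' => hω m (le_trans hM hm')
  have hBle : P (⋃ M, B M) ≤ C * ENNReal.ofReal ((1 + Real.log t) * t ^ (-α)) := by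
    rw [hBmono.measure_iUnion]
    refine iSup_le fun M => le_trans (measure_mono ?_) (h t ht (s M))
    exact Set.biInter_subset_of_mem (Set.mem_Ici.2 le_rfl)
  have hsub : ∀ᵐ ω ∂P, ω ∈ {ω | 2 * t < ‖process A ξ w n ω - w‖} →
      ω ∈ {ω | ∃ u, ω ∉ below (fun j θ => ‖A j θ‖) ξ t u} ∪ ⋃ M, B M := by
    filter_upwards [hB.ae_hasSum_process_sub hm w] with ω hω hlarge
    by_cases hgood : ∃ u, ω ∉ below (fun j θ => ‖A j θ‖) ξ t u
    · exact Or.inl hgood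
    right
    push Not at hgood
    have h1 := (e.hasSum_iff.2 (hω n)).tendsto_sum_nat
    have h2 : ∀ m, ∑ i ∈ Finset.range m, (({u : List ℕ | u.length < n}.indicator
        fun u => opWeight A ξ u ω (innovation A w (ξ u ω))) ∘ e) i = ∑ u ∈ s m, f u ω := by
      intro m
      simp only [s]
      rw [Finset.sum_filter, Finset.sum_map]
      refine Finset.sum_congr rfl fun i _ => ?_
      simp only [Function.comp, Set.indicator_apply, Set.mem_ofPred_eq, hf, Equiv.coe_toEmbedding]
      -- No line is cut at this `ω`, so restricting to uncut lines changes nothing.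
      rw [Set.indicator_of_mem (show ω ∈ stays A ξ t (e i) from hgood (e i))]
    simp_rw [h2] at h1
    have h3 : ∀ᶠ m in atTop, 2 * t < ‖∑ u ∈ s m, f u ω‖ :=
      h1.norm.eventually (lt_mem_nhds hlarge)
    obtain ⟨M, hM⟩ := eventually_atTop.1 h3
    refine Set.mem_iUnion.2 ⟨M, ?_⟩
    simp only [hBdef, Set.mem_iInter]
    exact fun m hm' => hM m hm'
  calc _ ≤ P ({ω | ∃ u, ω ∉ below (fun j θ => ‖A j θ‖) ξ t u} ∪ ⋃ M, B M) := measure_mono_ae hsub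
    _ ≤ _ := measure_union_le _ _
    _ ≤ ENNReal.ofReal ((1 + Real.log t) * t ^ (-α)) +
        C * ENNReal.ofReal ((1 + Real.log t) * t ^ (-α)) := by
        refine add_le_add (hbad.trans (ENNReal.ofReal_le_ofReal ?_)) hBle
        exact le_mul_of_one_le_left (Real.rpow_nonneg ht0.le _) (by linarith)
    _ = _ := by ring

end IsBranching

end GenerationSums

/-! ### From tail bounds to moments and uniform integrability -/

section Integrability

/-- A polynomial tail bound of order `q > p` controls the `p`-th moment. -/
theorem exists_moment_le_of_tail {p q T : ℝ} (hp : 0 < p) (hpq : p < q) (hT : 0 < T)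
    {C : ℝ≥0∞} (hC : C ≠ ∞) :
    ∃ K : ℝ≥0∞, K ≠ ∞ ∧ ∀ {Ω : Type*} [MeasurableSpace Ω] (P : Measure Ω)
      [IsProbabilityMeasure P] (f : Ω → ℝ), Measurable f → (∀ ω, 0 ≤ f ω) →
      (∀ t, T ≤ t → P {ω | t < f ω} ≤ C * ENNReal.ofReal (t ^ (-q))) →
      ∫⁻ ω, ENNReal.ofReal (f ω ^ p) ∂P ≤ K := by
  -- In the layer-cake formula the tail is bounded by `1` up to `T` and by the hypothesis beyond.
  -- The integrals converge at `0` because `p > 0` and at infinity because `p < q`.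
  refine ⟨ENNReal.ofReal p * ((∫⁻ t in Set.Ioc 0 T, ENNReal.ofReal (t ^ (p - 1))) +
    C * ∫⁻ t in Set.Ioi T, ENNReal.ofReal (t ^ (p - 1 - q))), ?_, ?_⟩
  · have h1 : IntegrableOn (fun t : ℝ => t ^ (p - 1)) (Set.Ioc 0 T) :=
      (intervalIntegrable_iff_integrableOn_Ioc_of_le hT.le).1
        (intervalIntegral.intervalIntegrable_rpow' (by linarith))
    have h2 : IntegrableOn (fun t : ℝ => t ^ (p - 1 - q)) (Set.Ioi T) :=
      integrableOn_Ioi_rpow_of_lt (by linarith) hT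
    exact ENNReal.mul_ne_top ENNReal.ofReal_ne_top (ENNReal.add_ne_top.2
      ⟨h1.lintegral_lt_top.ne, ENNReal.mul_ne_top hC h2.lintegral_lt_top.ne⟩)
  · intro Ω _ P _ f hf hf0 htail
    rw [lintegral_rpow_eq_lintegral_meas_lt_mul P (ae_of_all _ hf0) hf.aemeasurable hp]
    gcongr
    rw [← Set.Ioc_union_Ioi_eq_Ioi hT.le, lintegral_union measurableSet_Ioi
      (Set.Ioc_disjoint_Ioi le_rfl)]
    refine add_le_add (lintegral_mono fun t => ?_) ?_
    · calc _ ≤ 1 * ENNReal.ofReal (t ^ (p - 1)) := by gcongr; exact prob_le_one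
        _ = _ := one_mul _
    · rw [← lintegral_const_mul' _ _ hC]
      refine setLIntegral_mono (by fun_prop) fun t ht => ?_
      have ht0 : 0 < t := hT.trans ht
      calc _ ≤ C * ENNReal.ofReal (t ^ (-q)) * ENNReal.ofReal (t ^ (p - 1)) := by
            gcongr; exact htail t (le_of_lt ht)
        _ = _ := by
            rw [mul_assoc, ← ENNReal.ofReal_mul (Real.rpow_nonneg ht0.le _),
              ← Real.rpow_add ht0]
            congr 3; ring

/-- A sequence bounded in `L^q` is uniformly integrable in `L^p` for `p < q`. -/
theorem unifIntegrable_of_moment_le {Ω F : Type*} [MeasurableSpace Ω] {P : Measure Ω}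
    [NormedAddCommGroup F] {f : ℕ → Ω → F} (hf : ∀ n, AEStronglyMeasurable (f n) P)
    {p q : ℝ} (hp : 1 ≤ p) (hpq : p < q) {K : ℝ≥0∞} (hK : K ≠ ∞)
    (h : ∀ n, ∫⁻ ω, ENNReal.ofReal (‖f n ω‖ ^ q) ∂P ≤ K) :
    UnifIntegrable f (ENNReal.ofReal p) P := by
  have hp0 : 0 < p := by linarith
  refine unifIntegrable_of (by simpa using hp) ENNReal.ofReal_ne_top hf fun ε hε => ?_
  have hlim : Tendsto (fun c : ℝ => ENNReal.ofReal (c ^ (-(q - p))) * K) atTop (𝓝 0) := by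
    have h1 := ENNReal.tendsto_ofReal (tendsto_rpow_neg_atTop (sub_pos.2 hpq))
    have h2 := ENNReal.Tendsto.mul_const h1 (Or.inr hK)
    simpa using h2
  have hεp : 0 < ENNReal.ofReal ε ^ p := by
    rw [ENNReal.ofReal_rpow_of_pos hε]; simp; positivity
  obtain ⟨c, hc1, hc⟩ := ((hlim.eventually (gt_mem_nhds hεp)).and (eventually_gt_atTop 0)).exists
  lift c to NNReal using hc.le
  refine ⟨c, fun n => ?_⟩
  have hpne : ENNReal.ofReal p ≠ 0 := by simpa using hp0
  rw [eLpNorm_eq_lintegral_rpow_enorm_toReal hpne ENNReal.ofReal_ne_top,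
    ENNReal.toReal_ofReal hp0.le, one_div, ENNReal.rpow_inv_le_iff hp0]
  refine le_trans ?_ hc1.le
  -- Where the norm is at least `c`, its `p`-th power is at most `c ^ (-(q - p))` times its `q`-th
  -- power.
  calc _ ≤ ∫⁻ ω, ENNReal.ofReal (c ^ (-(q - p))) * ENNReal.ofReal (‖f n ω‖ ^ q) ∂P := by
        refine lintegral_mono fun ω => ?_
        dsimp only
        by_cases hω : c ≤ ‖f n ω‖₊
        · have hω' : c ≤ ‖f n ω‖ := hω
          have hpos : 0 < ‖f n ω‖ := hc.trans_le hω'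
          rw [Set.indicator_of_mem (show ω ∈ {x | c ≤ ‖f n x‖₊} from hω),
            ← ofReal_norm, ENNReal.ofReal_rpow_of_pos hpos, ← ENNReal.ofReal_mul (by positivity)]
          refine ENNReal.ofReal_le_ofReal ?_
          calc ‖f n ω‖ ^ p = ‖f n ω‖ ^ (-(q - p)) * ‖f n ω‖ ^ q := by
                rw [← Real.rpow_add hpos]; congr 1; ring
            _ ≤ _ := by
                gcongr ?_ * _
                exact Real.rpow_le_rpow_of_nonpos hc hω' (by linarith)
        · rw [Set.indicator_of_notMem (show ω ∉ {x | c ≤ ‖f n x‖₊} from hω)]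
          simp [hp0]
    _ = ENNReal.ofReal (c ^ (-(q - p))) * ∫⁻ ω, ENNReal.ofReal (‖f n ω‖ ^ q) ∂P :=
        lintegral_const_mul' _ _ ENNReal.ofReal_ne_top
    _ ≤ _ := by gcongr; exact h n

theorem memLp_of_moment_le {Ω F : Type*} [MeasurableSpace Ω] {P : Measure Ω}
    [NormedAddCommGroup F] {f : Ω → F} (hf : AEStronglyMeasurable f P)
    {q : ℝ} (hq : 0 < q) {K : ℝ≥0∞} (hK : K ≠ ∞)
    (h : ∫⁻ ω, ENNReal.ofReal (‖f ω‖ ^ q) ∂P ≤ K) : MemLp f (ENNReal.ofReal q) P := by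
  refine ⟨hf, ?_⟩
  have hqne : ENNReal.ofReal q ≠ 0 := by simpa using hq
  rw [eLpNorm_lt_top_iff_lintegral_rpow_enorm_lt_top hqne ENNReal.ofReal_ne_top,
    ENNReal.toReal_ofReal hq.le]
  refine (le_of_eq ?_).trans_lt (h.trans_lt hK.lt_top)
  refine lintegral_congr fun ω => ?_
  rw [← ofReal_norm, ENNReal.ofReal_rpow_of_nonneg (norm_nonneg _) hq.le]

/-- Fatou's lemma. -/
theorem moment_le_of_tendsto {Ω F : Type*} [MeasurableSpace Ω] {P : Measure Ω}
    [NormedAddCommGroup F] [MeasurableSpace F] [OpensMeasurableSpace F] {f : ℕ → Ω → F}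
    {g : Ω → F} (hf : ∀ n, Measurable (f n))
    (hlim : ∀ᵐ ω ∂P, Tendsto (fun n => f n ω) atTop (𝓝 (g ω)))
    {q : ℝ} (hq : 0 < q) {K : ℝ≥0∞} (h : ∀ n, ∫⁻ ω, ENNReal.ofReal (‖f n ω‖ ^ q) ∂P ≤ K) :
    ∫⁻ ω, ENNReal.ofReal (‖g ω‖ ^ q) ∂P ≤ K := by
  calc _ = ∫⁻ ω, liminf (fun n => ENNReal.ofReal (‖f n ω‖ ^ q)) atTop ∂P := by
        refine lintegral_congr_ae ?_
        filter_upwards [hlim] with ω hω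
        exact (ENNReal.tendsto_ofReal
          (hω.norm.rpow_const (Or.inr hq.le))).liminf_eq.symm
    _ ≤ liminf (fun n => ∫⁻ ω, ENNReal.ofReal (‖f n ω‖ ^ q) ∂P) atTop :=
        lintegral_liminf_le fun n => ((hf n).norm.pow_const q).ennreal_ofReal
    _ ≤ K := by
        refine (liminf_le_liminf (Eventually.of_forall h)).trans ?_
        simp

end Integrability

/-! ### The martingale and its limit -/

section Convergence

variable {Ω Θ E : Type*} [NormedAddCommGroup E] [InnerProductSpace ℝ E] [FiniteDimensional ℝ E]
  [Nontrivial E] [MeasurableSpace E] [BorelSpace E] [MeasurableSpace Ω] [MeasurableSpace Θ]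
  {P : Measure Ω} {ν : Measure Θ} {ξ : List ℕ → Ω → Θ} {A : ℕ → Θ → E →L[ℝ] E} {α : ℝ}

/-- The logarithm is absorbed by giving up `α - q` in the exponent. -/
theorem one_add_log_mul_rpow_le {α q t : ℝ} (hq : q < α) (ht : 1 ≤ t) :
    (1 + Real.log t) * t ^ (-α) ≤ (1 + 1 / (α - q)) * t ^ (-q) := by
  have ht0 : 0 < t := by linarith
  have hε : 0 < α - q := sub_pos.2 hq
  have h1 := Real.log_le_rpow_div ht0.le hε
  have h2 : 1 ≤ t ^ (α - q) := Real.one_le_rpow ht hε.le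
  have h3 : t ^ (-q) = t ^ (α - q) * t ^ (-α) := by
    rw [← Real.rpow_add ht0]; congr 1; ring
  rw [h3, ← mul_assoc]
  gcongr
  calc 1 + Real.log t ≤ t ^ (α - q) + t ^ (α - q) / (α - q) := add_le_add h2 h1
    _ = _ := by ring

/-- The σ-algebras generated by the first generations. -/
def generationFiltration (hξ : ∀ u, Measurable (ξ u)) :
    Filtration ℕ (inferInstance : MeasurableSpace Ω) where
  seq n := sigmaOf ξ {u | u.length < n}
  mono' _ _ h := sigmaOf_mono fun _ hu => lt_of_lt_of_le hu h
  le' _ := sigmaOf_le hξ _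

namespace IsBranching

variable [IsProbabilityMeasure P] [IsProbabilityMeasure ν]

theorem exists_moment_process (hB : IsBranching P ν ξ A α) (hα1 : 1 < α) (hα2 : α < 2)
    (hm : ∫⁻ θ, ∑' j, ENNReal.ofReal ‖A j θ‖ ∂ν ≠ ∞) {w : E}
    (hDi : Integrable (innovation A w) ν) (hD0 : ∫ θ, innovation A w θ ∂ν = 0)
    (hDα : ∫⁻ θ, ENNReal.ofReal (‖innovation A w θ‖ ^ α) ∂ν ≠ ∞) {p : ℝ} (hp : 0 < p)
    (hpα : p < α) :
    ∃ K : ℝ≥0∞, K ≠ ∞ ∧ ∀ n, ∫⁻ ω, ENNReal.ofReal (‖process A ξ w n ω - w‖ ^ p) ∂P ≤ K := by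
  obtain ⟨C, hC, h⟩ := hB.exists_tail_process hα1 hα2 hm hDi hD0 hDα
  obtain ⟨q, hpq, hqα⟩ := exists_between hpα
  have hε : 0 < α - q := sub_pos.2 hqα
  -- The tail is known at `2 * t` for `t ≥ 1`. Rescaling by `2` gives the threshold `T = 2` and the
  -- factor `2 ^ q`.
  obtain ⟨K, hK, hKb⟩ := exists_moment_le_of_tail hp hpq (T := 2) two_pos
    (C := C * ENNReal.ofReal ((1 + 1 / (α - q)) * 2 ^ q)) (by finiteness)
  refine ⟨K, hK, fun n => hKb P _ ((hB.measurable_process w n).sub_const w).norm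
    (fun _ => norm_nonneg _) fun t ht => ?_⟩
  have ht1 : 1 ≤ t / 2 := by linarith
  have ht0 : 0 < t := by linarith
  have h1 := h (t / 2) ht1 n
  rw [show 2 * (t / 2) = t by ring] at h1
  refine h1.trans ?_
  rw [mul_assoc, ← ENNReal.ofReal_mul (by positivity)]
  gcongr C * ENNReal.ofReal ?_
  refine (one_add_log_mul_rpow_le hqα ht1).trans (le_of_eq ?_)
  rw [Real.div_rpow ht0.le two_pos.le, Real.rpow_neg two_pos.le, div_inv_eq_mul]
  ring

/-- The event `s` and the weight of `u` depend only on marks other than `ξ u`, and with those frozen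
the innovation has mean zero. This is the martingale property, one word at a time. -/
theorem setIntegral_innovation_eq_zero (hB : IsBranching P ν ξ A α)
    (hm : ∫⁻ θ, ∑' j, ENNReal.ofReal ‖A j θ‖ ∂ν ≠ ∞) {w : E}
    (hDi : Integrable (innovation A w) ν) (hD0 : ∫ θ, innovation A w θ ∂ν = 0) (e : E)
    {n : ℕ} {s : Set Ω} (hs : MeasurableSet[sigmaOf ξ {u | u.length < n}] s) (u : Word n) :
    ∫ ω in s, inner ℝ e (opWeight A ξ u ω (innovation A w (ξ u ω))) ∂P = 0 := by
  have hs' : MeasurableSet s := sigmaOf_le hB.measurable _ _ hs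
  have hsub : {v : List ℕ | v.length < n} ⊆ {u.1}ᶜ := by
    rintro v hv rfl
    simp [u.2] at hv
  have hF : Measurable[sigmaOf ξ {u.1}ᶜ] fun ω =>
      (s.indicator (fun _ => (1 : ℝ)) ω, opWeight A ξ u ω) :=
    (measurable_const.indicator (sigmaOf_mono hsub _ hs)).prodMk
      (hB.measurable_opWeight_sigmaOf u (sigmaOf_compl_singleton_length u.1))
  have hh : Measurable fun p : (ℝ × (E →L[ℝ] E)) × Θ =>
      p.1.1 * inner ℝ e (p.1.2 (innovation A w p.2)) := by
    refine Measurable.mul (by fun_prop) (measurable_const.inner (measurable_clm_apply (by fun_prop)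
      ((hB.measurable_innovation w).comp measurable_snd)))
  have hI : Integrable (fun ω => opWeight A ξ u ω (innovation A w (ξ u ω))) P := by
    refine ⟨(hB.measurable_opWeight_innovation w u).aestronglyMeasurable, ?_⟩
    have h1 := hB.lintegral_opWeight_innovation w n
    have h2 : (∫⁻ θ, ∑' j, ENNReal.ofReal ‖A j θ‖ ∂ν) ^ n *
        ∫⁻ θ, ENNReal.ofReal ‖innovation A w θ‖ ∂ν < ∞ := by
      refine ENNReal.mul_lt_top (ENNReal.pow_ne_top hm).lt_top ?_
      simp_rw [ofReal_norm]
      exact hDi.2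
    rw [← h1] at h2
    refine lt_of_le_of_lt ?_ h2
    simp_rw [ofReal_norm]
    exact ENNReal.le_tsum (f := fun u : Word n =>
      ∫⁻ ω, ‖opWeight A ξ u ω (innovation A w (ξ u ω))‖ₑ ∂P) u
  have heq : ∀ ω, s.indicator (fun ω => inner ℝ e (opWeight A ξ u ω (innovation A w (ξ u ω)))) ω =
      s.indicator (fun _ => (1 : ℝ)) ω *
        inner ℝ e (opWeight A ξ u ω (innovation A w (ξ u ω))) := by
    intro ω
    by_cases h : ω ∈ s <;> simp [h]
  have hint : Integrable (fun ω => s.indicator (fun _ => (1 : ℝ)) ω *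
        inner ℝ e (opWeight A ξ u ω (innovation A w (ξ u ω)))) P := by
    simp_rw [← heq]
    exact (hI.const_inner e).indicator hs'
  rw [← integral_indicator hs']
  simp_rw [heq]
  refine (integral_of_sigmaOf hB.measurable hB.indep
    (by simp : Disjoint ({u.1}ᶜ : Set (List ℕ)) {u.1}) hF (measurable_sigmaOf rfl :
      Measurable[sigmaOf ξ {u.1}] (ξ u.1)) hh hint).trans ?_
  rw [hB.map_eq]
  refine integral_eq_zero_of_ae (ae_of_all _ fun ω => ?_)
  dsimp only
  rw [integral_const_mul]
  have h1 := ContinuousLinearMap.integral_comp_comm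
    ((innerSL ℝ e).comp (opWeight A ξ u ω)) hDi
  simp only [ContinuousLinearMap.comp_apply, innerSL_apply_apply] at h1
  rw [h1, hD0]
  simp

/-- Inner products with a fixed vector are taken to make the martingale scalar. The increment is a
sum over words, and its integral may be taken term by term because the absolute first moments are
summable. -/
theorem martingale_process (hB : IsBranching P ν ξ A α)
    (hm : ∫⁻ θ, ∑' j, ENNReal.ofReal ‖A j θ‖ ∂ν ≠ ∞) {w : E}
    (hDi : Integrable (innovation A w) ν) (hD0 : ∫ θ, innovation A w θ ∂ν = 0) (e : E) :
    Martingale (fun n ω => inner ℝ e (process A ξ w n ω))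
      (generationFiltration hB.measurable) P := by
  have hint : ∀ n, Integrable (fun ω => inner ℝ e (process A ξ w n ω)) P := fun n =>
    (hB.integrable_process hm w n).const_inner e
  have hadp : ∀ n, Measurable[sigmaOf ξ {u | u.length < n}]
      fun ω => inner ℝ e (process A ξ w n ω) := fun n =>
    (by fun_prop : Measurable fun x : E => inner ℝ e x).comp
      (hB.measurable_process_sigmaOf w le_rfl)
  refine martingale_nat (fun n => (hadp n).stronglyMeasurable) hint fun n => ?_
  refine ae_eq_condExp_of_forall_setIntegral_eq ((generationFiltration hB.measurable).le n)
    (hint (n + 1)) (fun s _ _ => (hint n).integrableOn) (fun s hs _ => ?_)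
    (hadp n).stronglyMeasurable.aestronglyMeasurable
  have hs' : MeasurableSet s := (generationFiltration hB.measurable).le n s hs
  rw [eq_comm, ← sub_eq_zero, ← integral_sub (hint (n + 1)).integrableOn (hint n).integrableOn]
  have h1 : ∫ ω in s, (inner ℝ e (process A ξ w (n + 1) ω) - inner ℝ e (process A ξ w n ω)) ∂P =
      ∫ ω in s, ∑' u : Word n, inner ℝ e (opWeight A ξ u ω (innovation A w (ξ u ω))) ∂P := by
    refine integral_congr_ae (ae_restrict_of_ae ?_)
    filter_upwards [hB.ae_hasSum_innovation hm w] with ω hω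
    rw [← inner_sub_right]
    exact ((innerSL ℝ e).hasSum (hω n)).tsum_eq.symm
  rw [h1, integral_tsum]
  · simp_rw [hB.setIntegral_innovation_eq_zero hm hDi hD0 e hs]
    exact tsum_zero
  · intro u
    exact (measurable_const.inner (hB.measurable_opWeight_innovation w u)).aestronglyMeasurable
  · have h2 : ‖e‖ₑ * ((∫⁻ θ, ∑' j, ENNReal.ofReal ‖A j θ‖ ∂ν) ^ n *
        ∫⁻ θ, ENNReal.ofReal ‖innovation A w θ‖ ∂ν) ≠ ∞ := by
      refine ENNReal.mul_ne_top enorm_ne_top (ENNReal.mul_ne_top (ENNReal.pow_ne_top hm) ?_)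
      simp_rw [ofReal_norm]
      exact hDi.2.ne
    refine ne_top_of_le_ne_top h2 ?_
    rw [← hB.lintegral_opWeight_innovation w n, ← ENNReal.tsum_mul_left]
    refine ENNReal.tsum_le_tsum fun u => ?_
    rw [← lintegral_const_mul' _ _ enorm_ne_top]
    refine (setLIntegral_le_lintegral _ _).trans (lintegral_mono fun ω => ?_)
    dsimp only
    rw [← ofReal_norm, ← ofReal_norm, ← ENNReal.ofReal_mul (norm_nonneg _)]
    exact ENNReal.ofReal_le_ofReal (norm_inner_le_norm _ _)

/-- The first moments are bounded because `1 < α`, so each coordinate in an orthonormal basis is an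
`L^1`-bounded martingale and converges. -/
theorem exists_ae_tendsto_process (hB : IsBranching P ν ξ A α) (hα1 : 1 < α) (hα2 : α < 2)
    (hm : ∫⁻ θ, ∑' j, ENNReal.ofReal ‖A j θ‖ ∂ν ≠ ∞) {w : E}
    (hDi : Integrable (innovation A w) ν) (hD0 : ∫ θ, innovation A w θ ∂ν = 0)
    (hDα : ∫⁻ θ, ENNReal.ofReal (‖innovation A w θ‖ ^ α) ∂ν ≠ ∞) :
    ∃ Zw : Ω → E, Measurable Zw ∧
      ∀ᵐ ω ∂P, Tendsto (fun n => process A ξ w n ω) atTop (𝓝 (Zw ω)) := by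
  obtain ⟨K, hK, hKb⟩ := hB.exists_moment_process hα1 hα2 hm hDi hD0 hDα one_pos hα1
  refine measurable_limit_of_tendsto_metrizable_ae
    (fun n => (hB.measurable_process w n).aemeasurable) ?_
  have hcoord : ∀ e : E, ∀ᵐ ω ∂P, ∃ l, Tendsto (fun n => inner ℝ e (process A ξ w n ω))
      atTop (𝓝 l) := by
    intro e
    have hR : ‖e‖ₑ * (K + ‖w‖ₑ) ≠ ∞ := by finiteness
    have hbdd : ∀ n, eLpNorm (fun ω => inner ℝ e (process A ξ w n ω)) 1 P ≤
        ((‖e‖ₑ * (K + ‖w‖ₑ)).toNNReal : ℝ≥0∞) := by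
      intro n
      rw [ENNReal.coe_toNNReal hR, eLpNorm_one_eq_lintegral_enorm]
      calc _ ≤ ∫⁻ ω, ‖e‖ₑ * (ENNReal.ofReal (‖process A ξ w n ω - w‖ ^ (1 : ℝ)) + ‖w‖ₑ) ∂P := by
            refine lintegral_mono fun ω => ?_
            dsimp only
            rw [Real.rpow_one, ← ofReal_norm, ← ofReal_norm, ← ofReal_norm (x := w),
              ← ENNReal.ofReal_add (norm_nonneg _) (norm_nonneg _),
              ← ENNReal.ofReal_mul (norm_nonneg _)]
            refine ENNReal.ofReal_le_ofReal ((norm_inner_le_norm _ _).trans ?_)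
            gcongr
            simpa using norm_add_le (process A ξ w n ω - w) w
        _ = ‖e‖ₑ * (∫⁻ ω, ENNReal.ofReal (‖process A ξ w n ω - w‖ ^ (1 : ℝ)) ∂P + ‖w‖ₑ) := by
            rw [lintegral_const_mul' _ _ enorm_ne_top, lintegral_add_right _ measurable_const]
            simp
        _ ≤ _ := by gcongr; exact hKb n
    exact (hB.martingale_process hm hDi hD0 e).submartingale.exists_ae_tendsto_of_bdd hbdd
  let b := stdOrthonormalBasis ℝ E
  filter_upwards [ae_all_iff.2 fun i => hcoord (b i)] with ω hω
  choose l hl using hω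
  refine ⟨∑ i, l i • b i, ?_⟩
  have h : ∀ n, process A ξ w n ω = ∑ i, inner ℝ (b i) (process A ξ w n ω) • b i := fun n =>
    (b.sum_repr' _).symm
  refine Tendsto.congr (fun n => (h n).symm) ?_
  exact tendsto_finsetSum _ fun i _ => (hl i).smul_const (b i)

theorem tendsto_eLpNorm_process (hB : IsBranching P ν ξ A α) (hα1 : 1 < α) (hα2 : α < 2)
    (hm : ∫⁻ θ, ∑' j, ENNReal.ofReal ‖A j θ‖ ∂ν ≠ ∞) {w : E}
    (hDi : Integrable (innovation A w) ν) (hD0 : ∫ θ, innovation A w θ ∂ν = 0)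
    (hDα : ∫⁻ θ, ENNReal.ofReal (‖innovation A w θ‖ ^ α) ∂ν ≠ ∞)
    {Zw : Ω → E} (hZ : Measurable Zw)
    (hlim : ∀ᵐ ω ∂P, Tendsto (fun n => process A ξ w n ω) atTop (𝓝 (Zw ω)))
    {p : ℝ} (hpα : p < α) :
    (∀ n, MemLp (process A ξ w n) (ENNReal.ofReal p) P) ∧ MemLp Zw (ENNReal.ofReal p) P ∧
      Tendsto (fun n => eLpNorm (process A ξ w n - Zw) (ENNReal.ofReal p) P) atTop (𝓝 0) := by
  -- Vitali's theorem is applied at an exponent that is at least `1` and still below `α`. The norm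
  -- of order `p` is dominated by it, as `P` is a probability measure.
  set r := max p 1 with hr
  have hr1 : 1 ≤ r := le_max_right _ _
  have hr0 : 0 < r := by linarith
  have hpr : ENNReal.ofReal p ≤ ENNReal.ofReal r := ENNReal.ofReal_le_ofReal (le_max_left _ _)
  obtain ⟨q, hrq, hqα⟩ := exists_between (max_lt hpα hα1)
  have hq0 : 0 < q := hr0.trans hrq
  obtain ⟨K, hK, hKb⟩ := hB.exists_moment_process hα1 hα2 hm hDi hD0 hDα hq0 hqα
  have hrq' : ENNReal.ofReal r ≤ ENNReal.ofReal q := ENNReal.ofReal_le_ofReal hrq.le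
  have hYm : ∀ n, Measurable fun ω => process A ξ w n ω - w := fun n =>
    (hB.measurable_process w n).sub_const w
  have hYlim : ∀ᵐ ω ∂P, Tendsto (fun n => process A ξ w n ω - w) atTop (𝓝 (Zw ω - w)) := by
    filter_upwards [hlim] with ω hω
    exact hω.sub_const w
  have hYL : ∀ n, MemLp (fun ω => process A ξ w n ω - w) (ENNReal.ofReal q) P := fun n =>
    memLp_of_moment_le (hYm n).aestronglyMeasurable hq0 hK (hKb n)
  have hZL : MemLp (fun ω => Zw ω - w) (ENNReal.ofReal q) P :=
    memLp_of_moment_le (hZ.sub_const w).aestronglyMeasurable hq0 hK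
      (moment_le_of_tendsto hYm hYlim hq0 hKb)
  have hui := unifIntegrable_of_moment_le (P := P) (fun n => (hYm n).aestronglyMeasurable)
    hr1 hrq hK hKb
  have hT := tendsto_Lp_finite_of_tendsto_ae (by simpa using hr1) ENNReal.ofReal_ne_top
    (fun n => (hYm n).aestronglyMeasurable) (hZL.mono_exponent hrq') hui hYlim
  have hcongr : ∀ n, ((fun ω => process A ξ w n ω - w) - fun ω => Zw ω - w) =
      process A ξ w n - Zw := by
    intro n; funext ω; simp
  simp_rw [hcongr] at hT
  have hw : MemLp (fun _ : Ω => w) (ENNReal.ofReal p) P := memLp_const w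
  refine ⟨fun n => ?_, ?_, ?_⟩
  · convert ((hYL n).mono_exponent (hpr.trans hrq')).add hw using 1
    funext ω; simp
  · convert (hZL.mono_exponent (hpr.trans hrq')).add hw using 1
    funext ω; simp
  · refine tendsto_of_tendsto_of_tendsto_of_le_of_le tendsto_const_nhds hT
      (fun _ => zero_le) fun n => ?_
    exact eLpNorm_le_eLpNorm_of_exponent_le hpr
      ((hB.measurable_process w n).sub hZ).aestronglyMeasurable

/-- A martingale converging in `L^1` is the conditional expectation of its limit. If the limit were
a constant `c`, every generation would equal `c` almost surely; generation `0` gives `c = w`, and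
generation `1` contradicts non-triviality. -/
theorem not_ae_eq_const (hB : IsBranching P ν ξ A α)
    (hm : ∫⁻ θ, ∑' j, ENNReal.ofReal ‖A j θ‖ ∂ν ≠ ∞) {w : E}
    (hDi : Integrable (innovation A w) ν) (hD0 : ∫ θ, innovation A w θ ∂ν = 0)
    {Zw : Ω → E}
    (hlim : Tendsto (fun n => eLpNorm (process A ξ w n - Zw) 1 P) atTop (𝓝 0))
    (hnontriv : ¬ ∀ᵐ ω ∂P, process A ξ w 1 ω = w) :
    ¬ ∃ c, ∀ᵐ ω ∂P, Zw ω = c := by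
  rintro ⟨c, hc⟩
  apply hnontriv
  have key : ∀ e : E, ∀ n, ∀ᵐ ω ∂P, inner ℝ e (process A ξ w n ω) = inner ℝ e c := by
    intro e n
    have hmart := hB.martingale_process hm hDi hD0 e
    have hT : Tendsto (fun n => eLpNorm ((fun ω => inner ℝ e (process A ξ w n ω)) -
        fun _ => inner ℝ e c) 1 P) atTop (𝓝 0) := by
      have h0 : Tendsto (fun n => ENNReal.ofReal ‖e‖ * eLpNorm (process A ξ w n - Zw) 1 P)
          atTop (𝓝 0) := by
        have := ENNReal.Tendsto.const_mul hlim (Or.inr (ENNReal.ofReal_ne_top (r := ‖e‖)))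
        rwa [mul_zero] at this
      refine tendsto_of_tendsto_of_tendsto_of_le_of_le tendsto_const_nhds h0
        (fun _ => zero_le) fun n => ?_
      refine eLpNorm_le_mul_eLpNorm_of_ae_le_mul ?_ 1
      filter_upwards [hc] with ω hω
      rw [Pi.sub_apply, Pi.sub_apply, hω, ← inner_sub_right]
      exact norm_inner_le_norm _ _
    have h1 := hmart.eq_condExp_of_tendsto_eLpNorm (integrable_const _) hT n
    rw [condExp_const ((generationFiltration hB.measurable).le n)] at h1
    exact h1
  have hwc : ∀ e : E, inner ℝ e w = inner ℝ e c := by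
    intro e
    obtain ⟨ω, hω⟩ := (key e 0).exists
    rwa [process_zero] at hω
  have hcw : w = c := ext_inner_left ℝ hwc
  let b := stdOrthonormalBasis ℝ E
  filter_upwards [ae_all_iff.2 fun i => key (b i) 1] with ω hω
  calc process A ξ w 1 ω = ∑ i, inner ℝ (b i) (process A ξ w 1 ω) • b i := (b.sum_repr' _).symm
    _ = ∑ i, inner ℝ (b i) c • b i := Finset.sum_congr rfl fun i _ => by rw [hω i]
    _ = c := b.sum_repr' c
    _ = w := hcw.symm

end IsBranching

end Convergence

/-! ### Similarity matrices as conformal operators -/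

section Matrices

variable {d : ℕ}

theorem isConformal_zero {E : Type*} [NormedAddCommGroup E] [NormedSpace ℝ E] :
    IsConformal (0 : E →L[ℝ] E) := by
  intro v; simp

theorem isConformal_of_norm_apply {E : Type*} [NormedAddCommGroup E] [NormedSpace ℝ E]
    [Nontrivial E] {T : E →L[ℝ] E} {c : ℝ} (hT : ∀ v, ‖T v‖ = c * ‖v‖) :
    IsConformal T ∧ ‖T‖ = c := by
  obtain ⟨v, hv⟩ := exists_ne (0 : E)
  have hv' := norm_pos_iff.2 hv
  have hc : 0 ≤ c := by
    have := norm_nonneg (T v)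
    rw [hT] at this
    exact nonneg_of_mul_nonneg_left this hv'
  have h : ‖T‖ = c := by
    refine le_antisymm (T.opNorm_le_bound hc fun v => (hT v).le) ?_
    have := T.le_opNorm v
    rw [hT] at this
    exact le_of_mul_le_mul_right this hv'
  exact ⟨fun v => by rw [h, hT], h⟩

/-- Closedness makes the case distinction in `markOp` measurable. -/
theorem isClosed_setOf_isConformal {E : Type*} [NormedAddCommGroup E] [NormedSpace ℝ E] :
    IsClosed {T : E →L[ℝ] E | IsConformal T} := by
  have : {T : E →L[ℝ] E | IsConformal T} = ⋂ v, {T | ‖T v‖ = ‖T‖ * ‖v‖} := by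
    ext T; simp [IsConformal]
  rw [this]
  exact isClosed_iInter fun v => isClosed_eq (by fun_prop) (by fun_prop)

theorem continuous_toEuclideanCLM_of :
    Continuous fun x : Fin d → Fin d → ℝ =>
      Matrix.toEuclideanCLM (n := Fin d) (𝕜 := ℝ) (Matrix.of x) :=
  LinearMap.continuous_of_finiteDimensional
    ((Matrix.toEuclideanCLM (n := Fin d) (𝕜 := ℝ)).toAlgEquiv.toLinearMap ∘ₗ
      (Matrix.ofLinearEquiv ℝ).toLinearMap)

theorem IsSimilarity.isConformal [Nontrivial (EuclideanSpace ℝ (Fin d))]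
    {A : Matrix (Fin d) (Fin d) ℝ} (hA : IsSimilarity A) :
    IsConformal (Matrix.toEuclideanCLM (n := Fin d) (𝕜 := ℝ) A) ∧
      0 < ‖Matrix.toEuclideanCLM (n := Fin d) (𝕜 := ℝ) A‖ := by
  obtain ⟨c, hc, O, hO, rfl⟩ := hA
  have hU : Matrix.toEuclideanCLM (n := Fin d) (𝕜 := ℝ) O ∈
      unitary (EuclideanSpace ℝ (Fin d) →L[ℝ] EuclideanSpace ℝ (Fin d)) :=
    Unitary.map_mem _ hO
  have h := isConformal_of_norm_apply (c := c)
    (T := Matrix.toEuclideanCLM (n := Fin d) (𝕜 := ℝ) (c • O)) fun v => by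
      rw [map_smul, _root_.smul_apply, norm_smul, Real.norm_of_nonneg hc.le,
        ContinuousLinearMap.norm_map_of_mem_unitary hU]
  exact ⟨h.1, hc.trans_eq h.2.symm⟩

/-- The operator of the matrix `θ j` if it is conformal, and `0` otherwise. -/
noncomputable def markOp (j : ℕ) (θ : ℕ → Fin d → Fin d → ℝ) :
    EuclideanSpace ℝ (Fin d) →L[ℝ] EuclideanSpace ℝ (Fin d) :=
  open Classical in
  if IsConformal (Matrix.toEuclideanCLM (n := Fin d) (𝕜 := ℝ) (Matrix.of (θ j))) then
    Matrix.toEuclideanCLM (n := Fin d) (𝕜 := ℝ) (Matrix.of (θ j)) else 0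

/-- Conformality holds at every mark, not just at those produced by the process, as `IsBranching`
demands; this is why `markOp` is set to zero elsewhere. -/
theorem isConformal_markOp (j : ℕ) (θ : ℕ → Fin d → Fin d → ℝ) : IsConformal (markOp j θ) := by
  unfold markOp
  split_ifs with h
  · exact h
  · exact isConformal_zero

theorem measurable_markOp (j : ℕ) : Measurable (markOp (d := d) j) := by
  have h : Measurable fun θ : ℕ → Fin d → Fin d → ℝ =>
      Matrix.toEuclideanCLM (n := Fin d) (𝕜 := ℝ) (Matrix.of (θ j)) :=
    continuous_toEuclideanCLM_of.measurable.comp (measurable_pi_apply j)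
  exact Measurable.ite (h isClosed_setOf_isConformal.measurableSet) h measurable_const

theorem norm_le_sum_abs (x : EuclideanSpace ℝ (Fin d)) : ‖x‖ ≤ ∑ a, |x a| := by
  have h := (EuclideanSpace.basisFun (Fin d) ℝ).sum_repr x
  calc ‖x‖ = ‖∑ a, (EuclideanSpace.basisFun (Fin d) ℝ).repr x a •
        EuclideanSpace.basisFun (Fin d) ℝ a‖ := by rw [h]
    _ ≤ ∑ a, |x a| := by
      refine (norm_sum_le _ _).trans (le_of_eq (Finset.sum_congr rfl fun a _ => ?_))
      rw [norm_smul]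
      simp

theorem toEuclideanCLM_single (A : Matrix (Fin d) (Fin d) ℝ) (a b : Fin d) :
    Matrix.toEuclideanCLM (n := Fin d) (𝕜 := ℝ) A (EuclideanSpace.single b 1) a = A a b := by
  rw [Matrix.ofLp_toEuclideanCLM]
  simp

end Matrices

/-! ### From the random tree to sums over all words -/

section Tree

variable {d : ℕ} {Ω : Type*} {N : List ℕ → Ω → ℕ∞}
  {X : List ℕ → ℕ → Ω → Matrix (Fin d) (Fin d) ℝ}

/-- The matrices of the offspring of an individual. -/
noncomputable def mark (N : List ℕ → Ω → ℕ∞) (X : List ℕ → ℕ → Ω → Matrix (Fin d) (Fin d) ℝ)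
    (u : List ℕ) (ω : Ω) : ℕ → Fin d → Fin d → ℝ :=
  (offspring N X u ω).2

theorem length_of_mem_generation {n : ℕ} {ω : Ω} {u : List ℕ} (h : u ∈ generation N n ω) :
    u.length = n := by
  induction n generalizing u with
  | zero => rw [show u = [] from h]; rfl
  | succ n ih =>
    obtain ⟨v, hv, j, -, rfl⟩ := h
    rw [List.length_cons, ih hv]

theorem cons_mem_generation {n : ℕ} {ω : Ω} {u : List ℕ} {j : ℕ} :
    j :: u ∈ generation N (n + 1) ω ↔ u ∈ generation N n ω ∧ (j : ℕ∞) < N u ω := by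
  constructor
  · rintro ⟨v, hv, i, hi, h⟩
    obtain ⟨rfl, rfl⟩ := List.cons.inj h
    exact ⟨hv, hi⟩
  · rintro ⟨hu, hj⟩
    exact ⟨u, hu, j, hj, rfl⟩

variable [Nontrivial (EuclideanSpace ℝ (Fin d))]

theorem markOp_mark_of_lt (hX : ∀ u (j : ℕ) ω, (j : ℕ∞) < N u ω → IsSimilarity (X u j ω)) {u : List ℕ}
    {j : ℕ} {ω : Ω} (h : (j : ℕ∞) < N u ω) :
    markOp j (mark N X u ω) = Matrix.toEuclideanCLM (n := Fin d) (𝕜 := ℝ) (X u j ω) := by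
  have h1 : Matrix.of (mark N X u ω j) = X u j ω := by
    ext a b
    simp [mark, offspring, h]
  rw [markOp, h1, if_pos (hX u j ω h).isConformal.1]

theorem markOp_mark_of_not_lt {u : List ℕ} {j : ℕ} {ω : Ω} (h : ¬ (j : ℕ∞) < N u ω) :
    markOp j (mark N X u ω) = 0 := by
  have h1 : Matrix.of (mark N X u ω j) = 0 := by
    ext a b
    simp only [mark, offspring, if_neg h]
    rfl
  rw [markOp, h1, map_zero, ite_self]

theorem opWeight_of_mem (hX : ∀ u (j : ℕ) ω, (j : ℕ∞) < N u ω → IsSimilarity (X u j ω)) {n : ℕ}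
    {ω : Ω} {u : List ℕ} (h : u ∈ generation N n ω) :
    opWeight markOp (mark N X) u ω =
      Matrix.toEuclideanCLM (n := Fin d) (𝕜 := ℝ) (weight X u ω) := by
  induction u generalizing n with
  | nil => simp [opWeight, weight]
  | cons j u ih =>
    cases n with
    | zero => exact absurd h (by simp [generation])
    | succ n =>
      rw [cons_mem_generation] at h
      rw [opWeight, weight, map_mul, ih h.1, markOp_mark_of_lt hX h.2]

/-- A word outside the tree has a missing individual on its line, whose zero matrix annihilates the
product. A sum over the random generation thus becomes a sum over all words of its length. -/
theorem opWeight_of_notMem {n : ℕ} {ω : Ω} {u : List ℕ} (hu : u.length = n)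
    (h : u ∉ generation N n ω) : opWeight markOp (mark N X) u ω = 0 := by
  induction u generalizing n with
  | nil => subst hu; exact absurd rfl h
  | cons j u ih =>
    subst hu
    rw [List.length_cons, cons_mem_generation, not_and_or] at h
    rw [opWeight]
    rcases h with h | h
    · rw [ih rfl h, zero_mul]
    · rw [markOp_mark_of_not_lt h, mul_zero]

/-- The inclusion of a generation into the words of the corresponding length. -/
def generationWord (n : ℕ) (ω : Ω) (u : generation N n ω) : Word n :=
  ⟨u, length_of_mem_generation u.2⟩

theorem generationWord_injective (n : ℕ) (ω : Ω) :
    Function.Injective (generationWord (N := N) n ω) :=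
  fun _ _ h => Subtype.ext (congrArg (fun v : Word n => v.1) h)

theorem opWeight_of_notMem_range {n : ℕ} {ω : Ω} {u : Word n}
    (h : u ∉ Set.range (generationWord (N := N) n ω)) :
    opWeight markOp (mark N X) u ω = 0 :=
  opWeight_of_notMem u.2 fun hu => h ⟨⟨u.1, hu⟩, rfl⟩

variable {M : Type*} [AddCommMonoid M] [TopologicalSpace M]
  {F : (EuclideanSpace ℝ (Fin d) →L[ℝ] EuclideanSpace ℝ (Fin d)) → M}

theorem tsum_generation (hX : ∀ u (j : ℕ) ω, (j : ℕ∞) < N u ω → IsSimilarity (X u j ω)) (hF : F 0 = 0)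
    (n : ℕ) (ω : Ω) :
    ∑' u : generation N n ω, F (Matrix.toEuclideanCLM (n := Fin d) (𝕜 := ℝ) (weight X u ω)) =
      ∑' u : Word n, F (opWeight markOp (mark N X) u ω) := by
  rw [← (generationWord_injective n ω).tsum_eq]
  · exact tsum_congr fun u => by rw [← opWeight_of_mem hX u.2]; rfl
  · intro u hu
    by_contra h
    exact hu (by dsimp only; rw [opWeight_of_notMem_range h, hF])

theorem summable_generation (hX : ∀ u (j : ℕ) ω, (j : ℕ∞) < N u ω → IsSimilarity (X u j ω))
    (hF : F 0 = 0) (n : ℕ) (ω : Ω) :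
    (Summable fun u : generation N n ω =>
      F (Matrix.toEuclideanCLM (n := Fin d) (𝕜 := ℝ) (weight X u ω))) ↔
      Summable fun u : Word n => F (opWeight markOp (mark N X) u ω) := by
  rw [← (generationWord_injective (N := N) n ω).summable_iff]
  · exact summable_congr fun u => by rw [← opWeight_of_mem hX u.2]; rfl
  · intro u hu
    rw [opWeight_of_notMem_range hu, hF]

theorem tsum_word_one (f : List ℕ → M) : ∑' u : Word 1, f u = ∑' j, f [j] := by
  rw [← ((Equiv.uniqueProd ℕ (Word 0)).symm.trans (wordSuccEquiv 0)).tsum_eq]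
  rfl

theorem tsum_generation_one (hX : ∀ u (j : ℕ) ω, (j : ℕ∞) < N u ω → IsSimilarity (X u j ω))
    (hF : F 0 = 0) (ω : Ω) :
    ∑' u : generation N 1 ω, F (Matrix.toEuclideanCLM (n := Fin d) (𝕜 := ℝ) (weight X u ω)) =
      ∑' j, F (markOp j (mark N X [] ω)) := by
  rw [tsum_generation hX hF, tsum_word_one fun u => F (opWeight markOp (mark N X) u ω)]
  simp [opWeight]

theorem Z_eq_process (hX : ∀ u (j : ℕ) ω, (j : ℕ∞) < N u ω → IsSimilarity (X u j ω))
    (w : EuclideanSpace ℝ (Fin d)) (n : ℕ) : Z N X w n = process markOp (mark N X) w n := by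
  funext ω
  exact tsum_generation (F := fun T => T w) hX rfl n ω

theorem process_one (w : EuclideanSpace ℝ (Fin d)) (ω : Ω) :
    process markOp (mark N X) w 1 ω = innovation markOp w (mark N X [] ω) + w := by
  rw [process, tsum_word_one fun u => opWeight markOp (mark N X) u ω w, innovation,
    sub_add_cancel]
  simp [opWeight]

theorem tsum_indicator_natCast_lt (n : ℕ∞) :
    ∑' j : ℕ, (open Classical in if (j : ℕ∞) < n then (1 : ℝ≥0∞) else 0) = n := by
  cases n with
  | top => simp
  | coe n =>
    rw [tsum_eq_sum (s := Finset.range n) fun j hj => if_neg (by simpa using hj),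
      Finset.sum_congr rfl fun j hj => if_pos (by simpa using hj)]
    simp

end Tree

/-! ### Transfer of the hypotheses to the abstract branching model -/

section Transfer

variable {d : ℕ} {Ω : Type*} [MeasurableSpace Ω] {P : Measure Ω} {N : List ℕ → Ω → ℕ∞}
  {X : List ℕ → ℕ → Ω → Matrix (Fin d) (Fin d) ℝ}

theorem measurable_mark (hmeas : ∀ u, Measurable (offspring N X u)) (u : List ℕ) :
    Measurable (mark N X u) := measurable_snd.comp (hmeas u)

variable [Nontrivial (EuclideanSpace ℝ (Fin d))]

theorem lintegral_tsum_markOp (hX : ∀ u (j : ℕ) ω, (j : ℕ∞) < N u ω → IsSimilarity (X u j ω))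
    (hmeas : ∀ u, Measurable (offspring N X u))
    {F : (EuclideanSpace ℝ (Fin d) →L[ℝ] EuclideanSpace ℝ (Fin d)) → ℝ≥0∞} (hF : Measurable F)
    (hF0 : F 0 = 0) :
    ∫⁻ θ, ∑' j, F (markOp j θ) ∂(P.map (mark N X [])) =
      ∫⁻ ω, ∑' u : generation N 1 ω,
        F (Matrix.toEuclideanCLM (n := Fin d) (𝕜 := ℝ) (weight X u ω)) ∂P := by
  have h : ∀ j, Measurable fun θ => F (markOp j θ) := fun j => hF.comp (measurable_markOp j)
  rw [lintegral_map (Measurable.tsum h) (measurable_mark hmeas [])]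
  exact lintegral_congr fun ω => (tsum_generation_one hX hF0 ω).symm

theorem isBranching_mark (hX : ∀ u (j : ℕ) ω, (j : ℕ∞) < N u ω → IsSimilarity (X u j ω))
    (hmeas : ∀ u, Measurable (offspring N X u)) (hindep : iIndepFun (offspring N X) P)
    (hident : ∀ u, IdentDistrib (offspring N X u) (offspring N X []) P P)
    (hsuper : 1 < ∫⁻ ω, (N [] ω : ℝ≥0∞) ∂P) {α : ℝ} (hα : α ≠ 0)
    (hmoment : ∫⁻ ω, ∑' u : generation N 1 ω, ENNReal.ofReal (‖weight X u ω‖ ^ α) ∂P = 1) :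
    IsBranching P (P.map (mark N X [])) (mark N X) markOp α where
  measurable := measurable_mark hmeas
  indep := hindep.comp (fun _ => Prod.snd) fun _ => measurable_snd
  map_eq u := ((hident u).comp measurable_snd).map_eq
  measurable_op := measurable_markOp
  conformal := isConformal_markOp
  moment := by
    rw [lintegral_tsum_markOp hX hmeas (F := fun T => ENNReal.ofReal (‖T‖ ^ α))
      (by fun_prop) (by simp [Real.zero_rpow hα])]
    exact hmoment
  supercritical := by
    have hmeas' : Measurable fun θ : ℕ → Fin d → Fin d → ℝ =>
        ∑' j, {θ | 0 < ‖markOp j θ‖}.indicator (1 : (ℕ → Fin d → Fin d → ℝ) → ℝ≥0∞) θ :=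
      Measurable.tsum fun j => measurable_one.indicator
        (measurableSet_lt measurable_const (measurable_markOp j).norm)
    rw [lintegral_map hmeas' (measurable_mark hmeas [])]
    refine hsuper.trans_eq (lintegral_congr fun ω => ?_)
    rw [← tsum_indicator_natCast_lt]
    refine tsum_congr fun j => ?_
    by_cases h : (j : ℕ∞) < N [] ω
    · rw [if_pos h, Set.indicator_of_mem]
      · rfl
      · change 0 < ‖markOp j (mark N X [] ω)‖
        rw [markOp_mark_of_lt hX h]
        exact (hX _ _ _ h).isConformal.2
    · rw [if_neg h, Set.indicator_of_notMem]
      change ¬ 0 < ‖markOp j (mark N X [] ω)‖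
      rw [markOp_mark_of_not_lt h]
      simp

/-- The norm of a conformal operator is the length of its image of one unit basis vector, hence at
most the sum of absolute values in one column of the matrix. Finite means in a single column are
enough. -/
theorem lintegral_tsum_norm_markOp_ne_top
    (hX : ∀ u (j : ℕ) ω, (j : ℕ∞) < N u ω → IsSimilarity (X u j ω))
    (hmeas : ∀ u, Measurable (offspring N X u)) (hmean : HasFiniteMean P N X) :
    ∫⁻ θ, ∑' j, ENNReal.ofReal ‖markOp j θ‖ ∂(P.map (mark N X [])) ≠ ∞ := by
  obtain ⟨b⟩ : Nonempty (Fin d) := by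
    by_contra h
    rw [not_nonempty_iff] at h
    exact not_subsingleton (EuclideanSpace ℝ (Fin d)) inferInstance
  let F : Fin d → (EuclideanSpace ℝ (Fin d) →L[ℝ] EuclideanSpace ℝ (Fin d)) → ℝ≥0∞ :=
    fun a T => ENNReal.ofReal |T (EuclideanSpace.single b 1) a|
  have hF : ∀ a, Measurable (F a) := fun a => by
    have h : Continuous fun T : EuclideanSpace ℝ (Fin d) →L[ℝ] EuclideanSpace ℝ (Fin d) =>
        |T (EuclideanSpace.single b 1) a| := by fun_prop
    exact h.measurable.ennreal_ofReal
  have hfin : ∀ a, ∫⁻ θ, ∑' j, F a (markOp j θ) ∂(P.map (mark N X [])) < ∞ := by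
    intro a
    rw [lintegral_tsum_markOp hX hmeas (hF a) (by simp [F])]
    simp only [F, toEuclideanCLM_single]
    exact hmean a b
  refine ne_top_of_le_ne_top (ENNReal.sum_ne_top.2 fun a _ => (hfin a).ne :
    ∑ a, ∫⁻ θ, ∑' j, F a (markOp j θ) ∂(P.map (mark N X [])) ≠ ∞) ?_
  have hF' : ∀ a j, Measurable fun θ => F a (markOp j θ) := fun a j =>
    (hF a).comp (measurable_markOp j)
  rw [← lintegral_finsetSum _ fun a _ => Measurable.tsum (hF' a)]
  refine lintegral_mono fun θ => ?_
  dsimp only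
  rw [← Summable.tsum_finsetSum fun _ _ => ENNReal.summable]
  refine ENNReal.tsum_le_tsum fun j => ?_
  rw [← ENNReal.ofReal_sum_of_nonneg fun _ _ => abs_nonneg _]
  refine ENNReal.ofReal_le_ofReal ?_
  have h := isConformal_markOp j θ (EuclideanSpace.single b 1)
  rw [PiLp.norm_single, norm_one, mul_one] at h
  rw [← h]
  exact norm_le_sum_abs _

/-- Beyond `e` the positive logarithm is at least `1`, so the logarithmic factor only enlarges the
power; below `e` the power is at most `e ^ α`. -/
theorem ofReal_norm_sub_rpow_le {E : Type*} [NormedAddCommGroup E] (x w : E) {α β : ℝ}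
    (hα : 0 ≤ α) (hβ : 0 ≤ β) :
    ENNReal.ofReal (‖x - w‖ ^ α) ≤ ENNReal.ofReal (2 ^ α * (Real.exp 1 ^ α + ‖w‖ ^ α)) +
      ENNReal.ofReal (2 ^ α) * ENNReal.ofReal (‖x‖ ^ α * Real.posLog ‖x‖ ^ β) := by
  have hp : 0 ≤ Real.posLog ‖x‖ := Real.posLog_nonneg
  rw [← ENNReal.ofReal_mul (by positivity), ← ENNReal.ofReal_add (by positivity) (by positivity)]
  refine ENNReal.ofReal_le_ofReal ?_
  have h1 : ‖x‖ ^ α ≤ Real.exp 1 ^ α + ‖x‖ ^ α * Real.posLog ‖x‖ ^ β := by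
    rcases le_total ‖x‖ (Real.exp 1) with h | h
    · have := Real.rpow_le_rpow (norm_nonneg x) h hα
      have h2 : 0 ≤ ‖x‖ ^ α * Real.posLog ‖x‖ ^ β := by positivity
      linarith
    · have h3 : 1 ≤ Real.posLog ‖x‖ :=
        ((Real.le_log_iff_exp_le ((Real.exp_pos 1).trans_le h)).2 h).trans (le_max_right _ _)
      have h4 : ‖x‖ ^ α * 1 ≤ ‖x‖ ^ α * Real.posLog ‖x‖ ^ β := by
        gcongr; exact Real.one_le_rpow h3 hβ
      have h5 : 0 ≤ Real.exp 1 ^ α := by positivity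
      linarith
  have h2 : ‖x - w‖ ≤ 2 * max ‖x‖ ‖w‖ := by
    have := norm_sub_le x w
    have := le_max_left ‖x‖ ‖w‖
    have := le_max_right ‖x‖ ‖w‖
    linarith
  have h3 : max ‖x‖ ‖w‖ ^ α ≤ ‖x‖ ^ α + ‖w‖ ^ α := by
    have := Real.rpow_nonneg (norm_nonneg x) α
    have := Real.rpow_nonneg (norm_nonneg w) α
    rcases max_cases ‖x‖ ‖w‖ with h | h <;> rw [h.1] <;> linarith
  calc ‖x - w‖ ^ α ≤ (2 * max ‖x‖ ‖w‖) ^ α := Real.rpow_le_rpow (norm_nonneg _) h2 hα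
    _ = 2 ^ α * max ‖x‖ ‖w‖ ^ α := Real.mul_rpow two_pos.le (le_max_of_le_left (norm_nonneg _))
    _ ≤ 2 ^ α * ((Real.exp 1 ^ α + ‖x‖ ^ α * Real.posLog ‖x‖ ^ β) + ‖w‖ ^ α) := by
      gcongr; linarith
    _ = _ := by ring

theorem lintegral_innovation_markOp_ne_top [IsProbabilityMeasure P]
    (hX : ∀ u (j : ℕ) ω, (j : ℕ∞) < N u ω → IsSimilarity (X u j ω))
    (hmeas : ∀ u, Measurable (offspring N X u)) {w : EuclideanSpace ℝ (Fin d)} {α : ℝ}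
    (hα : 0 ≤ α) (hlog : HasLogMoment P N X w α) :
    ∫⁻ θ, ENNReal.ofReal (‖innovation markOp w θ‖ ^ α) ∂(P.map (mark N X [])) ≠ ∞ := by
  obtain ⟨ε, hε, h⟩ := hlog
  have hD : Measurable (innovation (markOp (d := d)) w) :=
    (Measurable.tsum fun j => (measurable_markOp j).apply_continuousLinearMap w).sub_const w
  rw [lintegral_map (hD.norm.pow_const α).ennreal_ofReal (measurable_mark hmeas [])]
  have h1 : ∀ ω, innovation markOp w (mark N X [] ω) = Z N X w 1 ω - w := fun ω => by
    rw [Z_eq_process hX, process_one, add_sub_cancel_right]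
  simp_rw [h1]
  refine ne_top_of_le_ne_top ?_ (lintegral_mono fun ω =>
    ofReal_norm_sub_rpow_le (Z N X w 1 ω) w hα (by linarith : 0 ≤ 2 + ε))
  rw [lintegral_add_left measurable_const, lintegral_const_mul' _ _ ENNReal.ofReal_ne_top,
    lintegral_const, measure_univ, mul_one]
  exact ENNReal.add_ne_top.2 ⟨ENNReal.ofReal_ne_top, ENNReal.mul_ne_top ENNReal.ofReal_ne_top h.ne⟩

/-- The mean matrix is defined entry by entry. Summability in operator norm allows the entries of
the first generation sum to be computed by separate series. -/
theorem ae_process_one_eq_sum [IsProbabilityMeasure P] {ν : Measure (ℕ → Fin d → Fin d → ℝ)}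
    {α : ℝ} (hX : ∀ u (j : ℕ) ω, (j : ℕ∞) < N u ω → IsSimilarity (X u j ω))
    (hB : IsBranching P ν (mark N X) markOp α)
    (hm : ∫⁻ θ, ∑' j, ENNReal.ofReal ‖markOp (d := d) j θ‖ ∂ν ≠ ∞)
    (w : EuclideanSpace ℝ (Fin d)) :
    ∀ᵐ ω ∂P, ∀ a, process markOp (mark N X) w 1 ω a =
      ∑ b, (∑' u : generation N 1 ω, weight X u ω a b) * w b := by
  filter_upwards [hB.ae_summable hm 1] with ω hω a
  have hs : Summable fun u : Word 1 => opWeight markOp (mark N X) u ω := hω.of_norm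
  set T := ∑' u : Word 1, opWeight markOp (mark N X) u ω with hT
  have h1 : ∀ v, process markOp (mark N X) v 1 ω = T v := fun v =>
    ((ContinuousLinearMap.apply ℝ (EuclideanSpace ℝ (Fin d)) v).hasSum hs.hasSum).tsum_eq
  have h2 : ∀ b, ∑' u : generation N 1 ω, weight X u ω a b = T (EuclideanSpace.single b 1) a := by
    intro b
    have h3 := ((EuclideanSpace.proj (𝕜 := ℝ) a).comp (ContinuousLinearMap.apply ℝ
      (EuclideanSpace ℝ (Fin d)) (EuclideanSpace.single b (1 : ℝ)))).hasSum hs.hasSum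
    have h4 := tsum_generation (F := fun T => T (EuclideanSpace.single b 1) a) hX rfl 1 ω
    simp only [toEuclideanCLM_single] at h4
    rw [h4]
    exact h3.tsum_eq
  rw [h1]
  have h5 := (EuclideanSpace.basisFun (Fin d) ℝ).sum_repr w
  conv_lhs => rw [← h5, map_sum]
  simp only [map_smul, EuclideanSpace.basisFun_repr, EuclideanSpace.basisFun_apply]
  rw [WithLp.ofLp_sum, Finset.sum_apply]
  refine Finset.sum_congr rfl fun b _ => ?_
  rw [h2, PiLp.smul_apply, smul_eq_mul, mul_comm]

theorem integral_process_one [IsProbabilityMeasure P] {ν : Measure (ℕ → Fin d → Fin d → ℝ)}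
    {α : ℝ} (hX : ∀ u (j : ℕ) ω, (j : ℕ∞) < N u ω → IsSimilarity (X u j ω))
    (hB : IsBranching P ν (mark N X) markOp α)
    (hm : ∫⁻ θ, ∑' j, ENNReal.ofReal ‖markOp (d := d) j θ‖ ∂ν ≠ ∞)
    (w : EuclideanSpace ℝ (Fin d)) :
    ∫ ω, process markOp (mark N X) w 1 ω ∂P = Matrix.toEuclideanLin (meanMatrix P N X) w := by
  have hcoord : ∀ (v : EuclideanSpace ℝ (Fin d)) a,
      Integrable (fun ω => process markOp (mark N X) v 1 ω a) P := fun v a =>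
    (EuclideanSpace.proj (𝕜 := ℝ) a).integrable_comp (hB.integrable_process hm v 1)
  have hint : ∀ a b, Integrable (fun ω => ∑' u : generation N 1 ω, weight X u ω a b) P := by
    intro a b
    refine (hcoord (EuclideanSpace.single b 1) a).congr ?_
    filter_upwards [ae_process_one_eq_sum hX hB hm (EuclideanSpace.single b 1)] with ω hω
    rw [hω a]
    simp
  ext a
  have h1 := (EuclideanSpace.proj (𝕜 := ℝ) a).integral_comp_comm (hB.integrable_process hm w 1)
  simp only [PiLp.proj_apply] at h1
  rw [← h1]
  have h2 : ∫ ω, process markOp (mark N X) w 1 ω a ∂P =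
      ∫ ω, ∑ b, (∑' u : generation N 1 ω, weight X u ω a b) * w b ∂P := by
    refine integral_congr_ae ?_
    filter_upwards [ae_process_one_eq_sum hX hB hm w] with ω hω
    exact hω a
  rw [h2, integral_finsetSum _ fun b _ => (hint a b).mul_const _]
  simp_rw [integral_mul_const]
  rw [Matrix.ofLp_toLpLin]
  rfl

end Transfer

end SimilarityBRW

/-! ### The main theorem -/

theorem mainTheorem2 {d : ℕ} {Ω : Type*} [MeasurableSpace Ω]
    (P : Measure Ω) [IsProbabilityMeasure P]
    (N : List ℕ → Ω → ℕ∞) (X : List ℕ → ℕ → Ω → Matrix (Fin d) (Fin d) ℝ)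
    (hX : ∀ (u : List ℕ) (j : ℕ) (ω : Ω), (j : ℕ∞) < N u ω → SimilarityBRW.IsSimilarity (X u j ω))
    (hmeas : ∀ u : List ℕ, Measurable (SimilarityBRW.offspring N X u))
    (hindep : iIndepFun (SimilarityBRW.offspring N X) P)
    (hident : ∀ u : List ℕ,
      IdentDistrib (SimilarityBRW.offspring N X u) (SimilarityBRW.offspring N X []) P P)
    (hsuper : 1 < ∫⁻ ω, (N [] ω : ℝ≥0∞) ∂P)
    (hmean : SimilarityBRW.HasFiniteMean P N X)
    (w : EuclideanSpace ℝ (Fin d)) (hw : w ≠ 0)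
    (heig : Matrix.toEuclideanLin (SimilarityBRW.meanMatrix P N X) w = w)
    (hnontriv : ¬ ∀ᵐ ω ∂P, SimilarityBRW.Z N X w 1 ω = w)
    (α : ℝ) (hα1 : 1 < α) (hα2 : α < 2)
    (hC1 : SimilarityBRW.IsCharacteristicIndex P N X α)
    (hC2 : SimilarityBRW.HasLogMoment P N X w α) :
    (∀ n : ℕ, ∀ᵐ ω ∂P, Summable fun u : SimilarityBRW.generation N n ω =>
      ‖SimilarityBRW.weight X u ω‖) ∧
    ∃ Zw : Ω → EuclideanSpace ℝ (Fin d), Measurable Zw ∧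
      (∀ᵐ ω ∂P, Tendsto (fun n : ℕ => SimilarityBRW.Z N X w n ω) atTop (𝓝 (Zw ω))) ∧
      (∀ p : ℝ, 0 < p → p < α →
        (∀ n : ℕ, MemLp (SimilarityBRW.Z N X w n) (ENNReal.ofReal p) P) ∧
        MemLp Zw (ENNReal.ofReal p) P ∧
        Tendsto (fun n : ℕ => eLpNorm (SimilarityBRW.Z N X w n - Zw) (ENNReal.ofReal p) P)
          atTop (𝓝 0)) ∧
      ¬ ∃ c : EuclideanSpace ℝ (Fin d), ∀ᵐ ω ∂P, Zw ω = c := by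
  open SimilarityBRW in
  have : Nontrivial (EuclideanSpace ℝ (Fin d)) := ⟨w, 0, hw⟩
  have hM := measurable_mark hmeas []
  have : IsProbabilityMeasure (P.map (mark N X [])) :=
    Measure.isProbabilityMeasure_map hM.aemeasurable
  have hB := isBranching_mark hX hmeas hindep hident hsuper (by linarith : α ≠ 0)
    hC1.moment_eq_one
  have hm := lintegral_tsum_norm_markOp_ne_top hX hmeas hmean
  have hDα := lintegral_innovation_markOp_ne_top hX hmeas (by linarith) hC2
  have hDm := (hB.measurable_innovation w).aestronglyMeasurable (μ := P.map (mark N X []))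
  have hZ1 : ∀ ω, innovation markOp w (mark N X [] ω) = process markOp (mark N X) w 1 ω - w :=
    fun ω => by rw [process_one, add_sub_cancel_right]
  have hDi : Integrable (innovation markOp w) (P.map (mark N X [])) := by
    rw [integrable_map_measure hDm hM.aemeasurable]
    refine ((hB.integrable_process hm w 1).sub (integrable_const w)).congr
      (ae_of_all _ fun ω => (hZ1 ω).symm)
  -- Here the eigenvalue `1` enters: the first generation sum has mean `w`.
  have hD0 : ∫ θ, innovation markOp w θ ∂(P.map (mark N X [])) = 0 := by
    rw [integral_map hM.aemeasurable hDm]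
    simp_rw [hZ1]
    rw [integral_sub (hB.integrable_process hm w 1) (integrable_const w),
      integral_process_one hX hB hm, heig]
    simp
  refine ⟨fun n => ?_, ?_⟩
  · filter_upwards [hB.ae_summable hm n] with ω hω
    exact (summable_generation (F := fun T => ‖T‖) hX norm_zero n ω).2 hω
  · simp_rw [Z_eq_process hX] at hnontriv ⊢
    obtain ⟨Zw, hZ, hlim⟩ := hB.exists_ae_tendsto_process hα1 hα2 hm hDi hD0 hDα
    refine ⟨Zw, hZ, hlim, fun p _ hp => hB.tendsto_eLpNorm_process hα1 hα2 hm hDi hD0 hDα hZ hlim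
      hp, ?_⟩
    -- Non-degeneracy uses convergence in `L^1`, available because `1 < α`.
    have h1 := (hB.tendsto_eLpNorm_process hα1 hα2 hm hDi hD0 hDα hZ hlim hα1).2.2
    rw [ENNReal.ofReal_one] at h1
    exact hB.not_ae_eq_const hm hDi hD0 h1 hnontriv
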